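/- Fix an integer $m\ge 2$. Let $\mathcal D=\{\omega\in\mathbb C:\ \omega^m\in[-1,1]\times[-1,1]\}$, and for $0\le\alpha<\beta\le1$ let $\mathcal D(\alpha,\beta)$ be the set of $\omega\in\mathcal D\setminus\{0\}$ with argument (taken in $[0,2\pi)$) in $(2\pi\alpha,2\pi\beta)$, and $\overline{\mathcal D}(\alpha,\beta)$ its closure. Let $\theta_0=e^{\pi i/m}$, $\theta=\theta_0^2$, $G_0(\rho e^{it})=\rho^{1/m}e^{it/m}$ for $t\in[0,2\pi)$ and $G_l=\theta^lG_0$ for $0\le l<m$. For $f:\mathcal D\to\mathbb C$ put $$\mathscr F_{f,l}(u,s)=\int_{-1}^u\frac{f(G_l(v+is))}{(v^2+s^2)^{\frac{m-1}m}}\,dv,\qquad F_f(\omega)=\mathscr F_{f,l}(\Re\omega^m,\Im\omega^m)\ \text{ on }\mathcal D(\tfrac lm,\tfrac{l+1}m),\ 0\le l<m .$$ For $k\ge0$ let $\mathfrak o(k)=\frac{k-(m-2)}m$ and $\widehat{\mathfrak o}(k)=k-(m-2)$. Call $i$ relevant for $k$ if $0\le i\le\min(k,m-2)$ and $i\not\equiv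 k-(m-1)\pmod m$; for relevant $i$ let $$\partial^k_i(f)=\sum_{0\le n\le\frac{k-i}m}\frac{\binom k{i+nm}\binom{\frac{(m-1)-i}m-1}n}{\binom{\frac{(k-i)-(m-1)}m}n}\,\frac{\partial^kf}{\partial\omega^{i+nm}\partial\overline\omega^{\,k-i-nm}}(0),$$ and for $0\le l<2m$ let $$\mathscr C^k_l(f)=\sum_{i\text{ relevant for }k}\theta_0^{l(2i-k)}\,\mathfrak B\big(\tfrac{(m-1)-i}m,\tfrac{(m-1)-(k-i)}m\big)\,\partial^k_i(f),\qquad \mathfrak B(x,y)=\frac{\pi e^{\frac{i\pi}2(y-x)}}{2^{x+y-2}}\frac{\Gamma(x+y-1)}{\Gamma(x)\Gamma(y)}\quad(x,y\notin\mathbb Z),$$ where in the exponential $i$ is the imaginary unit, and $\Gamma(-n)$ is read as $(-1)^n/n!$ for integers $n\ge0$. Let $\eta(x)=-x\log x$ for $0\le x\le e^{-1}$, $\eta(x)=e^{-1}$ for $x\ge e^{-1}$, and let $\mathbb R_\eta=(\mathbb R_{>-1}\setminus\mathbb Z)\cup(\mathbb Z_{\ge-1}+\eta)$, with $v(r)=r$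 for real $r$ and $v(n+\eta)=n+1$. For $v(r)>0$, a function is of class $C^r$ if, when $r=n+a$ with an integer $n\ge 0$ and $0<a<1$, it is $C^n$ with $a$-Hölder $n$-th derivative, and, when $r=n+\eta$, it is $C^n$ and its $n$-th derivative has a multiple of $\eta$ as a modulus of continuity. **Theorem.** Let $k\ge m-1$, $0\le l<2m$ and $n=\lceil\mathfrak o(k)\rceil$. Let $f\in C^{\max(k,n+1)}(\mathcal D)$, and suppose that for some $r\in\mathbb R_\eta$ with $0<v(r)\le\mathfrak o(k)$ the function $F_f$ on $\mathcal D(\frac l{2m},\frac{l+1}{2m})$ has a $C^r$-extension to $\overline{\mathcal D}(\frac l{2m},\frac{l+1}{2m})$. Then 1. $\mathscr C^j_l(f)=0$ for all $j\ge0$ with $\mathfrak o(j)<v(r)$; 2. $\partial^j_i(f)=0$ for all $j\ge0$ with $\widehat{\mathfrak o}(j)<v(r)$ and all $i$ relevant for $j$, i.e. $0\le i\le\min(j,m-2)$ with $i\not\equiv j-(m-1)\pmod m$. -/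

import Mathlib

namespace SaddleLocal

/-! ### Branches of the root, the domain and its sectors -/

/-- The argument of a complex number, normalised to lie in `[0, 2π)`. -/
noncomputable def arg0 (z : ℂ) : ℝ :=
  if 0 ≤ z.arg then z.arg else z.arg + 2 * Real.pi

/-- The principal `m`-th root of unity `θ`. -/
noncomputable def theta (m : ℕ) : ℂ := Complex.exp (2 * Real.pi * Complex.I / m)

/-- The principal `2m`-th root of unity `θ₀`. -/
noncomputable def theta0 (m : ℕ) : ℂ := Complex.exp (Real.pi * Complex.I / m)

/-- The `l`-th branch `G_l = θ ^ l G_0` of the `m`-th root, where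
`G_0 (r e^{it}) = r^{1/m} e^{it/m}` for `t ∈ [0, 2π)`. -/
noncomputable def rootBranch (m l : ℕ) (z : ℂ) : ℂ :=
  theta m ^ l * ((‖z‖ ^ (1 / (m : ℝ)) : ℝ) : ℂ) * Complex.exp (arg0 z / m * Complex.I)

/-- The set `𝒟`: the preimage of the square `[-1,1] × [-1,1]` under `ω ↦ ω ^ m`. -/
def domainD (m : ℕ) : Set ℂ :=
  {w | (w ^ m).re ∈ Set.Icc (-1 : ℝ) 1 ∧ (w ^ m).im ∈ Set.Icc (-1 : ℝ) 1}

/-- The angular sector `𝒟(α, β)` (for `0 ≤ α < β ≤ 1`): the nonzero points of `𝒟` with argument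
in `(2πα, 2πβ)`. -/
def sector (m : ℕ) (α β : ℝ) : Set ℂ :=
  {w | w ∈ domainD m ∧ ∃ ρ t : ℝ, 0 < ρ ∧ t ∈ Set.Ioo (2 * Real.pi * α) (2 * Real.pi * β) ∧
    w = ρ * Complex.exp (t * Complex.I)}

/-! ### The functions `ℱ_{f,l}` and `F_f` -/

/-- `ℱ_{f,l}(u,s) = ∫_{-1}^u f(G_l(v,s)) / (v² + s²)^{(m-1)/m} dv`. -/
noncomputable def scriptF (m : ℕ) (f : ℂ → ℂ) (l : ℕ) (u s : ℝ) : ℂ :=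
  ∫ v in (-1 : ℝ)..u,
    f (rootBranch m l ⟨v, s⟩) / (((v ^ 2 + s ^ 2) ^ (((m : ℝ) - 1) / m) : ℝ) : ℂ)

/-- `F_f(ω) = ℱ_{f,l}(ω ^ m)` for `ω` in the open sector with argument in
`(2πl/m, 2π(l+1)/m)`; there `⌊m Arg(ω) / 2π⌋ = l`. -/
noncomputable def FF (m : ℕ) (f : ℂ → ℂ) (w : ℂ) : ℂ :=
  scriptF m f ⌊(m : ℝ) * arg0 w / (2 * Real.pi)⌋₊ (w ^ m).re (w ^ m).im

/-! ### The grading of smoothness -/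

/-- `η(x) = -x log x` for `x ∈ [0, 1/e]` and `η(x) = 1/e` for `x ≥ 1/e`. -/
noncomputable def eta (x : ℝ) : ℝ :=
  if x ≤ Real.exp (-1) then -(x * Real.log x) else Real.exp (-1)

/-- The set of exponents `ℝ_η = (ℝ_{>-1} \ ℤ) ∪ (ℤ_{≥-1} + η)`. -/
inductive REta : Type
  | real (r : ℝ) (hr : -1 < r) (hZ : ∀ z : ℤ, r ≠ z) : REta
  | addEta (n : ℤ) (hn : -1 ≤ n) : REta

/-- The numerical value of an exponent: `v(r) = r` and `v(n + η) = n + 1`. -/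
def REta.v : REta → ℝ
  | .real r _ _ => r
  | .addEta n _ => n + 1

/-- `g` is of class `C ^ n` on `S` and a multiple of `ϖ` is a modulus of continuity of its `n`-th
derivative on `S`. -/
def IsCMod (n : ℕ) (ϖ : ℝ → ℝ) (S : Set ℂ) (g : ℂ → ℂ) : Prop :=
  ContDiffOn ℝ n g S ∧ ∃ C : ℝ, ∀ x ∈ S, ∀ y ∈ S,
    ‖iteratedFDerivWithin ℝ n g S x - iteratedFDerivWithin ℝ n g S y‖ ≤ C * ϖ ‖x - y‖

/-- The class `C ^ r(S)` for an exponent `r` with `v(r) > 0`: for a real (non-integer) exponent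
`r = n + a` with `n = ⌊r⌋` and `0 < a < 1` the `n`-th derivative is `a`-Hölder, for `n + η` the
`n`-th derivative has a multiple of `η` as a modulus of continuity. -/
def IsCr : REta → Set ℂ → (ℂ → ℂ) → Prop
  | .real r _ _, S, g => IsCMod ⌊r⌋₊ (fun t => t ^ Int.fract r) S g
  | .addEta n _, S, g => IsCMod n.toNat eta S g

/-- `g`, given on `S`, is of class `C ^ r` on the closure of `S`, that is, it has a
`C ^ r`-extension from `S` to the closure of `S`. -/
def IsCrOnClosure (r : REta) (S : Set ℂ) (g : ℂ → ℂ) : Prop :=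
  ∃ h : ℂ → ℂ, Set.EqOn h g S ∧ IsCr r (closure S) h

/-! ### Orders and functionals -/

/-- The order `𝔬(σ,k) = (k - (m-2)) / m`. -/
noncomputable def ord (m k : ℕ) : ℝ := ((k : ℝ) - ((m : ℝ) - 2)) / m

/-- The order `𝔬̂(σ,k) = k - (m-2)`. -/
def ordHat (m k : ℕ) : ℝ := (k : ℝ) - ((m : ℝ) - 2)

/-- The Wirtinger derivative `∂/∂ω = (∂/∂x - i ∂/∂y) / 2`. -/
noncomputable def dW (f : ℂ → ℂ) (w : ℂ) : ℂ :=
  (fderiv ℝ f w 1 - Complex.I * fderiv ℝ f w Complex.I) / 2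

/-- The Wirtinger derivative `∂/∂ω̄ = (∂/∂x + i ∂/∂y) / 2`. -/
noncomputable def dWbar (f : ℂ → ℂ) (w : ℂ) : ℂ :=
  (fderiv ℝ f w 1 + Complex.I * fderiv ℝ f w Complex.I) / 2

/-- `∂^{a+b} f / ∂ω^a ∂ω̄^b (0,0)`. -/
noncomputable def wirtinger (a b : ℕ) (f : ℂ → ℂ) : ℂ := dW^[a] (dWbar^[b] f) 0

/-- The index `j` is relevant for order `k`: `0 ≤ j ≤ min k (m-2)` and
`j ≠ k - (m-1) mod m`. -/
def Relevant (m k j : ℕ) : Prop :=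
  j ≤ min k (m - 2) ∧ ¬ ((j : ℤ) ≡ (k : ℤ) - ((m : ℤ) - 1) [ZMOD (m : ℤ)])

instance (m k j : ℕ) : Decidable (Relevant m k j) := by
  unfold Relevant; infer_instance

/-- The functional `∂^k_j(f)`; `Ring.choose x n = x (x-1) ⋯ (x-n+1) / n!` is the generalised
binomial coefficient of a real number `x`. -/
noncomputable def partialFun (m k j : ℕ) (f : ℂ → ℂ) : ℂ :=
  ∑ n ∈ Finset.range ((k - j) / m + 1),
    (((k.choose (j + n * m) : ℝ) * Ring.choose (((m : ℝ) - 1 - j) / m - 1) n /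
      Ring.choose (((k : ℝ) - j - ((m : ℝ) - 1)) / m) n : ℝ) : ℂ) *
      wirtinger (j + n * m) (k - j - n * m) f

/-- The Gamma function with the convention `Γ(-n) = (-1)^n / n!` for `n = 0, 1, 2, …`. -/
noncomputable def gammaExt (x : ℝ) : ℝ :=
  if x = -(⌊-x⌋₊ : ℝ) then (-1) ^ ⌊-x⌋₊ / (Nat.factorial ⌊-x⌋₊ : ℝ) else Real.Gamma x

/-- The beta-like function
`𝔅(x,y) = π e^{iπ(y-x)/2} / 2^{x+y-2} · Γ(x+y-1) / (Γ(x) Γ(y))`, for `x, y` not integers. -/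
noncomputable def betaLike (x y : ℝ) : ℂ :=
  Real.pi * Complex.exp (Complex.I * (Real.pi / 2) * (y - x)) / (((2 : ℝ) ^ (x + y - 2) : ℝ) : ℂ) *
    ((gammaExt (x + y - 1) / (gammaExt x * gammaExt y) : ℝ) : ℂ)

/-- The functional `𝒞^k_l(f)`. -/
noncomputable def scriptC (m k l : ℕ) (f : ℂ → ℂ) : ℂ :=
  ∑ j ∈ (Finset.range (min k (m - 2) + 1)).filter (Relevant m k),
    theta0 m ^ ((l : ℤ) * (2 * (j : ℤ) - (k : ℤ))) *
      betaLike (((m : ℝ) - 1 - j) / m) (((m : ℝ) - 1 - ((k : ℝ) - j)) / m) * partialFun m k j f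

end SaddleLocal

/-! The map `sroot m l`, `z ↦ θ₀^l z^(1/m)`, opens the sector up to the upper half plane. There the
horizontal differences of `F_f` are, up to the sign `(-1)^l`, the integrals of `integrand`, which is
`f (sroot m l z)` times a power of `|z|` (`FF_sub`). A Taylor monomial `w^a w̄^(j-a)` of `f` turns
into the kernel `z^(-x) * conj (z^(-y))` with `x = expo m a`, `y = expo m (j-a)` and `x + y = 1 -
ord m j`. Hence the degree `j` part of `f` contributes a part of degree `ord m j` in `z`, that is
`ordHat m j = m * ord m j` in `w`. Both conclusions isolate this part and test it against the
smoothness of `F_f`.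

Conclusion 2 looks at the origin. A `C^r` function has an expansion in homogeneous polynomials in
`w, w̄` with error `o(|w|^β)` for every `β < v(r)`. Scaling two points of one horizontal line
towards 0 and comparing powers shows that, if `ordHat m j < v(r)`, the degree `j` part of the
integrals is a difference of values of a polynomial (`exists_homogeneous_primitive`).
Differentiating this polynomial and comparing coefficients on the unit circle gives a two-term
relation between its coefficients and the Taylor coefficients of `f` (`coeff_relation`). Along a
residue class mod `m` the relation telescopes with the weights `chooseRatio`, and what remains is
`∂^j_i(f) = 0` (`partialFun_eq_zero_of_coeff_relation`).

Conclusion 1 looks at two boundary points `sroot m l (±δ)` away from the origin, where the root is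
regular and height `s` in `z` corresponds to distance `O(s)` in `w`; so the threshold is `ord` and
not `ordHat`. The `p`-th vertical differences of `F_f` with step `s` are `o(s^(ord m j))` there
(`fwdDiff_comp_sroot_isLittleO`). Their difference is also the integral over `[-δ, δ]` of the `p`-th
differences of the integrand, in which the degree `i` part gives `s^(ord m i)` times a constant, up
to `O(s^p)`. Taking differences is what makes the integrals over the whole line converge. So the
constant for `i = j` vanishes (`sum_hcoeff_mul_regInt_eq_zero`).

It remains to identify that constant. Modulo horizontal derivatives, which integrate to 0, a
vertical derivative of the kernel raises `y` by one; so the regularised integral is a positive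
weight, common to one degree, times a Pochhammer product times a convergent Cauchy beta integral
(`regInt_eq`). The latter is evaluated by Fourier duality between Gamma densities (`cauchyBeta_eq`).
Integration by parts links the values along a residue class mod `m` through the same weights
`chooseRatio`, and the two exceptional classes contribute 0. The sum is thereby proportional to
`𝒞^j_l(f)` (`scriptC_eq_mul_sum`). -/

namespace SaddleLocal
open Filter Topology Asymptotics ComplexConjugate

/-! ### Wirtinger calculus -/

theorem fderiv_apply_eq_dW (f : ℂ → ℂ) (w v : ℂ) :
    fderiv ℝ f w v = dW f w * v + dWbar f w * conj v := by
  have h : fderiv ℝ f w v = v.re * fderiv ℝ f w 1 + v.im * fderiv ℝ f w Complex.I := by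
    conv_lhs => rw [show v = v.re • (1 : ℂ) + v.im • Complex.I by
      simp [Complex.re_add_im]]
    rw [map_add, map_smul, map_smul]; simp
  rw [h, dW, dWbar]
  conv_rhs => rw [← Complex.re_add_im v]
  simp only [map_add, map_mul, Complex.conj_ofReal, Complex.conj_I]
  ring_nf
  rw [Complex.I_sq]; ring

theorem dW_eventuallyEq {f g : ℂ → ℂ} {w : ℂ} (h : f =ᶠ[𝓝 w] g) : dW f =ᶠ[𝓝 w] dW g := by
  filter_upwards [h.fderiv (𝕜 := ℝ)] with z hz
  simp [dW, hz]

theorem dWbar_eventuallyEq {f g : ℂ → ℂ} {w : ℂ} (h : f =ᶠ[𝓝 w] g) :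
    dWbar f =ᶠ[𝓝 w] dWbar g := by
  filter_upwards [h.fderiv (𝕜 := ℝ)] with z hz
  simp [dWbar, hz]

theorem dW_iterate_eventuallyEq {f g : ℂ → ℂ} {w : ℂ} (h : f =ᶠ[𝓝 w] g) (n : ℕ) :
    dW^[n] f =ᶠ[𝓝 w] dW^[n] g := by
  induction n generalizing f g with
  | zero => exact h
  | succ n ih => exact ih (dW_eventuallyEq h)

theorem dWbar_iterate_eventuallyEq {f g : ℂ → ℂ} {w : ℂ} (h : f =ᶠ[𝓝 w] g) (n : ℕ) :
    dWbar^[n] f =ᶠ[𝓝 w] dWbar^[n] g := by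
  induction n generalizing f g with
  | zero => exact h
  | succ n ih => exact ih (dWbar_eventuallyEq h)

theorem contDiffAt_fderiv_apply {f : ℂ → ℂ} {w : ℂ} {n : ℕ}
    (hf : ContDiffAt ℝ (n + 1 : ℕ) f w) (v : ℂ) :
    ContDiffAt ℝ n (fun z => fderiv ℝ f z v) w :=
  (hf.fderiv_right (m := n) (by norm_cast)).clm_apply contDiffAt_const

theorem contDiffAt_dW {f : ℂ → ℂ} {w : ℂ} {n : ℕ} (hf : ContDiffAt ℝ (n + 1 : ℕ) f w) :
    ContDiffAt ℝ n (dW f) w :=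
  ((contDiffAt_fderiv_apply hf 1).sub
    (contDiffAt_const.mul (contDiffAt_fderiv_apply hf Complex.I))).div_const 2

theorem contDiffAt_dWbar {f : ℂ → ℂ} {w : ℂ} {n : ℕ} (hf : ContDiffAt ℝ (n + 1 : ℕ) f w) :
    ContDiffAt ℝ n (dWbar f) w :=
  ((contDiffAt_fderiv_apply hf 1).add
    (contDiffAt_const.mul (contDiffAt_fderiv_apply hf Complex.I))).div_const 2

theorem contDiffAt_dWbar_iterate {f : ℂ → ℂ} {w : ℂ} {n a : ℕ}
    (hf : ContDiffAt ℝ (n + a : ℕ) f w) : ContDiffAt ℝ n (dWbar^[a] f) w := by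
  induction a generalizing f with
  | zero => exact hf
  | succ a ih => exact ih (contDiffAt_dWbar hf)

theorem eventually_contDiffAt {f : ℂ → ℂ} {w : ℂ} {n : ℕ} (hf : ContDiffAt ℝ n f w) :
    ∀ᶠ z in 𝓝 w, ContDiffAt ℝ n f z :=
  hf.eventually (by simp)

theorem dWbar_dW_comm {f : ℂ → ℂ} {w : ℂ} (hf : ContDiffAt ℝ 2 f w) :
    dWbar (dW f) w = dW (dWbar f) w := by
  have hs := hf.isSymmSndFDerivAt (by simp)
  have hd : DifferentiableAt ℝ (fderiv ℝ f) w :=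
    (hf.fderiv_right (m := 1) (by norm_num)).differentiableAt (by norm_num)
  have hv : ∀ v : ℂ, HasFDerivAt (fun z => fderiv ℝ f z v) ((fderiv ℝ (fderiv ℝ f) w).flip v) w :=
    fun v => by
      have := hd.hasFDerivAt.clm_apply (hasFDerivAt_const v w)
      convert! this using 1
      ext; simp
  have h1 : HasFDerivAt (dW f) ((2 : ℂ)⁻¹ • ((fderiv ℝ (fderiv ℝ f) w).flip 1 -
      Complex.I • (fderiv ℝ (fderiv ℝ f) w).flip Complex.I)) w := by
    have := ((hv 1).sub ((hv Complex.I).const_smul Complex.I)).const_smul ((2 : ℂ)⁻¹)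
    refine this.congr_of_eventuallyEq (Eventually.of_forall fun z => ?_)
    simp [dW]; ring
  have h2 : HasFDerivAt (dWbar f) ((2 : ℂ)⁻¹ • ((fderiv ℝ (fderiv ℝ f) w).flip 1 +
      Complex.I • (fderiv ℝ (fderiv ℝ f) w).flip Complex.I)) w := by
    have := ((hv 1).add ((hv Complex.I).const_smul Complex.I)).const_smul ((2 : ℂ)⁻¹)
    refine this.congr_of_eventuallyEq (Eventually.of_forall fun z => ?_)
    simp [dWbar]; ring
  have hs1 := hs 1 Complex.I
  rw [dWbar, dW, h1.fderiv, h2.fderiv]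
  simp only [smul_apply, sub_apply,
    add_apply, ContinuousLinearMap.flip_apply, smul_eq_mul, hs1]
  ring

/-- Since `wirtinger` applies the `dWbar` first, an additional `dW` at the inside has to be carried
across them. This lets inductions on the order replace a function by its two first Wirtinger
derivatives. -/
theorem dWbar_iterate_dW {f : ℂ → ℂ} {w : ℂ} {b : ℕ} (hf : ContDiffAt ℝ (b + 1 : ℕ) f w) :
    dWbar^[b] (dW f) =ᶠ[𝓝 w] dW (dWbar^[b] f) := by
  induction b with
  | zero => exact EventuallyEq.rfl
  | succ b ih =>
    rw [Function.iterate_succ_apply', Function.iterate_succ_apply']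
    refine (dWbar_eventuallyEq (ih (hf.of_le (by norm_cast; omega)))).trans ?_
    have h2 : ContDiffAt ℝ (2 : ℕ) (dWbar^[b] f) w :=
      contDiffAt_dWbar_iterate (hf.of_le (by norm_cast; omega))
    filter_upwards [eventually_contDiffAt h2] with z hz
    exact dWbar_dW_comm (by exact_mod_cast hz)

theorem wirtinger_dW {f : ℂ → ℂ} {a b : ℕ} (hf : ContDiffAt ℝ (a + b + 1 : ℕ) f 0) :
    wirtinger a b (dW f) = wirtinger (a + 1) b f := by
  have h := dWbar_iterate_dW (b := b) (hf.of_le (by norm_cast; omega))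
  exact (dW_iterate_eventuallyEq h a).self_of_nhds

theorem wirtinger_dWbar (f : ℂ → ℂ) (a b : ℕ) :
    wirtinger a b (dWbar f) = wirtinger a (b + 1) f := rfl

/-- By induction both first Wirtinger derivatives are `O(|w|^k)`, and they control the full
derivative. The mean value inequality on the ball of radius `|w|` supplies the last factor `|w|`. -/
theorem wirtinger_isBigO {k : ℕ} {g : ℂ → ℂ} (hg : ContDiffAt ℝ k g 0)
    (h0 : ∀ a b, a + b < k → wirtinger a b g = 0) :
    g =O[𝓝 0] fun w => ‖w‖ ^ k := by
  induction k generalizing g with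
  | zero =>
    simpa using hg.continuousAt.norm.isBoundedUnder_le.isBigO_one ℝ
  | succ k ih =>
    have h1 := ih (contDiffAt_dW hg) fun a b hab => by
      rw [wirtinger_dW (hg.of_le (by norm_cast; omega))]; exact h0 _ _ (by omega)
    have h2 := ih (contDiffAt_dWbar hg) fun a b hab => by
      rw [wirtinger_dWbar]; exact h0 _ _ (by omega)
    obtain ⟨C1, hC1, h1⟩ := h1.exists_pos
    obtain ⟨C2, hC2, h2⟩ := h2.exists_pos
    have hd : ∀ᶠ z in 𝓝 (0 : ℂ), DifferentiableAt ℝ g z :=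
      (eventually_contDiffAt hg).mono fun z hz => hz.differentiableAt (by simp)
    obtain ⟨ε, hε, hb⟩ := Metric.eventually_nhds_iff_ball.1 (hd.and (h1.bound.and h2.bound))
    refine IsBigO.of_bound (C1 + C2) ?_
    filter_upwards [Metric.ball_mem_nhds 0 hε] with w hw
    have hw' : ‖w‖ < ε := by simpa using hw
    have hg0 : g 0 = 0 := h0 0 0 (by omega)
    have := (convex_closedBall (0 : ℂ) ‖w‖).norm_image_sub_le_of_norm_fderiv_le
      (𝕜 := ℝ) (f := g) (C := (C1 + C2) * ‖w‖ ^ k) (x := 0) (y := w)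
      (fun z hz => (hb z (by simp at hz ⊢; linarith)).1)
      (fun z hz => by
        have hz' : ‖z‖ ≤ ‖w‖ := by simpa using hz
        obtain ⟨-, b1, b2⟩ := hb z (by simp; linarith)
        refine ContinuousLinearMap.opNorm_le_bound _ (by positivity) fun v => ?_
        rw [fderiv_apply_eq_dW]
        refine (norm_add_le _ _).trans ?_
        rw [norm_mul, norm_mul, RCLike.norm_conj, ← add_mul]
        refine mul_le_mul_of_nonneg_right ?_ (norm_nonneg v)
        have : ‖z‖ ^ k ≤ ‖w‖ ^ k := by gcongr
        simp only [norm_pow, norm_norm] at b1 b2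
        nlinarith)
      (by simp) (by simp)
    simpa [hg0, pow_succ, mul_assoc] using this

/-! ### Monomials and the Taylor polynomial -/

/-- The monomial `w ^ a * conj w ^ b`. -/
noncomputable def wmono (a b : ℕ) (w : ℂ) : ℂ := w ^ a * conj w ^ b

theorem contDiff_wmono (a b : ℕ) {n : WithTop ℕ∞} : ContDiff ℝ n (wmono a b) :=
  (contDiff_id.pow a).mul (Complex.conjCLE.contDiff.pow b)

theorem hasFDerivAt_wmono (a b : ℕ) (w : ℂ) :
    HasFDerivAt (wmono a b) ((a * wmono (a - 1) b w) • (ContinuousLinearMap.id ℝ ℂ) +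
      (b * wmono a (b - 1) w) • (Complex.conjCLE : ℂ →L[ℝ] ℂ)) w := by
  have h1 := ((hasFDerivAt_id (𝕜 := ℝ) w).pow a).mul
    ((Complex.conjCLE : ℂ →L[ℝ] ℂ).hasFDerivAt (x := w) |>.pow b)
  convert! h1 using 1
  ext
  simp [wmono]; ring

theorem dW_const_mul_wmono (c : ℂ) (a b : ℕ) :
    dW (fun w => c * wmono a b w) = fun w => (c * a) * wmono (a - 1) b w := by
  funext w
  rw [dW, ((hasFDerivAt_wmono a b w).const_mul c).fderiv]
  simp; ring_nf; rw [Complex.I_sq]; ring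

theorem dWbar_const_mul_wmono (c : ℂ) (a b : ℕ) :
    dWbar (fun w => c * wmono a b w) = fun w => (c * b) * wmono a (b - 1) w := by
  funext w
  rw [dWbar, ((hasFDerivAt_wmono a b w).const_mul c).fderiv]
  simp; ring_nf; rw [Complex.I_sq]; ring

theorem dW_iterate_const_mul_wmono (c : ℂ) (a b n : ℕ) :
    dW^[n] (fun w => c * wmono a b w) = fun w => (c * a.descFactorial n) * wmono (a - n) b w := by
  induction n with
  | zero => simp
  | succ n ih =>
    rw [Function.iterate_succ_apply', ih, dW_const_mul_wmono]
    funext w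
    rw [Nat.descFactorial_succ, Nat.sub_sub]; push_cast; ring

theorem dWbar_iterate_const_mul_wmono (c : ℂ) (a b n : ℕ) :
    dWbar^[n] (fun w => c * wmono a b w) =
      fun w => (c * b.descFactorial n) * wmono a (b - n) w := by
  induction n with
  | zero => simp
  | succ n ih =>
    rw [Function.iterate_succ_apply', ih, dWbar_const_mul_wmono]
    funext w
    rw [Nat.descFactorial_succ, Nat.sub_sub]; push_cast; ring

theorem wirtinger_const_mul_wmono (c : ℂ) (a b a' b' : ℕ) :
    wirtinger a b (fun w => c * wmono a' b' w) =
      if a = a' ∧ b = b' then c * (a.factorial * b.factorial) else 0 := by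
  rw [wirtinger, dWbar_iterate_const_mul_wmono, dW_iterate_const_mul_wmono]
  simp only [wmono, map_zero]
  split_ifs with h
  · obtain ⟨rfl, rfl⟩ := h
    simp [Nat.descFactorial_self]; ring
  · rcases lt_trichotomy a a' with h1 | h1 | h1
    · rw [zero_pow (by omega)]; simp
    · rcases lt_trichotomy b b' with h2 | h2 | h2
      · rw [zero_pow (n := b' - b) (by omega)]; simp
      · exact absurd ⟨h1, h2⟩ h
      · rw [Nat.descFactorial_of_lt h2]; simp
    · rw [Nat.descFactorial_of_lt h1]; simp

theorem dW_add_eventuallyEq {f g : ℂ → ℂ} {w : ℂ} (hf : ContDiffAt ℝ 1 f w)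
    (hg : ContDiffAt ℝ 1 g w) : dW (f + g) =ᶠ[𝓝 w] dW f + dW g := by
  filter_upwards [eventually_contDiffAt (n := 1) (by exact_mod_cast hf),
    eventually_contDiffAt (n := 1) (by exact_mod_cast hg)] with z h1 h2
  simp only [dW, Pi.add_apply]
  rw [fderiv_add (h1.differentiableAt (by simp)) (h2.differentiableAt (by simp))]
  simp; ring

theorem dWbar_add_eventuallyEq {f g : ℂ → ℂ} {w : ℂ} (hf : ContDiffAt ℝ 1 f w)
    (hg : ContDiffAt ℝ 1 g w) : dWbar (f + g) =ᶠ[𝓝 w] dWbar f + dWbar g := by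
  filter_upwards [eventually_contDiffAt (n := 1) (by exact_mod_cast hf),
    eventually_contDiffAt (n := 1) (by exact_mod_cast hg)] with z h1 h2
  simp only [dWbar, Pi.add_apply]
  rw [fderiv_add (h1.differentiableAt (by simp)) (h2.differentiableAt (by simp))]
  simp; ring

theorem dW_iterate_add {f g : ℂ → ℂ} {w : ℂ} {n : ℕ} (hf : ContDiffAt ℝ n f w)
    (hg : ContDiffAt ℝ n g w) : dW^[n] (f + g) =ᶠ[𝓝 w] dW^[n] f + dW^[n] g := by
  induction n generalizing f g with
  | zero => exact EventuallyEq.rfl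
  | succ n ih =>
    exact (dW_iterate_eventuallyEq (dW_add_eventuallyEq
      (hf.of_le (by norm_cast; omega)) (hg.of_le (by norm_cast; omega))) n).trans
      (ih (contDiffAt_dW hf) (contDiffAt_dW hg))

theorem dWbar_iterate_add {f g : ℂ → ℂ} {w : ℂ} {n : ℕ} (hf : ContDiffAt ℝ n f w)
    (hg : ContDiffAt ℝ n g w) : dWbar^[n] (f + g) =ᶠ[𝓝 w] dWbar^[n] f + dWbar^[n] g := by
  induction n generalizing f g with
  | zero => exact EventuallyEq.rfl
  | succ n ih =>
    exact (dWbar_iterate_eventuallyEq (dWbar_add_eventuallyEq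
      (hf.of_le (by norm_cast; omega)) (hg.of_le (by norm_cast; omega))) n).trans
      (ih (contDiffAt_dWbar hf) (contDiffAt_dWbar hg))

theorem wirtinger_add {f g : ℂ → ℂ} {a b : ℕ} (hf : ContDiffAt ℝ (a + b : ℕ) f 0)
    (hg : ContDiffAt ℝ (a + b : ℕ) g 0) :
    wirtinger a b (f + g) = wirtinger a b f + wirtinger a b g := by
  have h1 := dWbar_iterate_add (n := b) (hf.of_le (by norm_cast; omega))
    (hg.of_le (by norm_cast; omega))
  have h2 := dW_iterate_add (n := a) (contDiffAt_dWbar_iterate hf) (contDiffAt_dWbar_iterate hg)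
  exact ((dW_iterate_eventuallyEq h1 a).trans h2).self_of_nhds

theorem wirtinger_sum {ι : Type*} (s : Finset ι) (F : ι → ℂ → ℂ) {a b : ℕ}
    (hF : ∀ i ∈ s, ContDiffAt ℝ (a + b : ℕ) (F i) 0) :
    wirtinger a b (∑ i ∈ s, F i) = ∑ i ∈ s, wirtinger a b (F i) := by
  classical
  induction s using Finset.induction_on with
  | empty =>
    have := wirtinger_const_mul_wmono 0 a b 0 0
    simp only [zero_mul, ite_self] at this
    exact this
  | insert i s hi ih =>
    rw [Finset.sum_insert hi, Finset.sum_insert hi, wirtinger_add (hF i (by simp)), ih]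
    · exact fun j hj => hF j (by simp [hj])
    · have : (∑ i ∈ s, F i) = fun x => ∑ i ∈ s, F i x := by ext; simp
      rw [this]
      exact ContDiffAt.sum fun j hj => hF j (by simp [hj])

/-- The coefficient of `w ^ a * conj w ^ b` in the Taylor polynomial of `f` at `0`. -/
noncomputable def tcoeff (f : ℂ → ℂ) (a b : ℕ) : ℂ :=
  wirtinger a b f / (a.factorial * b.factorial)

/-- The smoothness `N` of the remainder is kept apart from the order `k` of its vanishing: later up
to `p` derivatives of it are needed, and `p` may exceed `k`. -/
theorem exists_taylor_remainder {k N : ℕ} {f : ℂ → ℂ} (hkN : k ≤ N) (hf : ContDiffAt ℝ N f 0) :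
    ∃ R : ℂ → ℂ, ContDiffAt ℝ N R 0 ∧ (∀ a b, a + b < k → wirtinger a b R = 0) ∧
      ∀ w, f w = (∑ j ∈ Finset.range k, ∑ a ∈ Finset.range (j + 1),
        tcoeff f a (j - a) * wmono a (j - a) w) + R w := by
  set G : (_ : ℕ) × ℕ → ℂ → ℂ := fun p w =>
    -tcoeff f p.2 (p.1 - p.2) * wmono p.2 (p.1 - p.2) w with hG
  set S : Finset ((_ : ℕ) × ℕ) := (Finset.range k).sigma fun j => Finset.range (j + 1) with hS
  have hGc : ∀ p, ContDiff ℝ N (G p) := fun p => contDiff_const.mul (contDiff_wmono _ _)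
  have hsum : (∑ p ∈ S, G p) = fun x => ∑ p ∈ S, G p x := by ext; simp
  have hTc : ContDiff ℝ N (∑ p ∈ S, G p) := by
    rw [hsum]; exact ContDiff.sum fun p _ => hGc p
  refine ⟨f + ∑ p ∈ S, G p, hf.add hTc.contDiffAt, fun a b hab => ?_, fun w => ?_⟩
  · have hle : ((a + b : ℕ) : WithTop ℕ∞) ≤ (N : WithTop ℕ∞) := by norm_cast; omega
    rw [wirtinger_add (hf.of_le hle) (hTc.contDiffAt.of_le hle),
      wirtinger_sum _ _ fun p _ => (hGc p).contDiffAt.of_le hle]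
    simp only [hG, wirtinger_const_mul_wmono]
    rw [Finset.sum_eq_single ⟨a + b, a⟩]
    · have h1 : (a.factorial : ℂ) ≠ 0 := by exact_mod_cast a.factorial_ne_zero
      have h2 : (b.factorial : ℂ) ≠ 0 := by exact_mod_cast b.factorial_ne_zero
      simp [tcoeff]
      field_simp
      ring
    · rintro ⟨j, a'⟩ hp hne
      simp only [hS, Finset.mem_sigma, Finset.mem_range] at hp
      refine if_neg ?_
      rintro ⟨h1, h2⟩
      apply hne
      simp only at h1 h2
      subst h1
      obtain rfl : j = a + b := by omega
      rfl
    · intro h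
      simp only [hS, Finset.mem_sigma, Finset.mem_range] at h
      omega
  · simp only [Pi.add_apply, Finset.sum_apply, hG, hS, Finset.sum_sigma, neg_mul,
      Finset.sum_neg_distrib]
    ring

end SaddleLocal

namespace SaddleLocal
open Filter Topology Asymptotics ComplexConjugate Complex

/-! ### Functions with symbol-type bounds on vertical derivatives -/

/-- `K` has `N` derivatives in the vertical direction on `Ω`, the `i`-th of which is
`O(‖z‖ ^ (α - i))`. -/
def Sym (Ω : Set ℂ) : ℕ → ℝ → (ℂ → ℂ) → Prop
  | 0, α, K => ∃ C : ℝ, ∀ z ∈ Ω, ‖K z‖ ≤ C * ‖z‖ ^ α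
  | N + 1, α, K => (∃ C : ℝ, ∀ z ∈ Ω, ‖K z‖ ≤ C * ‖z‖ ^ α) ∧
      ∃ K' : ℂ → ℂ, (∀ z ∈ Ω, HasLineDerivAt ℝ K (K' z) z I) ∧ Sym Ω N (α - 1) K'

theorem Sym.bound {Ω : Set ℂ} {N : ℕ} {α : ℝ} {K : ℂ → ℂ} (h : Sym Ω N α K) :
    ∃ C : ℝ, 0 ≤ C ∧ ∀ z ∈ Ω, ‖K z‖ ≤ C * ‖z‖ ^ α := by
  have : ∃ C : ℝ, ∀ z ∈ Ω, ‖K z‖ ≤ C * ‖z‖ ^ α := by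
    cases N with
    | zero => exact h
    | succ N => exact h.1
  obtain ⟨C, hC⟩ := this
  exact ⟨|C|, abs_nonneg _, fun z hz => (hC z hz).trans (by gcongr; exact le_abs_self C)⟩

theorem Sym.of_succ {Ω : Set ℂ} {N : ℕ} {α : ℝ} {K : ℂ → ℂ} (h : Sym Ω (N + 1) α K) :
    Sym Ω N α K := by
  induction N generalizing α K with
  | zero => exact h.1
  | succ N ih =>
    obtain ⟨hb, K', hK', h⟩ := h
    exact ⟨hb, K', hK', ih h⟩

theorem Sym.of_le {Ω : Set ℂ} {N M : ℕ} {α : ℝ} {K : ℂ → ℂ} (h : Sym Ω M α K) (hNM : N ≤ M) :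
    Sym Ω N α K := by
  induction hNM with
  | refl => exact h
  | step _ ih => exact ih h.of_succ

theorem Sym.mono {Ω Ω' : Set ℂ} {N : ℕ} {α : ℝ} {K : ℂ → ℂ} (h : Sym Ω N α K) (hs : Ω' ⊆ Ω) :
    Sym Ω' N α K := by
  induction N generalizing α K with
  | zero => exact h.imp fun C hC z hz => hC z (hs hz)
  | succ N ih =>
    obtain ⟨hb, K', hK', h⟩ := h
    exact ⟨hb.imp fun C hC z hz => hC z (hs hz), K', fun z hz => hK' z (hs hz), ih h⟩

theorem Sym.weaken {Ω : Set ℂ} (hΩ : ∀ z ∈ Ω, z ≠ 0 ∧ ‖z‖ ≤ 1) {N : ℕ} {α β : ℝ} {K : ℂ → ℂ}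
    (h : Sym Ω N α K) (hβ : β ≤ α) : Sym Ω N β K := by
  have key : ∀ {N : ℕ} {α β : ℝ} {K : ℂ → ℂ}, Sym Ω N α K → β ≤ α →
      ∃ C : ℝ, ∀ z ∈ Ω, ‖K z‖ ≤ C * ‖z‖ ^ β := by
    intro N α β K h hβ
    obtain ⟨C, hC, hb⟩ := h.bound
    refine ⟨C, fun z hz => (hb z hz).trans ?_⟩
    have := Real.rpow_le_rpow_of_exponent_ge (norm_pos_iff.2 (hΩ z hz).1) (hΩ z hz).2 hβ
    gcongr
  induction N generalizing α β K with
  | zero => exact key h hβ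
  | succ N ih =>
    obtain ⟨K', hK', h'⟩ := h.2
    exact ⟨key h hβ, K', hK', ih h' (by linarith)⟩

theorem Sym.add {Ω : Set ℂ} {N : ℕ} {α : ℝ} {K L : ℂ → ℂ} (hK : Sym Ω N α K)
    (hL : Sym Ω N α L) : Sym Ω N α (fun z => K z + L z) := by
  have key : ∀ {N : ℕ} {α : ℝ} {K L : ℂ → ℂ}, Sym Ω N α K → Sym Ω N α L →
      ∃ C : ℝ, ∀ z ∈ Ω, ‖K z + L z‖ ≤ C * ‖z‖ ^ α := by
    intro N α K L hK hL
    obtain ⟨C, -, hC⟩ := hK.bound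
    obtain ⟨D, -, hD⟩ := hL.bound
    exact ⟨C + D, fun z hz => (norm_add_le _ _).trans (by
      rw [add_mul]; exact add_le_add (hC z hz) (hD z hz))⟩
  induction N generalizing α K L with
  | zero => exact key hK hL
  | succ N ih =>
    obtain ⟨K', hK', hK1⟩ := hK.2
    obtain ⟨L', hL', hL1⟩ := hL.2
    exact ⟨key hK hL, fun z => K' z + L' z, fun z hz => HasDerivAt.add (hK' z hz) (hL' z hz),
      ih hK1 hL1⟩

theorem Sym.mul {Ω : Set ℂ} (hΩ : ∀ z ∈ Ω, z ≠ 0) {N : ℕ} {α β : ℝ} {K L : ℂ → ℂ}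
    (hK : Sym Ω N α K) (hL : Sym Ω N β L) : Sym Ω N (α + β) (fun z => K z * L z) := by
  have key : ∀ {N : ℕ} {α β : ℝ} {K L : ℂ → ℂ}, Sym Ω N α K → Sym Ω N β L →
      ∃ C : ℝ, ∀ z ∈ Ω, ‖K z * L z‖ ≤ C * ‖z‖ ^ (α + β) := by
    intro N α β K L hK hL
    obtain ⟨C, hC0, hC⟩ := hK.bound
    obtain ⟨D, hD0, hD⟩ := hL.bound
    refine ⟨C * D, fun z hz => ?_⟩
    rw [norm_mul, Real.rpow_add (norm_pos_iff.2 (hΩ z hz)), mul_mul_mul_comm]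
    exact mul_le_mul (hC z hz) (hD z hz) (norm_nonneg _) (by positivity)
  induction N generalizing α β K L with
  | zero => exact key hK hL
  | succ N ih =>
    obtain ⟨K', hK', hK1⟩ := hK.2
    obtain ⟨L', hL', hL1⟩ := hL.2
    refine ⟨key hK hL, fun z => K' z * L z + K z * L' z, fun z hz => ?_, ?_⟩
    · have := HasDerivAt.mul (hK' z hz) (hL' z hz)
      simp only [zero_smul, add_zero] at this
      exact this
    · have h1 := ih hK1 hL.of_succ
      have h2 := ih hK.of_succ hL1
      rw [show α - 1 + β = α + β - 1 by ring] at h1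
      rw [show α + (β - 1) = α + β - 1 by ring] at h2
      exact h1.add h2

theorem Sym.const {Ω : Set ℂ} (N : ℕ) (c : ℂ) : Sym Ω N 0 (fun _ => c) := by
  have h0 : ∀ (N : ℕ) (α : ℝ), Sym Ω N α (fun _ => 0) := by
    intro N
    induction N with
    | zero => exact fun α => ⟨0, by simp⟩
    | succ N ih => exact fun α => ⟨⟨0, by simp⟩, fun _ => 0,
        fun z _ => hasDerivAt_const _ _, ih _⟩
  cases N with
  | zero => exact ⟨‖c‖, by simp⟩
  | succ N => exact ⟨⟨‖c‖, by simp⟩, fun _ => 0, fun z _ => hasDerivAt_const _ _, h0 _ _⟩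

theorem Sym.const_mul {Ω : Set ℂ} (hΩ : ∀ z ∈ Ω, z ≠ 0) {N : ℕ} {α : ℝ} {K : ℂ → ℂ}
    (hK : Sym Ω N α K) (c : ℂ) : Sym Ω N α (fun z => c * K z) := by
  simpa using (Sym.const N c).mul hΩ hK

theorem Sym.conj {Ω : Set ℂ} {N : ℕ} {α : ℝ} {K : ℂ → ℂ} (hK : Sym Ω N α K) :
    Sym Ω N α (fun z => conj (K z)) := by
  induction N generalizing α K with
  | zero => simpa [Sym] using hK
  | succ N ih =>
    obtain ⟨hb, K', hK', hK⟩ := hK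
    refine ⟨by simpa using hb, fun z => conj (K' z), fun z hz => ?_, ih hK⟩
    exact (Complex.conjCLE : ℂ →L[ℝ] ℂ).hasFDerivAt.comp_hasDerivAt (0 : ℝ) (hK' z hz)

theorem hasDerivAt_line (z v : ℂ) (t : ℝ) : HasDerivAt (fun t : ℝ => z + t • v) v t := by
  simpa using ((hasDerivAt_id t).smul_const v).const_add z

theorem hasLineDerivAt_cpow {z : ℂ} (hz : 0 < z.im) (e v : ℂ) :
    HasLineDerivAt ℝ (fun z => z ^ e) (v * (e * z ^ (e - 1))) z v := by
  have h1 : HasDerivAt (fun z : ℂ => z ^ e) (e * z ^ (e - 1)) (z + (0 : ℝ) • v) := by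
    simpa using (hasDerivAt_id z).cpow_const (c := e) (Or.inr hz.ne')
  have := h1.scomp (0 : ℝ) (hasDerivAt_line z v 0)
  exact this

theorem Sym.cpow {Ω : Set ℂ} (hΩ : ∀ z ∈ Ω, 0 < z.im) (N : ℕ) (e : ℝ) :
    Sym Ω N e (fun z => z ^ (e : ℂ)) := by
  have hΩ0 : ∀ z ∈ Ω, z ≠ 0 := fun z hz h => by simpa [h] using hΩ z hz
  have key : ∀ e : ℝ, ∃ C : ℝ, ∀ z ∈ Ω, ‖z ^ (e : ℂ)‖ ≤ C * ‖z‖ ^ e := fun e =>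
    ⟨1, fun z hz => by rw [Complex.norm_cpow_real, one_mul]⟩
  induction N generalizing e with
  | zero => exact key e
  | succ N ih =>
    refine ⟨key e, fun z => I * (e * z ^ ((e : ℂ) - 1)),
      fun z hz => hasLineDerivAt_cpow (hΩ z hz) _ _, ?_⟩
    have := ((ih (e - 1)).const_mul hΩ0 e).const_mul hΩ0 I
    simpa using this

/-- The part of the upper half plane in the disc of radius `ρ`. -/
def halfDisc (ρ : ℝ) : Set ℂ := {z | 0 < z.im ∧ ‖z‖ < ρ}

theorem ne_zero_of_im_pos {z : ℂ} (hz : 0 < z.im) : z ≠ 0 := fun h => by simp [h] at hz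

/-- Chain rule and induction on `N`: the Wirtinger derivatives of `R` vanish to order `k - 1`, hence
have size `|z|^((k-1)/m)` along the root, while the root has derivative of size `|z|^(1/m-1)`. The
product has size `|z|^(k/m-1)`, so each vertical derivative costs exactly one power of `|z|`. -/
theorem Sym.comp_root {m : ℕ} (hm : 2 ≤ m) {c : ℂ} (hc : ‖c‖ = 1) {N k : ℕ} (hkN : k ≤ N)
    {R : ℂ → ℂ} (hR : ContDiffAt ℝ N R 0) (h0 : ∀ a b, a + b < k → wirtinger a b R = 0) :
    ∃ ρ : ℝ, 0 < ρ ∧ ρ ≤ 1 ∧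
      Sym (halfDisc ρ) N (k / m) (fun z => R (c * z ^ ((1 / m : ℝ) : ℂ))) := by
  have hm0 : (0 : ℝ) < m := by positivity
  have key : ∀ ε > 0, ∀ z : ℂ, ‖z‖ < ε ^ m → ‖c * z ^ ((1 / m : ℝ) : ℂ)‖ < ε := by
    intro ε hε z hz
    rw [norm_mul, hc, one_mul, Complex.norm_cpow_real]
    calc ‖z‖ ^ (1 / m : ℝ) < (ε ^ m) ^ (1 / m : ℝ) :=
          Real.rpow_lt_rpow (norm_nonneg _) hz (by positivity)
      _ = ε := by rw [one_div]; exact Real.pow_rpow_inv_natCast hε.le (by omega)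
  have bd : ∀ {T : ℂ → ℂ} {N k : ℕ}, k ≤ N → ContDiffAt ℝ N T 0 →
      (∀ a b, a + b < k → wirtinger a b T = 0) → ∃ ρ : ℝ, 0 < ρ ∧ ρ ≤ 1 ∧ ∃ C : ℝ,
      ∀ z ∈ halfDisc ρ, ‖T (c * z ^ ((1 / m : ℝ) : ℂ))‖ ≤ C * ‖z‖ ^ (k / m : ℝ) := by
    intro T N k hk hT h0
    obtain ⟨C, hC⟩ := (wirtinger_isBigO (hT.of_le (by exact_mod_cast hk)) h0).bound
    obtain ⟨ε, hε, hb⟩ := Metric.eventually_nhds_iff_ball.1 hC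
    refine ⟨min 1 (ε ^ m), by positivity, min_le_left _ _, C, fun z hz => ?_⟩
    refine (hb _ ?_).trans_eq ?_
    · simpa using key ε hε z (hz.2.trans_le (min_le_right _ _))
    · rw [norm_mul, hc, one_mul, Complex.norm_cpow_real, norm_pow, Real.norm_eq_abs,
        abs_of_nonneg (by positivity), ← Real.rpow_mul_natCast (norm_nonneg _)]
      congr 2; field_simp
  induction N generalizing k R with
  | zero => exact bd hkN hR h0
  | succ N ih =>
    obtain ⟨ρ₀, hρ₀, hρ₀1, hb⟩ := bd hkN hR h0
    have hle : ∀ {a b : ℕ}, a + b < k - 1 →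
        ((a + b + 1 : ℕ) : WithTop ℕ∞) ≤ ((N + 1 : ℕ) : WithTop ℕ∞) := by
      intro a b hab; norm_cast; omega
    have v1 : ∀ a b, a + b < k - 1 → wirtinger a b (dW R) = 0 := fun a b hab => by
      rw [wirtinger_dW (hR.of_le (hle hab))]; exact h0 _ _ (by omega)
    have v2 : ∀ a b, a + b < k - 1 → wirtinger a b (dWbar R) = 0 := fun a b hab => by
      rw [wirtinger_dWbar]; exact h0 _ _ (by omega)
    obtain ⟨ρ₁, hρ₁, hρ₁1, s1⟩ := ih (k := k - 1) (by omega) (contDiffAt_dW hR) v1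
    obtain ⟨ρ₂, hρ₂, hρ₂1, s2⟩ := ih (k := k - 1) (by omega) (contDiffAt_dWbar hR) v2
    have hd : ∀ᶠ z in 𝓝 (0 : ℂ), DifferentiableAt ℝ R z :=
      (eventually_contDiffAt hR).mono fun z hz => hz.differentiableAt (by simp)
    obtain ⟨ε, hε, hdb⟩ := Metric.eventually_nhds_iff_ball.1 hd
    set ρ := min (min ρ₀ (ε ^ m)) (min ρ₁ ρ₂) with hρ
    have hsub : ∀ {ρ'}, ρ ≤ ρ' → halfDisc ρ ⊆ halfDisc ρ' := fun h z hz =>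
      ⟨hz.1, hz.2.trans_le h⟩
    have l0 : ρ ≤ ρ₀ := (min_le_left _ _).trans (min_le_left _ _)
    have lε : ρ ≤ ε ^ m := (min_le_left _ _).trans (min_le_right _ _)
    have l1 : ρ ≤ ρ₁ := (min_le_right _ _).trans (min_le_left _ _)
    have l2 : ρ ≤ ρ₂ := (min_le_right _ _).trans (min_le_right _ _)
    have hpos : ∀ z ∈ halfDisc ρ, z ≠ 0 := fun z hz => ne_zero_of_im_pos hz.1
    set v : ℂ → ℂ := fun z => c * (I * (((1 / m : ℝ) : ℂ) * z ^ (((1 / m : ℝ) : ℂ) - 1))) with hv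
    have sv : Sym (halfDisc ρ) N (1 / m - 1) v := by
      have := (((Sym.cpow (Ω := halfDisc ρ) (fun z hz => hz.1) N (1 / m - 1)).const_mul hpos
        ((1 / m : ℝ) : ℂ)).const_mul hpos I).const_mul hpos c
      simpa [hv] using this
    refine ⟨ρ, by positivity, l0.trans hρ₀1, hb.imp fun C hC z hz => hC z (hsub l0 hz), fun z =>
      dW R (c * z ^ ((1 / m : ℝ) : ℂ)) * v z + dWbar R (c * z ^ ((1 / m : ℝ) : ℂ)) * conj (v z),
      fun z hz => ?_, ?_⟩
    · have hq := HasDerivAt.const_mul c (hasLineDerivAt_cpow hz.1 ((1 / m : ℝ) : ℂ) I)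
      have hRd : HasFDerivAt R (fderiv ℝ R (c * z ^ ((1 / m : ℝ) : ℂ)))
          (c * (z + (0 : ℝ) • I) ^ ((1 / m : ℝ) : ℂ)) := by
        simpa using (hdb _ (by simpa using key ε hε z (hz.2.trans_le lε))).hasFDerivAt
      have := hRd.comp_hasDerivAt (0 : ℝ) hq
      rw [fderiv_apply_eq_dW] at this
      exact this
    · have h1 := (s1.mono (hsub l1)).mul hpos sv
      have h2 := (s2.mono (hsub l2)).mul hpos sv.conj
      refine (h1.add h2).weaken (fun z hz => ⟨hpos z hz, hz.2.le.trans (l0.trans hρ₀1)⟩) ?_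
      -- The subtraction `k - 1` is truncated, so for `k = 0` this is only an inequality; the
      -- exponent gained is then better than needed.
      have : (k : ℝ) ≤ ((k - 1 : ℕ) : ℝ) + 1 := by norm_cast; omega
      calc (k : ℝ) / m - 1 ≤ (((k - 1 : ℕ) : ℝ) + 1) / m - 1 := by gcongr
        _ = _ := by ring

/-! ### Forward differences -/

theorem hasLineDerivAt_fwdDiff_iterate {K K' : ℂ → ℂ} {h v : ℂ} {n : ℕ} {z : ℂ}
    (H : ∀ i ≤ n, HasLineDerivAt ℝ K (K' (z + (i : ℂ) * h)) (z + (i : ℂ) * h) v) :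
    HasLineDerivAt ℝ ((fwdDiff h)^[n] K) ((fwdDiff h)^[n] K' z) z v := by
  induction n generalizing z with
  | zero => simpa using H 0 le_rfl
  | succ n ih =>
    rw [Function.iterate_succ_apply', Function.iterate_succ_apply']
    have h1 := ih (z := z) fun i hi => H i (by omega)
    have h2 := ih (z := z + h) fun i hi => by
      have := H (i + 1) (by omega)
      rw [show z + ((i + 1 : ℕ) : ℂ) * h = z + h + i * h by push_cast; ring] at this
      exact this
    unfold HasLineDerivAt at *
    have h2' : HasDerivAt (fun t : ℝ => (fwdDiff h)^[n] K (z + t • v + h))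
        ((fwdDiff h)^[n] K' (z + h)) 0 := by
      refine h2.congr_of_eventuallyEq (Eventually.of_forall fun t => ?_)
      simp only; rw [add_right_comm]
    exact h2'.sub h1

theorem hasDerivAt_of_hasLineDerivAt {K : ℂ → ℂ} {k z v : ℂ} {t : ℝ}
    (h : HasLineDerivAt ℝ K k (z + t • v) v) : HasDerivAt (fun t : ℝ => K (z + t • v)) k t := by
  have h' : HasDerivAt (fun u : ℝ => K (z + t • v + u • v)) k (t - t) := by
    rw [sub_self]; exact h
  have := h'.comp_sub_const t t
  refine this.congr_of_eventuallyEq (Eventually.of_forall fun u => ?_)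
  simp only
  congr 1
  rw [add_assoc, ← add_smul]; congr 2; ring

theorem norm_le_norm_add_I {z : ℂ} (hz : 0 < z.im) {t : ℝ} (ht : 0 ≤ t) :
    ‖z‖ ≤ ‖z + t * I‖ := by
  rw [Complex.norm_def, Complex.norm_def]
  refine Real.sqrt_le_sqrt ?_
  simp only [Complex.normSq_apply]
  simp
  nlinarith

/-- One difference is at most `h` times a bound for the vertical derivative on the segment. Moving
up from `z` increases the modulus, and `α ≤ p` makes the remaining exponent nonpositive, so the
bound at the foot `z` serves for the whole segment. -/
theorem Sym.norm_fwdDiff_le {Ω : Set ℂ} (hΩ : ∀ z ∈ Ω, 0 < z.im) {p : ℕ} {α : ℝ} {K : ℂ → ℂ}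
    (hK : Sym Ω p α K) (hα : α ≤ p) :
    ∃ C : ℝ, 0 ≤ C ∧ ∀ (z : ℂ) (h : ℝ), 0 ≤ h →
      (∀ t : ℝ, 0 ≤ t → t ≤ p * h → z + t * I ∈ Ω) →
      ‖(fwdDiff (h * I))^[p] K z‖ ≤ C * h ^ p * ‖z‖ ^ (α - p) := by
  induction p generalizing α K with
  | zero =>
    obtain ⟨C, hC, hb⟩ := hK.bound
    refine ⟨C, hC, fun z h hh hz => ?_⟩
    simpa using hb z (by simpa using hz 0 le_rfl (by simp))
  | succ p ih =>
    obtain ⟨-, K', hK', hK⟩ := hK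
    obtain ⟨C, hC, hb⟩ := ih hK (by push_cast at hα; linarith)
    refine ⟨C, hC, fun z h hh hz => ?_⟩
    rw [Function.iterate_succ_apply', fwdDiff]
    have hz0 : 0 < z.im := hΩ z (by simpa using hz 0 le_rfl (by positivity))
    have hmem : ∀ t ∈ Set.Icc 0 h, ∀ u : ℝ, 0 ≤ u → u ≤ p * h → z + t * I + u * I ∈ Ω := by
      intro t ht u hu hu'
      have := hz (t + u) (by linarith [ht.1]) (by push_cast; linarith [ht.2])
      rwa [show z + ((t + u : ℝ) : ℂ) * I = z + t * I + u * I by push_cast; ring] at this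
    have := norm_image_sub_le_of_norm_deriv_le_segment' (a := 0) (b := h)
      (f := fun t : ℝ => (fwdDiff (h * I))^[p] K (z + t • I))
      (f' := fun t : ℝ => (fwdDiff (h * I))^[p] K' (z + t • I))
      (C := C * h ^ p * ‖z‖ ^ (α - (p + 1)))
      (fun t ht => (hasDerivAt_of_hasLineDerivAt (hasLineDerivAt_fwdDiff_iterate
        fun i hi => hK' _ ?_)).hasDerivWithinAt)
      (fun t ht => ?_) h ⟨hh, le_rfl⟩
    · simp only [Complex.real_smul, Complex.ofReal_zero, zero_mul, add_zero, sub_zero] at this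
      refine this.trans_eq ?_
      push_cast; ring
    · have := hmem t ht (i * h) (by positivity) (by gcongr)
      simpa [mul_assoc] using this
    · have ht' : t ∈ Set.Icc 0 h := ⟨ht.1, ht.2.le⟩
      simp only [Complex.real_smul]
      refine (hb (z + t * I) h hh (hmem t ht')).trans ?_
      have h1 := norm_le_norm_add_I hz0 ht.1
      have h2 : ‖z + t * I‖ ^ (α - 1 - p) ≤ ‖z‖ ^ (α - 1 - p) :=
        Real.rpow_le_rpow_of_nonpos (norm_pos_iff.2 (ne_zero_of_im_pos hz0)) h1
          (by push_cast at hα; linarith)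
      rw [show α - (p + 1) = α - 1 - p by ring]
      gcongr

end SaddleLocal

namespace SaddleLocal
open Filter Topology Asymptotics ComplexConjugate Complex MeasureTheory

/-! ### The Laplace transform of a power -/

theorem integrableOn_rpow_mul_exp {a b : ℝ} (ha : 0 < a) (hb : 0 < b) :
    IntegrableOn (fun t : ℝ => t ^ (a - 1) * Real.exp (-(b * t))) (Set.Ioi 0) := by
  have := integrableOn_rpow_mul_exp_neg_mul_rpow (p := 1) (s := a - 1) (by linarith)
    one_pos hb
  simpa using this

theorem norm_cpow_mul_exp {a t : ℝ} (ht : 0 < t) (r : ℂ) :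
    ‖(t : ℂ) ^ ((a : ℂ) - 1) * cexp (-(r * t))‖ = t ^ (a - 1) * Real.exp (-(r.re * t)) := by
  rw [norm_mul, Complex.norm_exp, Complex.norm_cpow_eq_rpow_re_of_pos ht]
  simp

theorem aestronglyMeasurable_cpow_mul_exp (a r : ℂ) :
    AEStronglyMeasurable (fun t : ℝ => (t : ℂ) ^ (a - 1) * cexp (-(r * t)))
      (volume.restrict (Set.Ioi 0)) := by
  refine ContinuousOn.aestronglyMeasurable (fun t ht => ?_) measurableSet_Ioi
  refine ContinuousAt.continuousWithinAt (ContinuousAt.mul ?_ (by fun_prop))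
  exact (continuousAt_ofReal_cpow_const _ _ (Or.inr ht.ne'))

theorem integrableOn_cpow_mul_exp {a : ℝ} (ha : 0 < a) {r : ℂ} (hr : 0 < r.re) :
    IntegrableOn (fun t : ℝ => (t : ℂ) ^ ((a : ℂ) - 1) * cexp (-(r * t))) (Set.Ioi 0) := by
  refine (integrableOn_rpow_mul_exp ha hr).mono' (aestronglyMeasurable_cpow_mul_exp _ _) ?_
  exact (ae_restrict_iff' measurableSet_Ioi).2 (Eventually.of_forall fun t ht =>
    (norm_cpow_mul_exp ht r).le)

theorem differentiableAt_laplace_rpow {a : ℝ} (ha : 0 < a) {r : ℂ} (hr : 0 < r.re) :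
    DifferentiableAt ℂ
      (fun r : ℂ => ∫ t : ℝ in Set.Ioi 0, (t : ℂ) ^ ((a : ℂ) - 1) * cexp (-(r * t))) r := by
  have key := hasDerivAt_integral_of_dominated_loc_of_deriv_le
    (μ := volume.restrict (Set.Ioi (0 : ℝ)))
    (F := fun (r : ℂ) (t : ℝ) => (t : ℂ) ^ ((a : ℂ) - 1) * cexp (-(r * t)))
    (F' := fun (r : ℂ) (t : ℝ) => (t : ℂ) ^ ((a : ℂ) - 1) * (cexp (-(r * t)) * (-t)))
    (x₀ := r) (s := {w | r.re / 2 < w.re})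
    (bound := fun t => t ^ ((a + 1) - 1) * Real.exp (-(r.re / 2 * t)))
    ((isOpen_lt continuous_const continuous_re).mem_nhds (by simp; linarith))
    (Eventually.of_forall fun w => aestronglyMeasurable_cpow_mul_exp _ _)
    (integrableOn_cpow_mul_exp ha hr) ?_ ?_ (integrableOn_rpow_mul_exp (by linarith)
      (by linarith)) ?_
  · exact key.2.differentiableAt
  · have : (fun t : ℝ => (t : ℂ) ^ ((a : ℂ) - 1) * (cexp (-(r * t)) * (-t))) =
        fun t : ℝ => ((t : ℂ) ^ ((a : ℂ) - 1) * cexp (-(r * t))) * (-t) := by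
      ext; ring
    rw [this]
    exact (aestronglyMeasurable_cpow_mul_exp _ _).mul
      (by fun_prop : Continuous fun t : ℝ => (-t : ℂ)).aestronglyMeasurable
  · refine (ae_restrict_iff' measurableSet_Ioi).2 (Eventually.of_forall fun t ht w hw => ?_)
    have ht' : (0 : ℝ) < t := ht
    rw [← mul_assoc, norm_mul, norm_cpow_mul_exp ht, norm_neg, norm_real, Real.norm_of_nonneg ht'.le,
      add_sub_right_comm, Real.rpow_add_one ht'.ne', mul_right_comm]
    have hw' : r.re / 2 < w.re := hw
    gcongr
  · refine Eventually.of_forall fun t w _ => ?_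
    refine HasDerivAt.const_mul _ (HasDerivAt.cexp ?_)
    have h := ((hasDerivAt_id w).mul_const (t : ℂ)).neg
    rw [one_mul] at h
    exact h

/-- Both sides are holomorphic in the right half plane and agree for real `r`; the points `1 +
1/(n+1)` accumulate at 1, so the identity theorem applies. -/
theorem laplace_rpow {a : ℝ} (ha : 0 < a) {r : ℂ} (hr : 0 < r.re) :
    ∫ t : ℝ in Set.Ioi 0, (t : ℂ) ^ ((a : ℂ) - 1) * cexp (-(r * t)) =
      r ^ (-(a : ℂ)) * Real.Gamma a := by
  set U : Set ℂ := {w | 0 < w.re}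
  have hU : IsOpen U := isOpen_lt continuous_const continuous_re
  have h1 : AnalyticOnNhd ℂ
      (fun r : ℂ => ∫ t : ℝ in Set.Ioi 0, (t : ℂ) ^ ((a : ℂ) - 1) * cexp (-(r * t))) U :=
    DifferentiableOn.analyticOnNhd
      (fun w hw => (differentiableAt_laplace_rpow ha hw).differentiableWithinAt) hU
  have h2 : AnalyticOnNhd ℂ (fun r : ℂ => r ^ (-(a : ℂ)) * Real.Gamma a) U :=
    DifferentiableOn.analyticOnNhd (fun w hw => (((differentiableAt_id).cpow_const
      (Or.inl hw)).mul_const _).differentiableWithinAt) hU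
  refine h1.eqOn_of_preconnected_of_frequently_eq h2
    (convex_halfSpace_re_gt 0).isPreconnected (z₀ := 1) (by simp [U]) ?_ hr
  have hlim : Tendsto (fun n : ℕ => ((1 + 1 / ((n : ℝ) + 1) : ℝ) : ℂ)) atTop (𝓝[≠] 1) := by
    refine tendsto_nhdsWithin_iff.2 ⟨?_, Eventually.of_forall fun n => ?_⟩
    · have := (tendsto_one_div_add_atTop_nhds_zero_nat (𝕜 := ℝ)).const_add 1
      have := (Complex.continuous_ofReal.tendsto _).comp this
      rw [add_zero, ofReal_one] at this
      exact this
    · have : (0 : ℝ) < 1 / ((n : ℝ) + 1) := by positivity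
      simp only [Set.mem_compl_iff, Set.mem_singleton_iff]
      rw [← Complex.ofReal_one, Complex.ofReal_inj]
      linarith
  refine hlim.frequently (Frequently.of_forall fun n => ?_)
  have hp : (0 : ℝ) < 1 + 1 / ((n : ℝ) + 1) := by positivity
  rw [integral_cpow_mul_exp_neg_mul_Ioi (a := (a : ℂ)) (by simpa using ha) hp,
    Complex.Gamma_ofReal, one_div, cpow_neg, inv_cpow]
  rw [Complex.arg_ofReal_of_nonneg hp.le]; exact Real.pi_pos.ne

/-! ### The Cauchy beta integral -/

/-- The density `t ^ (a - 1) * exp (-2πt)` on the positive half line. -/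
noncomputable def gdens (a : ℝ) : ℝ → ℂ :=
  (Set.Ioi (0 : ℝ)).indicator fun t => (t : ℂ) ^ ((a : ℂ) - 1) * cexp (-((2 * Real.pi : ℝ) * t))

theorem integrable_gdens {a : ℝ} (ha : 0 < a) : Integrable (gdens a) :=
  (integrableOn_cpow_mul_exp ha (by simp [Real.pi_pos])).integrable_indicator measurableSet_Ioi

theorem continuous_gdens {a : ℝ} (ha : 1 < a) : Continuous (gdens a) := by
  have : gdens a = fun t => ((max t 0 : ℝ) : ℂ) ^ ((a : ℂ) - 1) *
      cexp (-((2 * Real.pi : ℝ) * t)) := by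
    funext t
    rcases le_or_gt t 0 with ht | ht
    · have h : (a : ℂ) - 1 ≠ 0 := by
        rw [← Complex.ofReal_one, ← Complex.ofReal_sub]
        exact Complex.ofReal_ne_zero.2 (by linarith)
      rw [gdens, Set.indicator_of_notMem (by simpa using ht), max_eq_right ht, ofReal_zero,
        zero_cpow h, zero_mul]
    · rw [gdens, Set.indicator_of_mem (by simpa using ht), max_eq_left ht.le]
  rw [this]
  refine Continuous.mul ?_ (by fun_prop)
  refine (continuous_ofReal_cpow_const (y := (a : ℂ) - 1) ?_).comp (by fun_prop)
  simpa using ha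

open FourierTransform in
theorem fourier_gdens {a : ℝ} (ha : 0 < a) (ξ : ℝ) :
    𝓕 (gdens a) ξ = ((2 * Real.pi : ℝ) * (1 + ξ * I)) ^ (-(a : ℂ)) * Real.Gamma a := by
  rw [Real.fourier_real_eq_integral_exp_smul, ← laplace_rpow ha (by simp [Real.pi_pos]),
    ← integral_indicator measurableSet_Ioi]
  congr 1
  funext t
  by_cases ht : t ∈ Set.Ioi (0 : ℝ)
  · rw [gdens, Set.indicator_of_mem ht, Set.indicator_of_mem ht, smul_eq_mul, mul_left_comm,
      ← Complex.exp_add]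
    congr 2
    push_cast; ring
  · simp [gdens, ht]

theorem norm_one_add_mul_I (t : ℝ) : ‖(1 + t * I : ℂ)‖ = Real.sqrt (1 + t ^ 2) := by
  have := Complex.norm_add_mul_I 1 t
  simpa using this

theorem integrable_one_add_mul_I {a : ℝ} (ha : 1 < a) :
    Integrable fun t : ℝ => ‖(1 + t * I : ℂ)‖ ^ (-a) := by
  have := integrable_rpow_neg_one_add_norm_sq (E := ℝ) (r := a) (μ := volume) (by simpa using ha)
  refine this.congr (Eventually.of_forall fun t => ?_)
  simp only
  rw [norm_one_add_mul_I, Real.sqrt_eq_rpow, ← Real.rpow_mul (by positivity)]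
  simp; ring_nf

theorem slit_one_add_mul_I (t : ℝ) : (1 + t * I : ℂ) ∈ slitPlane := by
  left; simp

theorem cpow_two_pi_mul {z : ℂ} (c : ℂ) :
    ((2 * Real.pi : ℝ) * z : ℂ) ^ c = ((2 * Real.pi : ℝ) : ℂ) ^ c * z ^ c := by
  by_cases hz : z = 0
  · subst hz
    by_cases hc : c = 0 <;> simp [hc]
  have h0 : (((2 * Real.pi : ℝ)) : ℂ) ≠ 0 := by exact_mod_cast (by positivity : 2 * Real.pi ≠ 0)
  rw [cpow_def_of_ne_zero (mul_ne_zero h0 hz), cpow_def_of_ne_zero h0, cpow_def_of_ne_zero hz,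
    Complex.log_ofReal_mul (by positivity) hz, Complex.ofReal_log (by positivity), ← Complex.exp_add]
  ring_nf

open FourierTransform in
theorem integrable_fourier_gdens {a : ℝ} (ha : 1 < a) : Integrable (𝓕 (gdens a)) := by
  have hc : Continuous (𝓕 (gdens a)) := by
    have : 𝓕 (gdens a) = fun ξ : ℝ =>
        ((2 * Real.pi : ℝ) * (1 + ξ * I)) ^ (-(a : ℂ)) * (Real.Gamma a : ℂ) := by
      funext ξ; exact fourier_gdens (by linarith) ξ
    rw [this]
    refine Continuous.mul (continuous_iff_continuousAt.2 fun t => ?_) continuous_const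
    refine ContinuousAt.cpow (by fun_prop) continuousAt_const ?_
    left; simp [Real.pi_pos]
  refine (((integrable_one_add_mul_I ha).const_mul
    (‖((2 * Real.pi : ℝ) : ℂ) ^ (-(a : ℂ))‖ * ‖(Real.Gamma a : ℂ)‖))).mono'
    hc.aestronglyMeasurable (Eventually.of_forall fun t => le_of_eq ?_)
  rw [fourier_gdens (by linarith), cpow_two_pi_mul, norm_mul, norm_mul, ← ofReal_neg a,
    Complex.norm_cpow_real, Complex.norm_cpow_real]
  ring

open FourierTransform in
-- The Fourier transform is moved from the first factor to the second, where inversion returns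
-- `gdens b`; what is left is the Laplace transform of `t^(a+b-2)` at `4π`. The condition `1 < b`
-- makes `gdens b` continuous and its transform integrable, as inversion requires.
theorem integral_fourier_gdens_mul {a b : ℝ} (ha : 0 < a) (hb : 1 < b) :
    ∫ t : ℝ, 𝓕 (gdens a) t * 𝓕 (gdens b) (-t) =
      ((4 * Real.pi : ℝ) : ℂ) ^ (-((a + b - 1 : ℝ) : ℂ)) * Real.Gamma (a + b - 1) := by
  have hψ : Integrable fun t : ℝ => 𝓕 (gdens b) (-t) := (integrable_fourier_gdens hb).comp_neg
  have h1 := VectorFourier.integral_fourierIntegral_smul_eq_flip (μ := volume) (ν := volume)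
    (L := innerₗ ℝ) (f := gdens a) (g := fun t : ℝ => 𝓕 (gdens b) (-t))
    Real.continuous_fourierChar continuous_inner (integrable_gdens ha) hψ
  have h2 : ∀ τ : ℝ, VectorFourier.fourierIntegral Real.fourierChar volume (innerₗ ℝ).flip
      (fun t : ℝ => 𝓕 (gdens b) (-t)) τ = gdens b τ := by
    intro τ
    have h3 := congrFun ((continuous_gdens hb).fourierInv_fourier_eq
      (integrable_gdens (by linarith)) (integrable_fourier_gdens hb)) τ
    rw [Real.fourierInv_eq_fourier_comp_neg] at h3
    rw [← h3, flip_innerₗ]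
    rfl
  simp only [h2, smul_eq_mul] at h1
  refine h1.trans ?_
  have h4 := laplace_rpow (a := a + b - 1) (by linarith) (r := ((4 * Real.pi : ℝ) : ℂ))
    (by simp [Real.pi_pos])
  rw [← h4, ← integral_indicator measurableSet_Ioi]
  congr 1
  funext t
  by_cases ht : t ∈ Set.Ioi (0 : ℝ)
  · have ht0 : (t : ℂ) ≠ 0 := by exact_mod_cast (ne_of_gt ht)
    rw [gdens, gdens, Set.indicator_of_mem ht, Set.indicator_of_mem ht, Set.indicator_of_mem ht,
      mul_mul_mul_comm, ← Complex.cpow_add _ _ ht0, ← Complex.exp_add]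
    congr 2
    · push_cast; ring
    · push_cast; ring
  · simp [gdens, ht]

/-- The integral `∫ (t + i) ^ (-x) * conj ((t + i) ^ (-y)) dt`. -/
noncomputable def cauchyBeta (x y : ℝ) : ℂ :=
  ∫ t : ℝ, (t + I : ℂ) ^ (((-x : ℝ)) : ℂ) * conj ((t + I : ℂ) ^ (((-y : ℝ)) : ℂ))

/-- Write `t + I = I * (1 - tI)`. The second factor has argument in `(-π/2, π/2)`, so the principal
logarithms add. -/
theorem add_I_cpow (t x : ℝ) :
    (t + I : ℂ) ^ ((-x : ℝ) : ℂ) = cexp (-(I * (Real.pi / 2) * x)) * (1 + (-t : ℝ) * I) ^ (-(x : ℂ)) := by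
  have h0 : (1 + (-t : ℝ) * I : ℂ) ≠ 0 := slitPlane_ne_zero (slit_one_add_mul_I _)
  have h1 : (t + I : ℂ) = I * (1 + (-t : ℝ) * I) := by
    push_cast; ring_nf; rw [I_sq]; ring
  have h2 : Complex.arg (1 + (-t : ℝ) * I) ∈ Set.Ioo (-(Real.pi / 2)) (Real.pi / 2) := by
    have := Complex.abs_arg_lt_pi_div_two_iff (z := (1 + (-t : ℝ) * I)) |>.2 (Or.inl (by simp))
    exact abs_lt.1 this
  have h3 : Complex.log (I * (1 + (-t : ℝ) * I)) =
      Complex.log I + Complex.log (1 + (-t : ℝ) * I) := by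
    refine Complex.log_mul I_ne_zero h0 ?_
    rw [Complex.arg_I]
    constructor <;> linarith [h2.1, h2.2, Real.pi_pos]
  rw [h1, cpow_def_of_ne_zero (mul_ne_zero I_ne_zero h0), cpow_def_of_ne_zero h0, h3,
    Complex.log_I, ← Complex.exp_add]
  congr 1; push_cast; ring

theorem conj_one_add_cpow (t y : ℝ) :
    conj ((1 + (-t : ℝ) * I : ℂ) ^ (-(y : ℂ))) = (1 + t * I) ^ (-(y : ℂ)) := by
  have := Complex.conj_cpow (1 + (-t : ℝ) * I : ℂ) (-(y : ℂ))
    (mem_slitPlane_iff_arg.1 (slit_one_add_mul_I (-t))).1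
  simp only [map_neg, conj_ofReal, map_add, map_one, map_mul, conj_I] at this
  rw [← this]
  push_cast
  ring_nf

/-- Up to constants, `(1 + it)^(-x)` and `(1 - it)^(-y)` are the transforms of Gamma densities at
`t` and `-t`. The restriction to `1 < y` is harmless because `regBeta` raises the second parameter
by `p`. -/
theorem cauchyBeta_eq {x y : ℝ} (hx : 0 < x) (hy : 1 < y) :
    cauchyBeta x y = cexp (I * (Real.pi / 2) * (y - x)) *
      ((2 * Real.pi * 2 ^ (1 - (x + y)) * Real.Gamma (x + y - 1) /
        (Real.Gamma x * Real.Gamma y) : ℝ) : ℂ) := by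
  have h := integral_fourier_gdens_mul hx hy
  simp only [fourier_gdens hx, fourier_gdens (by linarith : 0 < y), cpow_two_pi_mul] at h
  have hΓx : (Real.Gamma x : ℂ) ≠ 0 := by exact_mod_cast (Real.Gamma_pos_of_pos hx).ne'
  have hΓy : (Real.Gamma y : ℂ) ≠ 0 := by
    exact_mod_cast (Real.Gamma_pos_of_pos (by linarith : 0 < y)).ne'
  have h5 : ∫ t : ℝ, (1 + t * I : ℂ) ^ (-(x : ℂ)) * (1 + (-t : ℝ) * I : ℂ) ^ (-(y : ℂ)) =
      ((2 * Real.pi * 2 ^ (1 - (x + y)) * Real.Gamma (x + y - 1) /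
        (Real.Gamma x * Real.Gamma y) : ℝ) : ℂ) := by
    have h6 : (fun t : ℝ => ((2 * Real.pi : ℝ) : ℂ) ^ (-(x : ℂ)) * (1 + t * I : ℂ) ^ (-(x : ℂ)) *
        (Real.Gamma x : ℂ) * (((2 * Real.pi : ℝ) : ℂ) ^ (-(y : ℂ)) *
        (1 + (-t : ℝ) * I : ℂ) ^ (-(y : ℂ)) * (Real.Gamma y : ℂ))) = fun t : ℝ =>
        (((2 * Real.pi : ℝ) : ℂ) ^ (-(x : ℂ)) * ((2 * Real.pi : ℝ) : ℂ) ^ (-(y : ℂ)) *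
        ((Real.Gamma x : ℂ) * (Real.Gamma y : ℂ))) *
        ((1 + t * I : ℂ) ^ (-(x : ℂ)) * (1 + (-t : ℝ) * I : ℂ) ^ (-(y : ℂ))) := by
      funext t; ring
    rw [h6, integral_const_mul] at h
    have hc : ((2 * Real.pi : ℝ) : ℂ) ^ (-(x : ℂ)) * ((2 * Real.pi : ℝ) : ℂ) ^ (-(y : ℂ)) =
        (((2 * Real.pi) ^ (-(x + y)) : ℝ) : ℂ) := by
      rw [← Complex.cpow_add _ _ (by exact_mod_cast (by positivity : 2 * Real.pi ≠ 0)),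
        Complex.ofReal_cpow (by positivity)]
      push_cast; ring_nf
    have hc2 : ((4 * Real.pi : ℝ) : ℂ) ^ (-((x + y - 1 : ℝ) : ℂ)) =
        (((4 * Real.pi) ^ (1 - (x + y)) : ℝ) : ℂ) := by
      rw [Complex.ofReal_cpow (by positivity)]
      push_cast; ring_nf
    have hreal : (4 * Real.pi) ^ (1 - (x + y)) =
        (2 * Real.pi) ^ (-(x + y)) * (2 * Real.pi * 2 ^ (1 - (x + y))) := by
      rw [show (4 : ℝ) * Real.pi = (2 * Real.pi) * 2 by ring,
        Real.mul_rpow (by positivity) (by norm_num), sub_eq_add_neg,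
        Real.rpow_add (by positivity : (0 : ℝ) < 2 * Real.pi), Real.rpow_one]
      ring
    have hne : (((2 * Real.pi) ^ (-(x + y)) : ℝ) : ℂ) ≠ 0 := by
      exact_mod_cast (Real.rpow_pos_of_pos (by positivity) _).ne'
    rw [hc, hc2, hreal] at h
    have h7 := mul_left_cancel₀ (mul_ne_zero hne (mul_ne_zero hΓx hΓy)) (h.trans
      (b := _) (c := (((2 * Real.pi) ^ (-(x + y)) : ℝ) : ℂ) * (↑(Real.Gamma x) * ↑(Real.Gamma y)) *
      ((2 * Real.pi * 2 ^ (1 - (x + y)) * Real.Gamma (x + y - 1) /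
        (Real.Gamma x * Real.Gamma y) : ℝ) : ℂ)) (by
        push_cast
        field_simp))
    exact h7
  rw [← h5, ← integral_neg_eq_self, cauchyBeta, ← integral_const_mul]
  congr 1
  funext t
  rw [add_I_cpow, add_I_cpow, map_mul, conj_one_add_cpow, ← Complex.exp_conj,
    show cexp (I * (Real.pi / 2) * (y - x)) = cexp (-(I * (Real.pi / 2) * x)) *
      cexp (conj (-(I * (Real.pi / 2) * y))) by
      rw [← Complex.exp_add]
      simp only [map_neg, map_mul, conj_I, map_div₀, conj_ofReal, map_ofNat]
      congr 1; ring]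
  simp only [neg_neg]
  ring

/-! ### The homogeneous kernels and their regularised integrals -/

/-- The open upper half plane. -/
def upper : Set ℂ := {z | 0 < z.im}

/-- The kernel `z ^ (-x) * conj (z ^ (-y))`. -/
noncomputable def kap (x y : ℝ) (z : ℂ) : ℂ :=
  z ^ ((-x : ℝ) : ℂ) * conj (z ^ ((-y : ℝ) : ℂ))

theorem sym_kap {Ω : Set ℂ} (hΩ : Ω ⊆ upper) (N : ℕ) (x y : ℝ) :
    Sym Ω N (-(x + y)) (kap x y) := by
  have := (Sym.cpow (Ω := Ω) hΩ N (-x)).mul (fun z hz => ne_zero_of_im_pos (hΩ hz))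
    (Sym.cpow (Ω := Ω) hΩ N (-y)).conj
  rwa [show -x + -y = -(x + y) by ring] at this

theorem continuousOn_kap (x y : ℝ) : ContinuousOn (kap x y) upper := by
  intro z hz
  refine ContinuousAt.continuousWithinAt (ContinuousAt.mul ?_ (Complex.continuous_conj.continuousAt.comp ?_))
  all_goals exact continuousAt_cpow_const (Or.inr (ne_of_gt hz))

theorem hasLineDerivAt_kap (x y : ℝ) {z : ℂ} (hz : z ∈ upper) (v : ℂ) :
    HasLineDerivAt ℝ (kap x y) (-(x * v) * kap (x + 1) y z + -(y * conj v) * kap x (y + 1) z)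
      z v := by
  have h1 := hasLineDerivAt_cpow hz ((-x : ℝ) : ℂ) v
  have h2 := (Complex.conjCLE : ℂ →L[ℝ] ℂ).hasFDerivAt.comp_hasDerivAt (0 : ℝ)
    (hasLineDerivAt_cpow hz ((-y : ℝ) : ℂ) v)
  have h3 := HasDerivAt.mul h1 h2
  simp only [zero_smul, add_zero, Function.comp_apply] at h3
  unfold HasLineDerivAt
  convert! h3 using 1
  simp only [kap, ContinuousLinearEquiv.coe_coe, conjCLE_apply, map_mul, conj_ofReal]
  push_cast
  ring_nf

theorem kap_smul (x y : ℝ) {s : ℝ} (hs : 0 < s) (z : ℂ) :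
    kap x y (s * z) = ((s ^ (-(x + y)) : ℝ) : ℂ) * kap x y z := by
  have h : ∀ e : ℝ, ((s : ℂ) * z) ^ (e : ℂ) = ((s ^ e : ℝ) : ℂ) * z ^ (e : ℂ) := by
    intro e
    by_cases hz : z = 0
    · subst hz
      by_cases he : e = 0 <;> simp [he]
    have h0 : (s : ℂ) ≠ 0 := by exact_mod_cast hs.ne'
    rw [cpow_def_of_ne_zero (mul_ne_zero h0 hz), Complex.ofReal_cpow hs.le,
      cpow_def_of_ne_zero h0, cpow_def_of_ne_zero hz, Complex.log_ofReal_mul hs hz,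
      Complex.ofReal_log hs.le, ← Complex.exp_add]
    ring_nf
  rw [kap, h, h, map_mul, conj_ofReal, kap, neg_add, Real.rpow_add hs]
  push_cast
  ring

theorem fwdDiff_iterate_smul (x y : ℝ) {s : ℝ} (hs : 0 < s) (p : ℕ) (z : ℂ) :
    (fwdDiff (s * I))^[p] (kap x y) (s * z) =
      ((s ^ (-(x + y)) : ℝ) : ℂ) * (fwdDiff I)^[p] (kap x y) z := by
  rw [fwdDiff_iter_eq_sum_shift, fwdDiff_iter_eq_sum_shift, Finset.mul_sum]
  refine Finset.sum_congr rfl fun i _ => ?_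
  rw [mul_smul_comm, ← kap_smul x y hs]
  congr 2
  rw [nsmul_eq_mul, nsmul_eq_mul]; ring

theorem continuousOn_fwdDiff_iterate {K : ℂ → ℂ} (hK : ContinuousOn K upper) {s : ℝ} (hs : 0 ≤ s)
    (p : ℕ) : ContinuousOn ((fwdDiff (s * I))^[p] K) upper := by
  induction p with
  | zero => exact hK
  | succ p ih =>
    rw [Function.iterate_succ_apply']
    refine ContinuousOn.sub (ih.comp (by fun_prop) fun z hz => ?_) ih
    have : 0 < z.im := hz
    change 0 < (z + s * I).im
    simp; linarith

theorem add_mul_I_mem_upper (v : ℝ) {t : ℝ} (ht : 0 < t) : (v + t * I : ℂ) ∈ upper := by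
  simpa [upper] using ht

theorem norm_add_mul_I_ge (v : ℝ) {t : ℝ} (ht : 0 < t) :
    min 1 t * ‖(1 + v * I : ℂ)‖ ≤ ‖(v + t * I : ℂ)‖ := by
  have h : 0 < min 1 t := lt_min one_pos ht
  rw [norm_one_add_mul_I, Complex.norm_add_mul_I, ← Real.sqrt_sq h.le,
    ← Real.sqrt_mul (by positivity), mul_add]
  refine Real.sqrt_le_sqrt ?_
  have h1 : min 1 t ^ 2 ≤ t ^ 2 := by gcongr; exact min_le_right _ _
  have h2 : min 1 t ^ 2 ≤ 1 := pow_le_one₀ h.le (min_le_left _ _)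
  nlinarith [sq_nonneg v]

theorem integrable_norm_line {t γ : ℝ} (ht : 0 < t) (hγ : 1 < γ) :
    Integrable fun v : ℝ => ‖(v + t * I : ℂ)‖ ^ (-γ) := by
  refine ((integrable_one_add_mul_I hγ).const_mul ((min 1 t) ^ (-γ))).mono' ?_
    (Eventually.of_forall fun v => ?_)
  · refine Continuous.aestronglyMeasurable (Continuous.rpow_const (by fun_prop) fun v => Or.inl ?_)
    exact norm_ne_zero_iff.2 (ne_zero_of_im_pos (add_mul_I_mem_upper v ht))
  · have h : 0 < min 1 t := lt_min one_pos ht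
    have h1 : 0 < ‖(1 + v * I : ℂ)‖ :=
      norm_pos_iff.2 (slitPlane_ne_zero (slit_one_add_mul_I v))
    rw [Real.norm_of_nonneg (by positivity), ← Real.mul_rpow h.le h1.le]
    exact Real.rpow_le_rpow_of_nonpos (by positivity) (norm_add_mul_I_ge v ht) (by linarith)

/-- Each difference improves the decay by one power. Thus integrals over horizontal lines converge
as soon as `x + y + p > 1`, although the kernel itself need not be integrable. -/
theorem norm_fwdDiff_kap_le (x y : ℝ) (p : ℕ) (h : 0 ≤ x + y + p) :
    ∃ C : ℝ, 0 ≤ C ∧ ∀ (z : ℂ), z ∈ upper → ∀ s : ℝ, 0 ≤ s →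
      ‖(fwdDiff (s * I))^[p] (kap x y) z‖ ≤ C * s ^ p * ‖z‖ ^ (-(x + y + p)) := by
  obtain ⟨C, hC, hb⟩ := (sym_kap subset_rfl p x y).norm_fwdDiff_le (fun z hz => hz)
    (by linarith)
  refine ⟨C, hC, fun z hz s hs => ?_⟩
  have := hb z s hs fun t ht _ => by
    have : 0 < z.im := hz
    change 0 < (z + t * I).im
    simp; linarith
  rwa [show -(x + y) - p = -(x + y + p) by ring] at this

theorem continuous_line {K : ℂ → ℂ} (hK : ContinuousOn K upper) {t : ℝ} (ht : 0 < t) :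
    Continuous fun v : ℝ => K (v + t * I) :=
  hK.comp_continuous (by fun_prop) fun v => add_mul_I_mem_upper v ht

theorem continuousOn_fwdDiff_kap (x y : ℝ) (p : ℕ) :
    ContinuousOn ((fwdDiff I)^[p] (kap x y)) upper := by
  have := continuousOn_fwdDiff_iterate (continuousOn_kap x y) zero_le_one p
  simpa using this

theorem integrable_fwdDiff_kap {x y : ℝ} {p : ℕ} (h : 1 < x + y + p) {t : ℝ} (ht : 0 < t) :
    Integrable fun v : ℝ => (fwdDiff I)^[p] (kap x y) (v + t * I) := by
  obtain ⟨C, hC, hb⟩ := norm_fwdDiff_kap_le x y p (by linarith)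
  refine ((integrable_norm_line ht h).const_mul C).mono'
    (continuous_line (continuousOn_fwdDiff_kap x y p) ht).aestronglyMeasurable
    (Eventually.of_forall fun v => ?_)
  have := hb _ (add_mul_I_mem_upper v ht) 1 zero_le_one
  simpa using this

/-- The regularised integral of `kap x y` along the horizontal line at height `t`. -/
noncomputable def regInt (p : ℕ) (x y t : ℝ) : ℂ :=
  ∫ v : ℝ, (fwdDiff I)^[p] (kap x y) (v + t * I)

theorem regInt_zero_one (x y : ℝ) : regInt 0 x y 1 = cauchyBeta x y := by
  simp [regInt, cauchyBeta, kap]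

theorem regInt_zero (x y : ℝ) {t : ℝ} (ht : 0 < t) :
    regInt 0 x y t = ((t ^ (1 - (x + y)) : ℝ) : ℂ) * cauchyBeta x y := by
  rw [← regInt_zero_one, regInt, regInt]
  simp only [Function.iterate_zero, id]
  have h := Measure.integral_comp_mul_left (fun v : ℝ => kap x y (v + t * I)) t
  have h2 : ∀ v : ℝ, kap x y ((t * v : ℝ) + t * I) =
      ((t ^ (-(x + y)) : ℝ) : ℂ) * kap x y (v + (1 : ℝ) * I) := by
    intro v
    rw [← kap_smul x y ht]; congr 1; push_cast; ring
  simp only [h2, integral_const_mul, abs_of_pos (inv_pos.2 ht)] at h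
  have ht0 : (t : ℂ) ≠ 0 := by exact_mod_cast ht.ne'
  rw [show 1 - (x + y) = 1 + -(x + y) by ring, Real.rpow_add ht, Real.rpow_one, ofReal_mul,
    mul_assoc, h, real_smul]
  push_cast
  field_simp

theorem tendsto_fwdDiff_kap {x y : ℝ} {p : ℕ} (h : 0 < x + y + p) {t : ℝ} (ht : 0 < t)
    {l : Filter ℝ} (hl : Tendsto (fun v : ℝ => ‖(v + t * I : ℂ)‖) l atTop) :
    Tendsto (fun v : ℝ => (fwdDiff I)^[p] (kap x y) (v + t * I)) l (𝓝 0) := by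
  obtain ⟨C, hC, hb⟩ := norm_fwdDiff_kap_le x y p h.le
  refine squeeze_zero_norm (a := fun v : ℝ => C * ‖(v + t * I : ℂ)‖ ^ (-(x + y + p)))
    (fun v => ?_) ?_
  · have := hb _ (add_mul_I_mem_upper v ht) 1 zero_le_one
    simpa using this
  · have := ((tendsto_rpow_neg_atTop h).comp hl).const_mul C
    simpa using this

theorem tendsto_norm_line_atTop (t : ℝ) :
    Tendsto (fun v : ℝ => ‖(v + t * I : ℂ)‖) atTop atTop :=
  tendsto_atTop_mono (fun v => by
    have := Complex.abs_re_le_norm (v + t * I : ℂ)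
    simp at this
    exact (le_abs_self v).trans this) tendsto_id

theorem tendsto_norm_line_atBot (t : ℝ) :
    Tendsto (fun v : ℝ => ‖(v + t * I : ℂ)‖) atBot atTop :=
  tendsto_atTop_mono (fun v => by
    have := Complex.abs_re_le_norm (v + t * I : ℂ)
    simp at this
    exact (neg_le_abs v).trans this) tendsto_neg_atBot_atTop

theorem hasDerivAt_horizontal {K K' : ℂ → ℂ} {p : ℕ} {t : ℝ} (ht : 0 < t) {s : ℝ} (hs : 0 ≤ s)
    (h : ∀ z ∈ upper, HasLineDerivAt ℝ K (K' z) z 1) (v : ℝ) :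
    HasDerivAt (fun v : ℝ => (fwdDiff (s * I))^[p] K (v + t * I))
      ((fwdDiff (s * I))^[p] K' (v + t * I)) v := by
  have h1 : HasLineDerivAt ℝ ((fwdDiff (s * I))^[p] K) ((fwdDiff (s * I))^[p] K' (v + t * I))
      (v + t * I) 1 := by
    refine hasLineDerivAt_fwdDiff_iterate fun i _ => h _ ?_
    have : 0 ≤ (i : ℝ) * s := by positivity
    change 0 < Complex.im _
    simp; linarith
  have h2 : HasLineDerivAt ℝ ((fwdDiff (s * I))^[p] K) ((fwdDiff (s * I))^[p] K' (v + t * I))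
      (t * I + v • 1) 1 := by
    rw [show (t * I + v • (1 : ℂ)) = v + t * I by simp [add_comm]]; exact h1
  refine (hasDerivAt_of_hasLineDerivAt h2).congr_of_eventuallyEq (Eventually.of_forall fun u => ?_)
  simp [add_comm]

theorem fwdDiff_iterate_comb (a b : ℂ) (K L : ℂ → ℂ) (p : ℕ) (h z : ℂ) :
    (fwdDiff h)^[p] (fun z => a * K z + b * L z) z =
      a * (fwdDiff h)^[p] K z + b * (fwdDiff h)^[p] L z := by
  simp only [fwdDiff_iter_eq_sum_shift, smul_add, Finset.sum_add_distrib, Finset.mul_sum,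
    mul_smul_comm]

/-- Integration by parts for the Cauchy beta integral. -/
theorem cauchyBeta_shift {x y : ℝ} (h : 1 < x + y) :
    (1 - x) * cauchyBeta x y = y * cauchyBeta (x - 1) (y + 1) := by
  have hd : ∀ v : ℝ, HasDerivAt (fun v : ℝ => kap (x - 1) y (v + (1 : ℝ) * I))
      ((1 - x) * kap x y (v + (1 : ℝ) * I) + -y * kap (x - 1) (y + 1) (v + (1 : ℝ) * I)) v := by
    intro v
    have := hasDerivAt_horizontal (p := 0) (s := 0) one_pos le_rfl
      (fun z hz => hasLineDerivAt_kap (x - 1) y hz 1) v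
    simpa using this
  have i1 : Integrable fun v : ℝ => kap x y (v + (1 : ℝ) * I) := by
    have := integrable_fwdDiff_kap (x := x) (y := y) (p := 0) (by simpa using h) one_pos
    simpa using this
  have i2 : Integrable fun v : ℝ => kap (x - 1) (y + 1) (v + (1 : ℝ) * I) := by
    have := integrable_fwdDiff_kap (x := x - 1) (y := y + 1) (p := 0)
      (by push_cast; linarith) one_pos
    simpa using this
  have t0 : ∀ l : Filter ℝ, Tendsto (fun v : ℝ => ‖(v + (1 : ℝ) * I : ℂ)‖) l atTop →
      Tendsto (fun v : ℝ => kap (x - 1) y (v + (1 : ℝ) * I)) l (𝓝 0) := fun l hl => by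
    have := tendsto_fwdDiff_kap (x := x - 1) (y := y) (p := 0) (by push_cast; linarith) one_pos hl
    simpa using this
  have := integral_of_hasDerivAt_of_tendsto hd ((i1.const_mul _).add (i2.const_mul _))
    (t0 _ (tendsto_norm_line_atBot 1)) (t0 _ (tendsto_norm_line_atTop 1))
  rw [integral_add (i1.const_mul _) (i2.const_mul _), integral_const_mul, integral_const_mul] at this
  have e1 : ∀ x y, ∫ v : ℝ, kap x y (v + (1 : ℝ) * I) = cauchyBeta x y := fun x y => by
    simp [cauchyBeta, kap]
  rw [e1, e1] at this
  linear_combination this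

/-- The weights occurring in the regularised integrals. -/
noncomputable def regWeight (σ : ℝ) : ℕ → ℝ → ℝ
  | 0, t => t ^ (1 - σ)
  | p + 1, t => ∫ τ in (0 : ℝ)..1, regWeight σ p (t + τ)

/-- Positivity is the point: the weight can later be cancelled. Monotonicity is carried along to
have integrability in the recursive definition. -/
theorem regWeight_pos_antitone {σ : ℝ} (hσ : 1 < σ) (p : ℕ) :
    (∀ t, 0 < t → 0 < regWeight σ p t) ∧ AntitoneOn (regWeight σ p) (Set.Ioi 0) := by
  induction p with
  | zero =>
    exact ⟨fun t ht => Real.rpow_pos_of_pos ht _, fun a ha b _ hab =>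
      Real.rpow_le_rpow_of_nonpos ha hab (by linarith)⟩
  | succ p ih =>
    have hi : ∀ t, 0 < t → IntervalIntegrable (fun τ => regWeight σ p (t + τ)) volume 0 1 := by
      intro t ht
      refine AntitoneOn.intervalIntegrable fun a ha b hb hab => ?_
      rw [Set.uIcc_of_le zero_le_one] at ha hb
      exact ih.2 (by simp; linarith [ha.1]) (by simp; linarith [hb.1]) (by linarith)
    refine ⟨fun t ht => ?_, fun a ha b hb hab => ?_⟩
    · exact intervalIntegral.intervalIntegral_pos_of_pos_on (hi t ht)
        (fun τ hτ => ih.1 _ (by linarith [hτ.1])) one_pos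
    · have ha' : 0 < a := ha
      have hb' : 0 < b := hb
      exact intervalIntegral.integral_mono_on zero_le_one (hi b hb') (hi a ha')
        fun τ hτ => ih.2 (by simp; linarith [hτ.1]) (by simp; linarith [hτ.1]) (by linarith)

/-! ### Evaluation of the regularised integrals -/

theorem integrable_prod_line {F : ℂ → ℂ} (hF : ContinuousOn F upper) {t : ℝ} (ht : 0 < t)
    {C γ : ℝ} (hC : 0 ≤ C) (hγ : 1 < γ) (hb : ∀ z ∈ upper, ‖F z‖ ≤ C * ‖z‖ ^ (-γ)) :
    Integrable (Function.uncurry fun (τ v : ℝ) => F (v + (t + τ : ℝ) * I))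
      ((volume.restrict (Set.uIoc 0 1)).prod volume) := by
  have h1 : Integrable (fun q : ℝ × ℝ => C * ‖(q.2 + t * I : ℂ)‖ ^ (-γ))
      ((volume.restrict (Set.uIoc 0 1)).prod volume) := by
    have : Integrable (fun _ : ℝ => C) (volume.restrict (Set.uIoc (0 : ℝ) 1)) := by
      rw [Set.uIoc_of_le zero_le_one]
      exact integrable_const C
    exact this.mul_prod (integrable_norm_line ht hγ)
  have hm : (volume.restrict (Set.uIoc (0 : ℝ) 1)).prod (volume : Measure ℝ) =
      ((volume : Measure ℝ).prod (volume : Measure ℝ)).restrict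
        (Set.uIoc (0 : ℝ) 1 ×ˢ Set.univ) := by
    rw [← Measure.prod_restrict, Measure.restrict_univ]
  have hms : MeasurableSet (Set.uIoc (0 : ℝ) 1 ×ˢ (Set.univ : Set ℝ)) :=
    measurableSet_uIoc.prod MeasurableSet.univ
  have hmem : ∀ q ∈ Set.uIoc (0 : ℝ) 1 ×ˢ (Set.univ : Set ℝ), 0 < q.1 := fun q hq => by
    have := hq.1
    rw [Set.uIoc_of_le zero_le_one] at this
    exact this.1
  refine h1.mono' ?_ ?_
  · rw [hm]
    refine ContinuousOn.aestronglyMeasurable ?_ hms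
    exact hF.comp (by fun_prop) fun q hq => add_mul_I_mem_upper _ (by linarith [hmem q hq])
  · rw [hm]
    refine (ae_restrict_iff' hms).2 (Eventually.of_forall fun q hq => ?_)
    have hq0 := hmem q hq
    refine (hb _ (add_mul_I_mem_upper _ (by linarith))).trans ?_
    have h2 := norm_le_norm_add_I (add_mul_I_mem_upper q.2 ht) hq0.le
    have h3 : ‖(q.2 + (t + q.1 : ℝ) * I : ℂ)‖ ^ (-γ) ≤ ‖(q.2 + t * I : ℂ)‖ ^ (-γ) := by
      refine Real.rpow_le_rpow_of_nonpos
        (norm_pos_iff.2 (ne_zero_of_im_pos (add_mul_I_mem_upper q.2 ht))) ?_ (by linarith)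
      refine h2.trans_eq ?_
      congr 1; push_cast; ring
    gcongr

/-- One difference is the integral over `[0,1]` of the vertical derivative. That derivative is `I`
times the horizontal one plus `2Iy` times the kernel with `y + 1`; after Fubini the horizontal part
integrates to 0. -/
theorem regInt_succ {x y : ℝ} {p : ℕ} (h : 1 < x + y + (p + 1 : ℕ)) {t : ℝ} (ht : 0 < t) :
    regInt (p + 1) x y t =
      2 * I * y * ∫ τ in (0 : ℝ)..1, regInt p x (y + 1) (t + τ) := by
  push_cast at h
  set A : ℂ → ℂ := fun z => -(x * 1) * kap (x + 1) y z + -(y * conj 1) * kap x (y + 1) z with hA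
  set B : ℂ → ℂ := fun z => -(x * I) * kap (x + 1) y z + -(y * conj I) * kap x (y + 1) z with hB
  -- `A` and `B` are the horizontal and the vertical derivative of the kernel. Their antiholomorphic
  -- parts enter with opposite signs relative to multiplication by `I`, which leaves the term `2Iy`.
  have hBA : B = fun z => I * A z + (2 * I * y) * kap x (y + 1) z := by
    funext z; simp only [hA, hB, conj_I, map_one]; ring
  have cA : ContinuousOn A upper :=
    ((continuousOn_const).mul (continuousOn_kap _ _)).add
      (continuousOn_const.mul (continuousOn_kap _ _))
  have cB : ContinuousOn B upper :=
    ((continuousOn_const).mul (continuousOn_kap _ _)).add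
      (continuousOn_const.mul (continuousOn_kap _ _))
  have contΔ : ∀ {K : ℂ → ℂ}, ContinuousOn K upper → ContinuousOn ((fwdDiff I)^[p] K) upper :=
    fun hK => by simpa using continuousOn_fwdDiff_iterate hK zero_le_one p
  obtain ⟨C₁, hC₁, hb₁⟩ := norm_fwdDiff_kap_le (x + 1) y p (by linarith)
  obtain ⟨C₂, hC₂, hb₂⟩ := norm_fwdDiff_kap_le x (y + 1) p (by linarith)
  have bd : ∀ a b : ℂ, ∀ z ∈ upper,
      ‖(fwdDiff I)^[p] (fun z => a * kap (x + 1) y z + b * kap x (y + 1) z) z‖ ≤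
        (‖a‖ * C₁ + ‖b‖ * C₂) * ‖z‖ ^ (-(x + y + (p + 1))) := by
    intro a b z hz
    have e1 := hb₁ z hz 1 zero_le_one
    have e2 := hb₂ z hz 1 zero_le_one
    rw [show x + 1 + y + p = x + y + (p + 1) by ring] at e1
    rw [show x + (y + 1) + p = x + y + (p + 1) by ring] at e2
    simp only [ofReal_one, one_mul, one_pow, mul_one] at e1 e2
    rw [fwdDiff_iterate_comb]
    refine (norm_add_le _ _).trans ?_
    rw [norm_mul, norm_mul, add_mul, mul_assoc, mul_assoc]
    gcongr
  have iA : ∀ s : ℝ, 0 < s → Integrable fun v : ℝ => (fwdDiff I)^[p] A (v + s * I) := fun s hs =>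
    (((integrable_norm_line hs h).const_mul _).mono'
      (continuous_line (contΔ cA) hs).aestronglyMeasurable
      (Eventually.of_forall fun v => bd _ _ _ (add_mul_I_mem_upper v hs)))
  have zA : ∀ s : ℝ, 0 < s → ∫ v : ℝ, (fwdDiff I)^[p] A (v + s * I) = 0 := by
    intro s hs
    have hd : ∀ v : ℝ, HasDerivAt (fun v : ℝ => (fwdDiff I)^[p] (kap x y) (v + s * I))
        ((fwdDiff I)^[p] A (v + s * I)) v := fun v => by
      have := hasDerivAt_horizontal (p := p) (s := 1) hs zero_le_one
        (fun z hz => hasLineDerivAt_kap x y hz 1) v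
      simpa only [ofReal_one, one_mul] using this
    have := integral_of_hasDerivAt_of_tendsto hd (iA s hs)
      (tendsto_fwdDiff_kap (by linarith) hs (tendsto_norm_line_atBot s))
      (tendsto_fwdDiff_kap (by linarith) hs (tendsto_norm_line_atTop s))
    simpa using this
  have inner : ∀ s : ℝ, 0 < s → ∫ v : ℝ, (fwdDiff I)^[p] B (v + s * I) =
      2 * I * y * regInt p x (y + 1) s := by
    intro s hs
    have hk := integrable_fwdDiff_kap (x := x) (y := y + 1) (p := p) (by linarith) hs
    simp only [hBA, fwdDiff_iterate_comb]
    rw [integral_add ((iA s hs).const_mul _) (hk.const_mul _), integral_const_mul,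
      integral_const_mul, zA s hs, regInt]
    ring
  have ftc : ∀ v : ℝ, (fwdDiff I)^[p + 1] (kap x y) (v + t * I) =
      ∫ τ in (0 : ℝ)..1, (fwdDiff I)^[p] B (v + (t + τ : ℝ) * I) := by
    intro v
    have hd : ∀ τ ∈ Set.uIcc (0 : ℝ) 1,
        HasDerivAt (fun τ : ℝ => (fwdDiff I)^[p] (kap x y) (v + t * I + τ • I))
          ((fwdDiff I)^[p] B (v + (t + τ : ℝ) * I)) τ := by
      intro τ hτ
      rw [Set.uIcc_of_le zero_le_one] at hτ
      have := hτ.1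
      have e : (v + (t + τ : ℝ) * I : ℂ) = v + t * I + τ • I := by
        rw [real_smul]; push_cast; ring
      rw [e]
      refine hasDerivAt_of_hasLineDerivAt (hasLineDerivAt_fwdDiff_iterate fun i _ =>
        hasLineDerivAt_kap x y ?_ I)
      change 0 < Complex.im _
      simp; positivity
    rw [intervalIntegral.integral_eq_sub_of_hasDerivAt hd]
    · rw [Function.iterate_succ_apply', fwdDiff]; simp
    · refine ContinuousOn.intervalIntegrable ?_
      rw [Set.uIcc_of_le zero_le_one]
      exact (contΔ cB).comp (by fun_prop) fun τ hτ =>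
        add_mul_I_mem_upper v (by linarith [hτ.1])
  rw [regInt]
  simp only [ftc]
  have swap := intervalIntegral_integral_swap (a := 0) (b := 1)
    (integrable_prod_line (contΔ cB) ht (by positivity) h (bd _ _))
  rw [← swap, ← intervalIntegral.integral_const_mul]
  refine intervalIntegral.integral_congr fun τ hτ => ?_
  rw [Set.uIcc_of_le zero_le_one] at hτ
  exact inner _ (by linarith [hτ.1])

/-- The weight depends on `x` and `y` only through `x + y + p`, hence is the same for all monomials
of one degree. Only the Pochhammer product and the convergent beta integral see the individual
exponents. -/
theorem regInt_eq {x y : ℝ} {p : ℕ} (h : 1 < x + y + p) {t : ℝ} (ht : 0 < t) :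
    regInt p x y t = (2 * I) ^ p * (∏ i ∈ Finset.range p, ((y + i : ℝ) : ℂ)) *
      cauchyBeta x (y + p) * regWeight (x + y + p) p t := by
  induction p generalizing y t with
  | zero => rw [regInt_zero _ _ ht]; simp [regWeight]; ring
  | succ p ih =>
    rw [regInt_succ h ht, Finset.prod_range_succ', regWeight, ← intervalIntegral.integral_ofReal]
    rw [← intervalIntegral.integral_const_mul, ← intervalIntegral.integral_const_mul]
    refine intervalIntegral.integral_congr fun τ hτ => ?_
    rw [Set.uIcc_of_le zero_le_one] at hτ
    rw [ih (y := y + 1) (by push_cast at h; linarith) (by linarith [hτ.1])]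
    have e1 : x + (y + 1) + p = x + y + (p + 1 : ℕ) := by push_cast; ring
    have e2 : y + 1 + p = y + (p + 1 : ℕ) := by push_cast; ring
    have e3 : ∀ i : ℕ, y + 1 + i = y + (i + 1 : ℕ) := fun i => by push_cast; ring
    simp only [e1, e2, e3, pow_succ, Nat.cast_zero, add_zero]
    ring

/-! ### Taylor expansions on convex sets -/

/-- `P` is a homogeneous polynomial of degree `d` in `w` and `conj w`. -/
def IsHom (d : ℕ) (P : ℂ → ℂ) : Prop :=
  ∃ p : ℕ → ℂ, ∀ w, P w = ∑ a ∈ Finset.range (d + 1), p a * wmono a (d - a) w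

theorem wmono_smul (a b : ℕ) (t : ℝ) (w : ℂ) :
    wmono a b (t * w) = (t : ℂ) ^ (a + b) * wmono a b w := by
  simp only [wmono, map_mul, conj_ofReal]; ring

theorem IsHom.smul {d : ℕ} {P : ℂ → ℂ} (h : IsHom d P) (t : ℝ) (w : ℂ) :
    P (t * w) = (t : ℂ) ^ d * P w := by
  obtain ⟨p, hp⟩ := h
  rw [hp, hp, Finset.mul_sum]
  refine Finset.sum_congr rfl fun a ha => ?_
  rw [wmono_smul, show a + (d - a) = d by have := Finset.mem_range.1 ha; omega]
  ring

theorem isHom_const (c : ℂ) : IsHom 0 fun _ => c := ⟨fun _ => c, fun w => by simp [wmono]⟩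

theorem IsHom.add {d : ℕ} {P Q : ℂ → ℂ} (hP : IsHom d P) (hQ : IsHom d Q) :
    IsHom d fun w => P w + Q w := by
  obtain ⟨p, hp⟩ := hP
  obtain ⟨q, hq⟩ := hQ
  exact ⟨fun a => p a + q a, fun w => by
    simp only [hp, hq, ← Finset.sum_add_distrib]; exact Finset.sum_congr rfl fun _ _ => by ring⟩

theorem IsHom.const_mul {d : ℕ} {P : ℂ → ℂ} (hP : IsHom d P) (c : ℂ) :
    IsHom d fun w => c * P w := by
  obtain ⟨p, hp⟩ := hP
  exact ⟨fun a => c * p a, fun w => by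
    simp only [hp, Finset.mul_sum]; exact Finset.sum_congr rfl fun _ _ => by ring⟩

theorem IsHom.mul_self {d : ℕ} {P : ℂ → ℂ} (hP : IsHom d P) :
    IsHom (d + 1) fun w => P w * w := by
  obtain ⟨p, hp⟩ := hP
  refine ⟨fun a => if a = 0 then 0 else p (a - 1), fun w => ?_⟩
  simp only
  rw [hp, Finset.sum_range_succ' _ (d + 1), Finset.sum_mul]
  simp only [if_true, zero_mul, add_zero, Nat.succ_ne_zero, if_false, Nat.add_sub_cancel]
  refine Finset.sum_congr rfl fun a _ => ?_
  rw [wmono, wmono, show d + 1 - (a + 1) = d - a by omega]; ring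

theorem IsHom.mul_conj {d : ℕ} {P : ℂ → ℂ} (hP : IsHom d P) :
    IsHom (d + 1) fun w => P w * conj w := by
  obtain ⟨p, hp⟩ := hP
  refine ⟨fun a => if a = d + 1 then 0 else p a, fun w => ?_⟩
  simp only
  rw [hp, Finset.sum_range_succ _ (d + 1), Finset.sum_mul]
  simp only [if_true, zero_mul, add_zero]
  refine Finset.sum_congr rfl fun a ha => ?_
  have := Finset.mem_range.1 ha
  rw [if_neg (by omega), wmono, wmono, show d + 1 - a = (d - a) + 1 by omega]; ring

/-- The `(n+1)`-st derivative of `g` is the `n`-th derivative of its differential up to an isometric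
currying. So a modulus of continuity passes to the components of the differential at the cost of
`‖L‖`. -/
theorem norm_iteratedFDerivWithin_clm_comp_fderivWithin_sub {T : Set ℂ} (hT : UniqueDiffOn ℝ T)
    {n : ℕ} {g : ℂ → ℂ} (hg : ContDiffOn ℝ (n + 1 : ℕ) g T) (L : (ℂ →L[ℝ] ℂ) →L[ℝ] ℂ) {x y : ℂ}
    (hx : x ∈ T) (hy : y ∈ T) :
    ‖iteratedFDerivWithin ℝ n (fun w => L (fderivWithin ℝ g T w)) T x -
      iteratedFDerivWithin ℝ n (fun w => L (fderivWithin ℝ g T w)) T y‖ ≤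
    ‖L‖ * ‖iteratedFDerivWithin ℝ (n + 1) g T x - iteratedFDerivWithin ℝ (n + 1) g T y‖ := by
  have hd : ContDiffOn ℝ n (fderivWithin ℝ g T) T := hg.fderivWithin hT (by norm_cast)
  have h1 : ∀ z ∈ T, iteratedFDerivWithin ℝ n (fun w => L (fderivWithin ℝ g T w)) T z =
      L.compContinuousMultilinearMap (iteratedFDerivWithin ℝ n (fderivWithin ℝ g T) T z) :=
    fun z hz => L.iteratedFDerivWithin_comp_left (hd z hz) hT hz le_rfl
  have h2 : ∀ z ∈ T, iteratedFDerivWithin ℝ (n + 1) g T z =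
      (continuousMultilinearCurryRightEquiv' ℝ n ℂ ℂ).symm
        (iteratedFDerivWithin ℝ n (fderivWithin ℝ g T) T z) :=
    fun z hz => iteratedFDerivWithin_succ_eq_comp_right hT hz
  have h3 : ‖iteratedFDerivWithin ℝ (n + 1) g T x - iteratedFDerivWithin ℝ (n + 1) g T y‖ =
      ‖iteratedFDerivWithin ℝ n (fderivWithin ℝ g T) T x -
        iteratedFDerivWithin ℝ n (fderivWithin ℝ g T) T y‖ := by
    rw [h2 x hx, h2 y hy]
    set e := (continuousMultilinearCurryRightEquiv' ℝ n ℂ ℂ).symm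
    exact (congrArg norm (e.map_sub _ _).symm).trans (e.norm_map _)
  rw [h1 x hx, h1 y hy, h3]
  refine le_trans (le_of_eq ?_) (L.norm_compContinuousMultilinearMap_le _)
  congr 1
  ext v
  simp

/-- Induction on `n`: the two Wirtinger derivatives of `g` have such expansions, and these are
integrated along the segment from `w₀` to `w`, which lies in `T` by convexity. The integration takes
the form of a mean value inequality for `g` minus its candidate polynomial. -/
theorem exists_taylor_of_modulus {ϖ : ℝ → ℝ} (hϖ : MonotoneOn ϖ (Set.Ici 0))
    (hϖ0 : ∀ t, 0 ≤ t → 0 ≤ ϖ t) {T : Set ℂ} (hT : Convex ℝ T) (hTd : UniqueDiffOn ℝ T)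
    {w₀ : ℂ} (hw₀ : w₀ ∈ T) {n : ℕ} {g : ℂ → ℂ} (hg : ContDiffOn ℝ n g T) {C : ℝ}
    (hC : ∀ x ∈ T, ∀ y ∈ T,
      ‖iteratedFDerivWithin ℝ n g T x - iteratedFDerivWithin ℝ n g T y‖ ≤ C * ϖ ‖x - y‖) :
    ∃ P : ℕ → ℂ → ℂ, (∀ d, IsHom d (P d)) ∧ ∃ C' : ℝ, 0 ≤ C' ∧ ∀ w ∈ T,
      ‖g w - ∑ d ∈ Finset.range (n + 1), P d (w - w₀)‖ ≤ C' * (‖w - w₀‖ ^ n * ϖ ‖w - w₀‖) := by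
  induction n generalizing g C with
  | zero =>
    refine ⟨fun d _ => if d = 0 then g w₀ else 0, fun d => ?_, |C|, abs_nonneg C, fun w hw => ?_⟩
    · by_cases hd : d = 0
      · subst hd; simpa using isHom_const (g w₀)
      · exact ⟨fun _ => 0, fun w => by simp [hd]⟩
    · have h1 := hC w hw w₀ hw₀
      have h2 : ‖iteratedFDerivWithin ℝ 0 g T w - iteratedFDerivWithin ℝ 0 g T w₀‖ =
          ‖g w - g w₀‖ := by
        rw [iteratedFDerivWithin_zero_eq_comp]
        simp only [Function.comp_apply]
        rw [← map_sub, LinearIsometryEquiv.norm_map]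
      rw [h2] at h1
      simp only [zero_add, Finset.range_one, Finset.sum_singleton, if_true, pow_zero, one_mul]
      exact h1.trans (mul_le_mul_of_nonneg_right (le_abs_self C) (hϖ0 _ (norm_nonneg _)))
  | succ n ih =>
    -- The choices `c = -I` and `c = I` give the derivatives with respect to `w` and `w̄`.
    set L : ℂ → (ℂ →L[ℝ] ℂ) →L[ℝ] ℂ := fun c =>
      (2 : ℂ)⁻¹ • (ContinuousLinearMap.apply ℝ ℂ (1 : ℂ) +
        c • ContinuousLinearMap.apply ℝ ℂ (I : ℂ)) with hL
    have hd : ContDiffOn ℝ n (fderivWithin ℝ g T) T := hg.fderivWithin hTd (by norm_cast)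
    have step : ∀ c : ℂ, ∃ P : ℕ → ℂ → ℂ, (∀ d, IsHom d (P d)) ∧ ∃ C' : ℝ, 0 ≤ C' ∧ ∀ w ∈ T,
        ‖L c (fderivWithin ℝ g T w) - ∑ d ∈ Finset.range (n + 1), P d (w - w₀)‖ ≤
          C' * (‖w - w₀‖ ^ n * ϖ ‖w - w₀‖) := by
      intro c
      refine ih (g := fun w => L c (fderivWithin ℝ g T w)) (C := ‖L c‖ * C)
        ((L c).contDiff.comp_contDiffOn hd) fun x hx y hy => ?_
      refine (norm_iteratedFDerivWithin_clm_comp_fderivWithin_sub hTd hg (L c) hx hy).trans ?_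
      rw [mul_assoc]
      exact mul_le_mul_of_nonneg_left (hC x hx y hy) (L c).opNorm_nonneg
    obtain ⟨A, hA, CA, hCA, hbA⟩ := step (-I)
    obtain ⟨B, hB, CB, hCB, hbB⟩ := step I
    have hsplit : ∀ w ξ : ℂ, fderivWithin ℝ g T w ξ =
        L (-I) (fderivWithin ℝ g T w) * ξ + L I (fderivWithin ℝ g T w) * conj ξ := by
      intro w ξ
      have h : fderivWithin ℝ g T w ξ = ξ.re * fderivWithin ℝ g T w 1 +
          ξ.im * fderivWithin ℝ g T w I := by
        conv_lhs => rw [show ξ = ξ.re • (1 : ℂ) + ξ.im • I by simp [Complex.re_add_im]]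
        rw [map_add, map_smul, map_smul]; simp
      rw [h]
      simp only [hL, smul_apply, add_apply, ContinuousLinearMap.apply_apply, smul_eq_mul]
      conv_rhs => rw [← Complex.re_add_im ξ]
      simp only [map_add, map_mul, conj_ofReal, conj_I]
      ring_nf
      rw [I_sq]; ring
    -- `Q d` is homogeneous of degree `d + 1`; the factor `1/(d+1)` below comes from integrating
    -- `t^d` over `[0,1]`.
    set Q : ℕ → ℂ → ℂ := fun d ξ => A d ξ * ξ + B d ξ * conj ξ with hQ
    refine ⟨fun d => match d with
      | 0 => fun _ => g w₀
      | d + 1 => fun ξ => ((d : ℂ) + 1)⁻¹ * Q d ξ, fun d => ?_, CA + CB, by positivity,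
      fun w hw => ?_⟩
    · cases d with
      | zero => exact isHom_const _
      | succ d => exact ((hA d).mul_self.add (hB d).mul_conj).const_mul _
    · set ξ := w - w₀ with hξ
      rw [Finset.sum_range_succ']
      simp only
      have hmem : ∀ t ∈ Set.Icc (0 : ℝ) 1, w₀ + t • ξ ∈ T := fun t ht =>
        hT.add_smul_sub_mem hw₀ hw ht
      have hder : ∀ t ∈ Set.Icc (0 : ℝ) 1, HasDerivWithinAt
          (fun t : ℝ => g (w₀ + t • ξ) - ∑ d ∈ Finset.range (n + 1),
            (t : ℂ) ^ (d + 1) * (((d : ℂ) + 1)⁻¹ * Q d ξ))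
          (fderivWithin ℝ g T (w₀ + t • ξ) ξ -
            ∑ d ∈ Finset.range (n + 1), (t : ℂ) ^ d * Q d ξ) (Set.Icc 0 1) t := by
        intro t ht
        have h1 : HasDerivWithinAt (fun t : ℝ => w₀ + t • ξ) ξ (Set.Icc 0 1) t :=
          (hasDerivAt_line w₀ ξ t).hasDerivWithinAt
        have h2 := ((hg.differentiableOn (by simp) _ (hmem t ht)).hasFDerivWithinAt).comp_hasDerivWithinAt
          t h1 hmem
        refine h2.sub (HasDerivWithinAt.fun_sum fun d _ => ?_)
        have h3 : HasDerivAt (fun t : ℝ => (t : ℂ) ^ (d + 1)) (((d : ℂ) + 1) * (t : ℂ) ^ d) t := by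
          have := (hasDerivAt_pow (d + 1) (t : ℂ)).comp_ofReal
          simpa using this
        have h4 := (h3.mul_const (((d : ℂ) + 1)⁻¹ * Q d ξ)).hasDerivWithinAt (s := Set.Icc 0 1)
        have hd0 : ((d : ℂ) + 1) ≠ 0 := by exact_mod_cast Nat.succ_ne_zero d
        convert! h4 using 1
        field_simp
      have hbd : ∀ t ∈ Set.Ico (0 : ℝ) 1, ‖fderivWithin ℝ g T (w₀ + t • ξ) ξ -
          ∑ d ∈ Finset.range (n + 1), (t : ℂ) ^ d * Q d ξ‖ ≤
          (CA + CB) * (‖ξ‖ ^ (n + 1) * ϖ ‖ξ‖) := by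
        intro t ht
        have hm := hmem t ⟨ht.1, ht.2.le⟩
        have e : ∀ {P : ℕ → ℂ → ℂ}, (∀ d, IsHom d (P d)) →
            ∑ d ∈ Finset.range (n + 1), P d (w₀ + t • ξ - w₀) =
              ∑ d ∈ Finset.range (n + 1), (t : ℂ) ^ d * P d ξ := fun hP =>
          Finset.sum_congr rfl fun d _ => by rw [add_sub_cancel_left, real_smul, (hP d).smul]
        have bA := hbA _ hm
        have bB := hbB _ hm
        rw [e hA] at bA
        rw [e hB] at bB
        have hn : ‖w₀ + t • ξ - w₀‖ ≤ ‖ξ‖ := by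
          rw [add_sub_cancel_left, norm_smul, Real.norm_of_nonneg ht.1]
          exact mul_le_of_le_one_left (norm_nonneg _) ht.2.le
        have hw1 : ϖ ‖w₀ + t • ξ - w₀‖ ≤ ϖ ‖ξ‖ :=
          hϖ (norm_nonneg _) (norm_nonneg _) hn
        have hw2 : ‖w₀ + t • ξ - w₀‖ ^ n * ϖ ‖w₀ + t • ξ - w₀‖ ≤ ‖ξ‖ ^ n * ϖ ‖ξ‖ :=
          mul_le_mul (by gcongr) hw1 (hϖ0 _ (norm_nonneg _)) (by positivity)
        rw [hsplit, show ∑ d ∈ Finset.range (n + 1), (t : ℂ) ^ d * Q d ξ =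
          (∑ d ∈ Finset.range (n + 1), (t : ℂ) ^ d * A d ξ) * ξ +
          (∑ d ∈ Finset.range (n + 1), (t : ℂ) ^ d * B d ξ) * conj ξ by
            rw [Finset.sum_mul, Finset.sum_mul, ← Finset.sum_add_distrib]
            exact Finset.sum_congr rfl fun d _ => by rw [hQ]; ring,
          add_sub_add_comm, ← sub_mul, ← sub_mul]
        refine (norm_add_le _ _).trans ?_
        rw [norm_mul, norm_mul, RCLike.norm_conj, ← add_mul, pow_succ]
        have hE : 0 ≤ ‖ξ‖ ^ n * ϖ ‖ξ‖ := mul_nonneg (by positivity) (hϖ0 _ (norm_nonneg _))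
        have k1 := bA.trans (mul_le_mul_of_nonneg_left hw2 hCA)
        have k2 := bB.trans (mul_le_mul_of_nonneg_left hw2 hCB)
        calc _ ≤ (CA * (‖ξ‖ ^ n * ϖ ‖ξ‖) + CB * (‖ξ‖ ^ n * ϖ ‖ξ‖)) * ‖ξ‖ := by gcongr
          _ = _ := by ring
      have := norm_image_sub_le_of_norm_deriv_le_segment' hder hbd 1 ⟨zero_le_one, le_rfl⟩
      simp only [one_smul, ofReal_one, one_pow, one_mul, zero_smul, ofReal_zero, add_zero,
        zero_pow (Nat.succ_ne_zero _), zero_mul, Finset.sum_const_zero, sub_zero, mul_one] at this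
      rw [hξ, add_sub_cancel] at this
      rw [← hξ] at this
      refine (le_of_eq ?_).trans this
      congr 1; ring

/-! ### The expansion of functions of class `C ^ r` -/

theorem eta_nonneg {t : ℝ} (ht : 0 ≤ t) : 0 ≤ eta t := by
  unfold eta
  split_ifs with h
  · have : Real.log t ≤ 0 := Real.log_nonpos ht (h.trans (by
      rw [Real.exp_le_one_iff]; norm_num))
    nlinarith
  · positivity

theorem eta_monotoneOn : MonotoneOn eta (Set.Ici 0) := by
  have hmono : MonotoneOn (fun x : ℝ => -(x * Real.log x)) (Set.Icc 0 (Real.exp (-1))) := by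
    refine monotoneOn_of_deriv_nonneg (convex_Icc _ _)
      (Real.continuous_mul_log.neg.continuousOn) ?_ ?_
    · intro x hx
      rw [interior_Icc] at hx
      exact (Real.hasDerivAt_mul_log hx.1.ne').neg.differentiableAt.differentiableWithinAt
    · intro x hx
      rw [interior_Icc] at hx
      have h1 := (Real.hasDerivAt_mul_log hx.1.ne').neg.deriv
      change 0 ≤ deriv (-fun x => x * Real.log x) x
      rw [h1]
      have : Real.log x ≤ -1 := by
        rw [← Real.log_exp (-1)]; exact Real.log_le_log hx.1 hx.2.le
      linarith
  intro x hx y hy hxy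
  unfold eta
  split_ifs with h1 h2 h2
  · exact hmono ⟨hx, h1⟩ ⟨hy, h2⟩ hxy
  · have := hmono ⟨hx, h1⟩ ⟨(Real.exp_pos _).le, le_rfl⟩ h1
    simpa using this
  · exact absurd (hxy.trans h2) h1
  · exact le_rfl

theorem rpow_isLittleO_rpow {a b : ℝ} (h : b < a) :
    (fun t : ℝ => t ^ a) =o[𝓝[>] 0] fun t : ℝ => t ^ b := by
  refine isLittleO_of_tendsto' ?_ ?_
  · filter_upwards [self_mem_nhdsWithin] with t ht h0
    exact absurd h0 (Real.rpow_pos_of_pos ht b).ne'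
  · have : Tendsto (fun t : ℝ => t ^ (a - b)) (𝓝[>] 0) (𝓝 0) := by
      have := (Real.continuousAt_rpow_const 0 (a - b) (Or.inr (by linarith))).tendsto
      rw [Real.zero_rpow (by linarith)] at this
      exact this.mono_left nhdsWithin_le_nhds
    refine this.congr' ?_
    filter_upwards [self_mem_nhdsWithin] with t ht
    rw [Real.rpow_sub ht]

theorem eta_isLittleO {a : ℝ} (n : ℕ) (h : a < n + 1) :
    (fun t : ℝ => t ^ n * eta t) =o[𝓝[>] 0] fun t : ℝ => t ^ a := by
  refine isLittleO_of_tendsto' ?_ ?_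
  · filter_upwards [self_mem_nhdsWithin] with t ht h0
    exact absurd h0 (Real.rpow_pos_of_pos ht a).ne'
  · have := (tendsto_log_mul_rpow_nhdsGT_zero (r := n + 1 - a) (by linarith)).neg
    rw [neg_zero] at this
    refine this.congr' ?_
    filter_upwards [self_mem_nhdsWithin, mem_nhdsWithin_of_mem_nhds
      (Iio_mem_nhds (Real.exp_pos (-1)))] with t ht ht1
    have ht' : (0 : ℝ) < t := ht
    rw [eta, if_pos (le_of_lt ht1), Real.rpow_sub ht', Real.rpow_add_one ht'.ne',
      Real.rpow_natCast]
    ring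

/-- The two kinds of exponent are reduced to what both share: the Taylor error `t^n ϖ(t)` is
`o(t^β)` for every `β < v(r)`. The logarithm in `eta` is absorbed because the inequality is strict.
-/
theorem IsCr.exists_modulus {r : REta} (hr : 0 < r.v) {S : Set ℂ} {h : ℂ → ℂ} (hh : IsCr r S h) :
    ∃ (n : ℕ) (ϖ : ℝ → ℝ), (n : ℝ) ≤ r.v ∧ MonotoneOn ϖ (Set.Ici 0) ∧ (∀ t, 0 ≤ t → 0 ≤ ϖ t) ∧
      (∀ β < r.v, (fun t : ℝ => t ^ n * ϖ t) =o[𝓝[>] 0] fun t : ℝ => t ^ β) ∧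
      IsCMod n ϖ S h := by
  cases r with
  | real r h1 hZ =>
    have hr' : 0 < r := hr
    refine ⟨⌊r⌋₊, fun t => t ^ Int.fract r, Nat.floor_le hr'.le, fun a ha b _ hab => ?_,
      fun t ht => Real.rpow_nonneg ht _, fun β hβ => ?_, hh⟩
    · exact Real.rpow_le_rpow ha hab (Int.fract_nonneg r)
    · refine (rpow_isLittleO_rpow (a := r) hβ).congr' ?_ EventuallyEq.rfl
      filter_upwards [self_mem_nhdsWithin] with t ht
      rw [← Real.rpow_natCast, ← Real.rpow_add ht, natCast_floor_eq_intCast_floor hr'.le,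
        Int.floor_add_fract]
  | addEta n hn =>
    have hr' : (0 : ℝ) < n + 1 := hr
    have hn0 : 0 ≤ n := by
      have : (0 : ℤ) < n + 1 := by exact_mod_cast hr'
      omega
    have hnn : ((n.toNat : ℕ) : ℝ) = n := by exact_mod_cast Int.toNat_of_nonneg hn0
    refine ⟨n.toNat, eta, ?_, eta_monotoneOn, fun t => eta_nonneg, fun β hβ => ?_, hh⟩
    · rw [hnn]; simp [REta.v]
    · exact eta_isLittleO _ (by rw [hnn]; exact hβ)

/-- Intersecting with an open `B` does not change derivatives within `S`, so convexity is needed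
only locally. A monotone error function allows the points compared later to be bounded by a common
distance. -/
theorem IsCr.exists_expansion {r : REta} (hr : 0 < r.v) {S B : Set ℂ} {h : ℂ → ℂ}
    (hh : IsCr r S h) (hB : IsOpen B) (hconv : Convex ℝ (S ∩ B))
    (hint : (interior (S ∩ B)).Nonempty) :
    ∃ n : ℕ, (n : ℝ) ≤ r.v ∧ ∀ w₀ ∈ S ∩ B, ∃ P : ℕ → ℂ → ℂ, (∀ d, IsHom d (P d)) ∧
      ∃ E : ℝ → ℝ, MonotoneOn E (Set.Ici 0) ∧
      (∀ β < r.v, E =o[𝓝[>] 0] fun t : ℝ => t ^ β) ∧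
      ∀ w ∈ S ∩ B, ‖h w - ∑ d ∈ Finset.range (n + 1), P d (w - w₀)‖ ≤ E ‖w - w₀‖ := by
  obtain ⟨n, ϖ, hn, hmono, hpos, ho, hc, C, hC⟩ := hh.exists_modulus hr
  refine ⟨n, hn, fun w₀ hw₀ => ?_⟩
  have hC' : ∀ x ∈ S ∩ B, ∀ y ∈ S ∩ B, ‖iteratedFDerivWithin ℝ n h (S ∩ B) x -
      iteratedFDerivWithin ℝ n h (S ∩ B) y‖ ≤ C * ϖ ‖x - y‖ := by
    intro x hx y hy
    rw [iteratedFDerivWithin_inter_open hB hx.2, iteratedFDerivWithin_inter_open hB hy.2]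
    exact hC x hx.1 y hy.1
  obtain ⟨P, hP, C', hC'0, hb⟩ := exists_taylor_of_modulus hmono hpos hconv
    (uniqueDiffOn_convex hconv hint) hw₀ (hc.mono Set.inter_subset_left) hC'
  refine ⟨P, hP, fun t => C' * (t ^ n * ϖ t), fun a ha b hb hab => ?_,
    fun β hβ => (ho β hβ).const_mul_left C', hb⟩
  have ha' : 0 ≤ a := ha
  exact mul_le_mul_of_nonneg_left (mul_le_mul (pow_le_pow_left₀ ha' hab n) (hmono ha hb hab)
    (hpos a ha) (pow_nonneg (ha'.trans hab) n)) hC'0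

/-! ### The sectors in terms of the upper half plane -/

/-- The `m`-th root `z ↦ θ₀ ^ l * z ^ (1 / m)`, mapping the upper half plane to the cone
over the sector with index `l`. -/
noncomputable def sroot (m l : ℕ) (z : ℂ) : ℂ := theta0 m ^ l * z ^ ((1 / m : ℝ) : ℂ)

theorem theta0_pow (m l : ℕ) : theta0 m ^ l = cexp ((Real.pi * l / m : ℝ) * I) := by
  rw [theta0, ← Complex.exp_nat_mul]; congr 1; push_cast; ring

theorem norm_theta0_pow (m l : ℕ) : ‖theta0 m ^ l‖ = 1 := by
  rw [theta0_pow]; exact Complex.norm_exp_ofReal_mul_I _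

theorem norm_sroot (m l : ℕ) (z : ℂ) : ‖sroot m l z‖ = ‖z‖ ^ (1 / m : ℝ) := by
  rw [sroot, norm_mul, norm_theta0_pow, one_mul, Complex.norm_cpow_real]

theorem sroot_eq_polar (m l : ℕ) {z : ℂ} (hz : z ≠ 0) :
    sroot m l z = ((‖z‖ ^ (1 / m : ℝ) : ℝ) : ℂ) *
      cexp (((Real.pi * l + z.arg) / m : ℝ) * I) := by
  have h0 : (‖z‖ : ℂ) ≠ 0 := by exact_mod_cast norm_ne_zero_iff.2 hz
  rw [sroot, theta0_pow, cpow_def_of_ne_zero hz, Complex.ofReal_cpow (norm_nonneg _),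
    cpow_def_of_ne_zero h0, ← Complex.ofReal_log (norm_nonneg _), ← Complex.exp_add,
    ← Complex.exp_add, Complex.log]
  congr 1
  push_cast; ring

theorem theta0_pow_self {m : ℕ} (hm : 2 ≤ m) : theta0 m ^ m = -1 := by
  rw [theta0_pow]
  have : (m : ℝ) ≠ 0 := by positivity
  rw [mul_div_assoc, div_self this, mul_one, Complex.exp_pi_mul_I]

theorem sroot_pow {m : ℕ} (hm : 2 ≤ m) (l : ℕ) (z : ℂ) : sroot m l z ^ m = (-1) ^ l * z := by
  have : m ≠ 0 := by omega
  rw [sroot, mul_pow, ← pow_mul, mul_comm l, pow_mul, theta0_pow_self hm]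
  congr 1
  have h : ((1 / m : ℝ) : ℂ) = ((m : ℂ))⁻¹ := by push_cast; rw [one_div]
  rw [h, Complex.cpow_nat_inv_pow _ this]

/-- The part of the upper half plane over the square. -/
def box : Set ℂ := {z | 0 < z.im ∧ z.im ≤ 1 ∧ |z.re| ≤ 1}

theorem arg_mem_Ioo {z : ℂ} (hz : 0 < z.im) : z.arg ∈ Set.Ioo 0 Real.pi := by
  refine ⟨lt_of_le_of_ne (Complex.arg_nonneg_iff.2 hz.le) fun h => ?_,
    lt_of_le_of_ne (Complex.arg_le_pi z) fun h => ?_⟩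
  · rw [eq_comm, Complex.arg_eq_zero_iff] at h; exact hz.ne' h.2
  · rw [Complex.arg_eq_pi_iff] at h; exact hz.ne' h.2

theorem re_im_neg_one_pow_mul (l : ℕ) (z : ℂ) :
    ((-1) ^ l * z).re = (-1) ^ l * z.re ∧ ((-1) ^ l * z).im = (-1) ^ l * z.im := by
  rcases neg_one_pow_eq_or ℂ l with h | h <;> rcases Nat.even_or_odd l with h' | h' <;>
    simp [h'.neg_one_pow]

theorem sroot_mem_domainD {m : ℕ} (hm : 2 ≤ m) (l : ℕ) {z : ℂ} (hz : z ∈ box) :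
    sroot m l z ∈ domainD m := by
  obtain ⟨h1, h2, h3⟩ := hz
  rw [abs_le] at h3
  rw [domainD, Set.mem_ofPred_eq, sroot_pow hm, (re_im_neg_one_pow_mul l z).1,
    (re_im_neg_one_pow_mul l z).2]
  rcases neg_one_pow_eq_or ℝ l with h | h <;> rw [h] <;>
    refine ⟨⟨?_, ?_⟩, ?_, ?_⟩ <;> linarith

theorem sroot_mem_sector {m : ℕ} (hm : 2 ≤ m) (l : ℕ) {z : ℂ} (hz : z ∈ box) :
    sroot m l z ∈ sector m ((l : ℝ) / (2 * m)) (((l : ℝ) + 1) / (2 * m)) := by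
  have hz0 := ne_zero_of_im_pos hz.1
  obtain ⟨ha, hb⟩ := arg_mem_Ioo hz.1
  have hm0 : (0 : ℝ) < m := by positivity
  refine ⟨sroot_mem_domainD hm l hz, ‖z‖ ^ (1 / m : ℝ), (Real.pi * l + z.arg) / m,
    Real.rpow_pos_of_pos (norm_pos_iff.2 hz0) _, ⟨?_, ?_⟩, sroot_eq_polar m l hz0⟩
  · rw [show 2 * Real.pi * ((l : ℝ) / (2 * m)) = Real.pi * l / m by field_simp]
    gcongr; linarith
  · rw [show 2 * Real.pi * (((l : ℝ) + 1) / (2 * m)) = (Real.pi * l + Real.pi) / m by field_simp]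
    gcongr

/-! ### The function `F_f` in half-plane coordinates -/

theorem arg0_polar {ρ t : ℝ} (hρ : 0 < ρ) (ht0 : 0 ≤ t) (ht : t < 2 * Real.pi) :
    arg0 (ρ * cexp (t * I)) = t := by
  rw [arg0]
  rcases le_or_gt t Real.pi with h | h
  · have : (ρ * cexp (t * I) : ℂ).arg = t := by
      rw [Complex.exp_mul_I]
      exact Complex.arg_mul_cos_add_sin_mul_I hρ ⟨by linarith [Real.pi_pos], h⟩
    rw [this, if_pos ht0]
  · have : (ρ * cexp (t * I) : ℂ).arg = t - 2 * Real.pi := by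
      have e : cexp (t * I) = cexp (((t - 2 * Real.pi : ℝ) : ℂ) * I) := by
        rw [← Complex.exp_periodic.sub_eq]
        congr 1; push_cast; ring
      rw [e, Complex.exp_mul_I]
      exact Complex.arg_mul_cos_add_sin_mul_I hρ ⟨by linarith, by linarith⟩
    rw [this, if_neg (by linarith)]; ring

/-- The `m`-th power of `sroot m l z` is `(-1)^l z`, and `m` times its argument is `πl + arg z` with
`arg z` in `(0, π)`. Hence the branch index is `⌊l/2⌋`, and odd `l` corresponds to the lower half of
the square. -/
theorem FF_sroot {m : ℕ} (hm : 2 ≤ m) (f : ℂ → ℂ) {l : ℕ} (hl : l < 2 * m) {z : ℂ}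
    (hz : 0 < z.im) :
    FF m f (sroot m l z) = scriptF m f (l / 2) ((-1) ^ l * z.re) ((-1) ^ l * z.im) := by
  have hz0 := ne_zero_of_im_pos hz
  obtain ⟨ha, hb⟩ := arg_mem_Ioo hz
  have hm0 : (0 : ℝ) < m := by positivity
  have hπ := Real.pi_pos
  have hl' : (l : ℝ) + 1 ≤ 2 * m := by exact_mod_cast hl
  have harg : arg0 (sroot m l z) = (Real.pi * l + z.arg) / m := by
    rw [sroot_eq_polar m l hz0]
    refine arg0_polar (Real.rpow_pos_of_pos (norm_pos_iff.2 hz0) _) (by positivity) ?_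
    rw [div_lt_iff₀ hm0]
    nlinarith
  have hfl : ⌊(m : ℝ) * arg0 (sroot m l z) / (2 * Real.pi)⌋₊ = l / 2 := by
    rw [harg, Nat.floor_eq_iff (by positivity), mul_div_cancel₀ _ hm0.ne', le_div_iff₀ (by positivity),
      div_lt_iff₀ (by positivity)]
    have h1 : ((l / 2 : ℕ) : ℝ) * 2 ≤ l := by exact_mod_cast Nat.div_mul_le_self l 2
    have h2 : (l : ℝ) + 1 ≤ (((l / 2 : ℕ) : ℝ) + 1) * 2 := by
      have : l + 1 ≤ (l / 2 + 1) * 2 := by omega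
      exact_mod_cast this
    constructor <;> nlinarith
  rw [FF, hfl, sroot_pow hm, (re_im_neg_one_pow_mul l z).1, (re_im_neg_one_pow_mul l z).2]

theorem theta_eq (m : ℕ) : theta m = theta0 m ^ 2 := by
  rw [theta, theta0, ← Complex.exp_nat_mul]; congr 1; push_cast; ring

theorem rootBranch_eq_sroot (m l : ℕ) {v s : ℝ} (hs : 0 < s) :
    rootBranch m (l / 2) ⟨(-1) ^ l * v, (-1) ^ l * s⟩ = sroot m l (v + s * I) := by
  have hu : 0 < (v + s * I : ℂ).im := by simpa using hs
  have hz0 := ne_zero_of_im_pos hu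
  have hnum : (⟨(-1) ^ l * v, (-1) ^ l * s⟩ : ℂ) = (-1) ^ l * (v + s * I) := by
    apply Complex.ext
    · rw [(re_im_neg_one_pow_mul l _).1]; simp
    · rw [(re_im_neg_one_pow_mul l _).2]; simp
  have harg : Real.pi * l + (v + s * I : ℂ).arg =
      2 * Real.pi * (l / 2 : ℕ) + arg0 ((-1) ^ l * (v + s * I)) := by
    obtain ⟨ha, hb⟩ := arg_mem_Ioo hu
    rcases Nat.even_or_odd l with h | h
    · rw [h.neg_one_pow, one_mul, arg0, if_pos ha.le]
      have : (l : ℝ) = 2 * (l / 2 : ℕ) := by exact_mod_cast (Nat.two_mul_div_two_of_even h).symm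
      nth_rw 1 [this]; ring
    · rw [h.neg_one_pow, neg_one_mul, arg0, Complex.arg_neg_eq_arg_sub_pi_of_im_pos hu,
        if_neg (by linarith)]
      have : (l : ℝ) = 2 * (l / 2 : ℕ) + 1 := by
        exact_mod_cast (Nat.two_mul_div_two_add_one_of_odd h).symm
      nth_rw 1 [this]; ring
  have hnorm : ‖((-1) ^ l * (v + s * I) : ℂ)‖ = ‖(v + s * I : ℂ)‖ := by simp
  rw [hnum, rootBranch, sroot_eq_polar m l hz0, harg, hnorm, theta_eq, ← pow_mul, theta0_pow]
  rw [mul_right_comm, mul_comm, ← Complex.exp_add]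
  congr 2
  push_cast; ring

/-- The integrand of `F_f` on the upper half plane. -/
noncomputable def integrand (m l : ℕ) (f : ℂ → ℂ) (z : ℂ) : ℂ :=
  f (sroot m l z) * kap (((m : ℝ) - 1) / m) (((m : ℝ) - 1) / m) z

theorem kap_self (e : ℝ) (z : ℂ) : kap e e z = ((Complex.normSq z ^ (-e) : ℝ) : ℂ) := by
  rw [kap, Complex.mul_conj, Complex.normSq_eq_norm_sq, Complex.normSq_eq_norm_sq,
    Complex.norm_cpow_real, ← Real.rpow_natCast, ← Real.rpow_natCast, ← Real.rpow_mul (norm_nonneg _),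
    ← Real.rpow_mul (norm_nonneg _), mul_comm]

theorem integrand_eq (m l : ℕ) (f : ℂ → ℂ) {v s : ℝ} (hs : 0 < s) :
    f (rootBranch m (l / 2) ⟨(-1) ^ l * v, (-1) ^ l * s⟩) /
      (((((-1) ^ l * v) ^ 2 + ((-1) ^ l * s) ^ 2) ^ (((m : ℝ) - 1) / m) : ℝ) : ℂ) =
    integrand m l f (v + s * I) := by
  rw [rootBranch_eq_sroot m l hs, integrand, kap_self, Real.rpow_neg (Complex.normSq_nonneg _),
    Complex.normSq_add_mul_I, mul_pow, mul_pow, ← pow_mul, mul_comm l, pow_mul, neg_one_sq, one_pow,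
    one_mul, one_mul, div_eq_mul_inv, Complex.ofReal_inv]

theorem continuousOn_sroot (m l : ℕ) : ContinuousOn (sroot m l) upper := fun _ hz =>
  (continuousAt_const.mul (continuousAt_cpow_const (Or.inr (ne_of_gt hz)))).continuousWithinAt

theorem box_subset_upper : box ⊆ upper := fun _ hz => hz.1

theorem continuousOn_integrand {m : ℕ} (hm : 2 ≤ m) (l : ℕ) {f : ℂ → ℂ}
    (hf : ContinuousOn f (domainD m)) : ContinuousOn (integrand m l f) box :=
  (hf.comp ((continuousOn_sroot m l).mono box_subset_upper)
    fun _ hz => sroot_mem_domainD hm l hz).mul ((continuousOn_kap _ _).mono box_subset_upper)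

/-- The common lower limit `-1` drops out of a difference at equal height. For odd `l` the
substitution `v ↦ -v` reverses the direction of integration, whence the sign `(-1)^l`. -/
theorem FF_sub {m : ℕ} (hm : 2 ≤ m) {f : ℂ → ℂ} (hf : ContinuousOn f (domainD m)) {l : ℕ}
    (hl : l < 2 * m) {u₁ u₂ s : ℝ} (hs : 0 < s) (hs1 : s ≤ 1) (h₁ : |u₁| ≤ 1) (h₂ : |u₂| ≤ 1) :
    FF m f (sroot m l (u₂ + s * I)) - FF m f (sroot m l (u₁ + s * I)) =
      (-1) ^ l * ∫ v in u₁..u₂, integrand m l f (v + s * I) := by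
  have hc : ContinuousOn (fun v : ℝ => integrand m l f (v + s * I)) (Set.Icc (-1) 1) :=
    (continuousOn_integrand hm l hf).comp (by fun_prop) fun v hv => by
      simp only [box, Set.mem_ofPred_eq]
      simp [hs, hs1, abs_le, hv.1, hv.2]
  have hsq : ∀ x : ℝ, (-1 : ℝ) ^ l * ((-1) ^ l * x) = x := fun x => by
    rw [← mul_assoc, ← pow_add, Even.neg_one_pow ⟨l, rfl⟩, one_mul]
  rw [FF_sroot hm f hl (add_mul_I_mem_upper u₂ hs), FF_sroot hm f hl (add_mul_I_mem_upper u₁ hs)]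
  have hS : ∀ u : ℝ, scriptF m f (l / 2) ((-1) ^ l * (u + s * I : ℂ).re)
      ((-1) ^ l * (u + s * I : ℂ).im) =
      ∫ v in (-1 : ℝ)..((-1) ^ l * u), integrand m l f (((-1) ^ l * v : ℝ) + s * I) := by
    intro u
    have hre : (u + s * I : ℂ).re = u := by simp
    have him : (u + s * I : ℂ).im = s := by simp
    rw [hre, him, scriptF]
    refine intervalIntegral.integral_congr fun v _ => ?_
    rw [← integrand_eq m l f hs, hsq]
  rw [hS, hS]
  rw [abs_le] at h₁ h₂
  have hii : ∀ a ∈ Set.Icc (-1 : ℝ) 1, ∀ b ∈ Set.Icc (-1 : ℝ) 1, IntervalIntegrable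
      (fun v : ℝ => integrand m l f (((-1) ^ l * v : ℝ) + s * I)) volume a b := by
    intro a ha b hb
    refine ContinuousOn.intervalIntegrable ?_
    refine ContinuousOn.comp (g := fun v : ℝ => integrand m l f (v + s * I)) hc
      (f := fun v : ℝ => (-1) ^ l * v) (by fun_prop) fun v hv => ?_
    have := Set.uIcc_subset_Icc ha hb hv
    rcases neg_one_pow_eq_or ℝ l with h | h <;> simp only [h] <;>
      constructor <;> linarith [this.1, this.2]
  have hmem : ∀ u : ℝ, -1 ≤ u ∧ u ≤ 1 → (-1 : ℝ) ^ l * u ∈ Set.Icc (-1 : ℝ) 1 := by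
    intro u hu
    rcases neg_one_pow_eq_or ℝ l with h | h <;> rw [h] <;> constructor <;> linarith [hu.1, hu.2]
  have h1 : (-1 : ℝ) ∈ Set.Icc (-1 : ℝ) 1 := by constructor <;> norm_num
  rw [intervalIntegral.integral_interval_sub_left (hii _ h1 _ (hmem _ h₂))
    (hii _ h1 _ (hmem _ h₁))]
  rcases Nat.even_or_odd l with h | h
  · simp only [h.neg_one_pow, one_mul]
  · simp only [h.neg_one_pow, neg_one_mul]
    rw [intervalIntegral.integral_comp_neg (fun v : ℝ => integrand m l f (v + s * I)), neg_neg,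
      neg_neg, intervalIntegral.integral_symm]

theorem wmono_sroot_mul_kap {m : ℕ} (hm : 2 ≤ m) (l a b : ℕ) {z : ℂ} (hz : z ≠ 0) :
    wmono a b (sroot m l z) * kap (((m : ℝ) - 1) / m) (((m : ℝ) - 1) / m) z =
      wmono a b (theta0 m ^ l) * kap (((m : ℝ) - 1 - a) / m) (((m : ℝ) - 1 - b) / m) z := by
  have hm0 : (m : ℝ) ≠ 0 := by positivity
  have key : ∀ a : ℕ, (z ^ ((1 / m : ℝ) : ℂ)) ^ a * z ^ ((-(((m : ℝ) - 1) / m) : ℝ) : ℂ) =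
      z ^ ((-(((m : ℝ) - 1 - a) / m) : ℝ) : ℂ) := by
    intro a
    rw [← Complex.cpow_nat_mul, ← Complex.cpow_add _ _ hz]
    congr 1
    push_cast
    ring
  rw [wmono, wmono, kap, kap, sroot, ← key a, ← key b]
  simp only [map_mul, map_pow, mul_pow]
  ring

/-! ### Convexity of the sectors near the origin -/

/-- In the unit disc membership in `domainD` is automatic, and since the opening `π/m` is less than
`π` the sector is an intersection of two half planes. This yields openness and convexity near the
origin. -/
theorem sector_inter_ball {m : ℕ} (hm : 2 ≤ m) (l : ℕ) :
    sector m ((l : ℝ) / (2 * m)) (((l : ℝ) + 1) / (2 * m)) ∩ Metric.ball 0 1 =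
      {w : ℂ | 0 < (w * conj (theta0 m ^ l)).im} ∩
        {w : ℂ | (w * conj (theta0 m ^ (l + 1))).im < 0} ∩ Metric.ball 0 1 := by
  have hm0 : (0 : ℝ) < m := by positivity
  have hm2 : (2 : ℝ) ≤ m := by exact_mod_cast hm
  have hπ := Real.pi_pos
  have hπm : Real.pi / m ≤ Real.pi := div_le_self hπ.le (by linarith)
  have hπm0 : 0 < Real.pi / m := by positivity
  have him : ∀ (ρ t : ℝ) (j : ℕ), (ρ * cexp (t * I) * conj (theta0 m ^ j)).im =
      ρ * Real.sin (t - Real.pi * j / m) := by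
    intro ρ t j
    rw [theta0_pow, ← Complex.exp_conj, mul_assoc, ← Complex.exp_add, map_mul, conj_ofReal, conj_I,
      show (t : ℂ) * I + ((Real.pi * j / m : ℝ) : ℂ) * -I =
        ((t - Real.pi * j / m : ℝ) : ℂ) * I by push_cast; ring,
      Complex.im_ofReal_mul, Complex.exp_ofReal_mul_I_im]
  have e1 : 2 * Real.pi * ((l : ℝ) / (2 * m)) = Real.pi * l / m := by field_simp
  have e2 : 2 * Real.pi * (((l : ℝ) + 1) / (2 * m)) = Real.pi * l / m + Real.pi / m := by
    field_simp
  have e3 : Real.pi * ((l + 1 : ℕ) : ℝ) / m = Real.pi * l / m + Real.pi / m := by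
    push_cast; ring
  ext w
  simp only [Set.mem_inter_iff, Set.mem_ofPred_eq]
  refine and_congr_left fun hw => ⟨?_, ?_⟩
  · rintro ⟨-, ρ, t, hρ, ht, rfl⟩
    rw [e1, e2] at ht
    rw [him, him, e3]
    refine ⟨mul_pos hρ (Real.sin_pos_of_pos_of_lt_pi (by linarith [ht.1]) (by linarith [ht.2])),
      mul_neg_of_pos_of_neg hρ (Real.sin_neg_of_neg_of_neg_pi_lt (by linarith [ht.2])
        (by linarith [ht.1]))⟩
  · rintro ⟨h1, h2⟩
    have hw' : ‖w‖ < 1 := by simpa using hw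
    have hwm : ‖w ^ m‖ ≤ 1 := by
      rw [norm_pow]; exact pow_le_one₀ (norm_nonneg _) hw'.le
    refine ⟨⟨abs_le.1 ((Complex.abs_re_le_norm _).trans hwm),
      abs_le.1 ((Complex.abs_im_le_norm _).trans hwm)⟩, ?_⟩
    set w' := w * conj (theta0 m ^ l) with hw'd
    have hw0 : w' ≠ 0 := ne_zero_of_im_pos h1
    have hww : w = w' * theta0 m ^ l := by
      rw [hw'd, mul_assoc, mul_comm (conj _), Complex.mul_conj, Complex.normSq_eq_norm_sq,
        norm_theta0_pow]; simp
    have hpol : w = ‖w'‖ * cexp (((w'.arg + Real.pi * l / m : ℝ) : ℂ) * I) := by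
      conv_lhs => rw [hww, ← Complex.norm_mul_exp_arg_mul_I w', theta0_pow, mul_assoc,
        ← Complex.exp_add]
      congr 2; push_cast; ring
    obtain ⟨ha, hb⟩ := arg_mem_Ioo h1
    refine ⟨‖w'‖, w'.arg + Real.pi * l / m, norm_pos_iff.2 hw0, ?_, hpol⟩
    rw [e1, e2]
    refine ⟨by linarith, ?_⟩
    -- An argument beyond the second ray, still below `π` after rotation, would make the sine in
    -- `h2` nonnegative.
    by_contra hcon
    push Not at hcon
    rw [hpol, him, e3] at h2
    have := Real.sin_nonneg_of_nonneg_of_le_pi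
      (x := w'.arg + Real.pi * l / m - (Real.pi * l / m + Real.pi / m)) (by linarith)
      (by linarith)
    exact absurd h2 (not_lt.2 (mul_nonneg (norm_nonneg _) this))

theorem isOpen_sector_inter_ball {m : ℕ} (hm : 2 ≤ m) (l : ℕ) :
    IsOpen (sector m ((l : ℝ) / (2 * m)) (((l : ℝ) + 1) / (2 * m)) ∩ Metric.ball 0 1) := by
  rw [sector_inter_ball hm]
  exact ((isOpen_lt continuous_const (by fun_prop)).inter
    (isOpen_lt (by fun_prop) continuous_const)).inter Metric.isOpen_ball

theorem convex_sector_inter_ball {m : ℕ} (hm : 2 ≤ m) (l : ℕ) :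
    Convex ℝ (sector m ((l : ℝ) / (2 * m)) (((l : ℝ) + 1) / (2 * m)) ∩ Metric.ball 0 1) := by
  rw [sector_inter_ball hm]
  have hlin : ∀ c : ℂ, IsLinearMap ℝ fun w : ℂ => (w * c).im := fun c =>
    ⟨fun x y => by rw [add_mul, add_im], fun r x => by
      rw [real_smul, mul_assoc, im_ofReal_mul, smul_eq_mul]⟩
  exact ((convex_halfSpace_gt (hlin _) 0).inter (convex_halfSpace_lt (hlin _) 0)).inter
    (convex_ball _ _)

theorem closure_sector_inter_ball (S : Set ℂ) :
    closure S ∩ Metric.ball 0 1 = closure (S ∩ Metric.ball 0 1) ∩ Metric.ball 0 1 := by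
  refine Set.Subset.antisymm (fun w hw => ⟨?_, hw.2⟩)
    (Set.inter_subset_inter_left _ (closure_mono Set.inter_subset_left))
  have := (Metric.isOpen_ball (x := (0 : ℂ)) (ε := 1)).inter_closure (t := S) ⟨hw.2, hw.1⟩
  rwa [Set.inter_comm] at this

theorem convex_closure_sector_inter_ball {m : ℕ} (hm : 2 ≤ m) (l : ℕ) :
    Convex ℝ (closure (sector m ((l : ℝ) / (2 * m)) (((l : ℝ) + 1) / (2 * m))) ∩
      Metric.ball 0 1) := by
  rw [closure_sector_inter_ball]
  exact (convex_sector_inter_ball hm l).closure.inter (convex_ball _ _)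

theorem interior_closure_sector_inter_ball_nonempty {m : ℕ} (hm : 2 ≤ m) (l : ℕ) :
    (interior (closure (sector m ((l : ℝ) / (2 * m)) (((l : ℝ) + 1) / (2 * m))) ∩
      Metric.ball 0 1)).Nonempty := by
  refine ⟨sroot m l ((0 : ℝ) + (1 / 2 : ℝ) * I), mem_interior.2 ⟨_,
    Set.inter_subset_inter_left _ subset_closure, isOpen_sector_inter_ball hm l,
    sroot_mem_sector hm l ?_, ?_⟩⟩
  · simp only [box, Set.mem_ofPred_eq]
    simp; norm_num
  · rw [mem_ball_zero_iff, norm_sroot]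
    refine Real.rpow_lt_one (norm_nonneg _) ?_ (by positivity)
    simp; norm_num

/-! ### Expansion of the integrand -/

/-- The exponent `(m - 1 - a) / m`. -/
noncomputable def expo (m a : ℕ) : ℝ := ((m : ℝ) - 1 - a) / m

theorem expo_add {m : ℕ} (hm : 2 ≤ m) {a j : ℕ} (ha : a ≤ j) :
    expo m a + expo m (j - a) = 1 - ord m j := by
  have : (m : ℝ) ≠ 0 := by positivity
  rw [expo, expo, ord, Nat.cast_sub ha]
  field_simp; ring

/-- The Taylor coefficients of `w ↦ f (θ₀ ^ l * w)`. -/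
noncomputable def hcoeff (m l : ℕ) (f : ℂ → ℂ) (j a : ℕ) : ℂ :=
  tcoeff f a (j - a) * wmono a (j - a) (theta0 m ^ l)

theorem halfDisc_subset_box {ρ : ℝ} (hρ : ρ ≤ 1) : halfDisc ρ ⊆ box := fun z hz =>
  ⟨hz.1, (le_abs_self _).trans ((Complex.abs_im_le_norm z).trans (hz.2.le.trans hρ)),
    (Complex.abs_re_le_norm z).trans (hz.2.le.trans hρ)⟩

/-- The remainder has size `|z|^(k/m)` and the density contributes `|z|^(-2(m-1)/m)`; together the
exponent is `ord m k - 1`. The identity holds on the whole half plane because the Taylor polynomial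
is subtracted globally; only the bounds are local. -/
theorem exists_integrand_expansion {m : ℕ} (hm : 2 ≤ m) {k N : ℕ} (hkN : k ≤ N) {f : ℂ → ℂ}
    (hf : ContDiffAt ℝ N f 0) (hfc : ContinuousOn f (domainD m)) (l : ℕ) :
    ∃ (K : ℂ → ℂ) (ρ : ℝ), 0 < ρ ∧ ρ ≤ 1 ∧ ContinuousOn K (halfDisc ρ) ∧
      Sym (halfDisc ρ) N (ord m k - 1) K ∧ ∀ z ∈ upper, integrand m l f z =
        (∑ j ∈ Finset.range k, ∑ a ∈ Finset.range (j + 1),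
          hcoeff m l f j a * kap (expo m a) (expo m (j - a)) z) + K z := by
  obtain ⟨R, hR, hR0, hfR⟩ := exists_taylor_remainder hkN hf
  obtain ⟨ρ, hρ, hρ1, hs⟩ := Sym.comp_root hm (norm_theta0_pow m l) hkN hR hR0
  have hexp : ∀ z ∈ upper, integrand m l f z =
      (∑ j ∈ Finset.range k, ∑ a ∈ Finset.range (j + 1),
        hcoeff m l f j a * kap (expo m a) (expo m (j - a)) z) + integrand m l R z := by
    intro z hz
    rw [integrand, hfR, add_mul, Finset.sum_mul]
    congr 1
    refine Finset.sum_congr rfl fun j _ => ?_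
    rw [Finset.sum_mul]
    refine Finset.sum_congr rfl fun a _ => ?_
    rw [mul_assoc, wmono_sroot_mul_kap hm l _ _ (ne_zero_of_im_pos hz), hcoeff, mul_assoc]
    rfl
  have hsub : halfDisc ρ ⊆ upper := fun z hz => hz.1
  refine ⟨integrand m l R, ρ, hρ, hρ1, ?_, ?_, hexp⟩
  · have h1 : ContinuousOn (fun z => integrand m l f z -
        ∑ j ∈ Finset.range k, ∑ a ∈ Finset.range (j + 1),
          hcoeff m l f j a * kap (expo m a) (expo m (j - a)) z) (halfDisc ρ) := by
      refine ((continuousOn_integrand hm l hfc).mono (halfDisc_subset_box hρ1)).sub ?_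
      refine continuousOn_finsetSum _ fun j _ => continuousOn_finsetSum _ fun a _ => ?_
      exact continuousOn_const.mul ((continuousOn_kap _ _).mono hsub)
    refine h1.congr fun z hz => ?_
    simp only [hexp z (hsub hz)]; ring
  · have h2 := hs.mul (fun z hz => ne_zero_of_im_pos hz.1)
      (sym_kap hsub N (((m : ℝ) - 1) / m) (((m : ℝ) - 1) / m))
    have hm0 : (m : ℝ) ≠ 0 := by positivity
    rwa [show (k : ℝ) / m + -(((m : ℝ) - 1) / m + ((m : ℝ) - 1) / m) = ord m k - 1 by
      rw [ord]; field_simp; ring] at h2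

/-! ### Uniqueness of polynomial expansions -/

theorem pow_isLittleO_pow {a b : ℕ} (h : b < a) :
    (fun t : ℝ => t ^ a) =o[𝓝[>] 0] fun t : ℝ => t ^ b :=
  (Asymptotics.isLittleO_pow_pow h).mono nhdsWithin_le_nhds

theorem coeff_eq_zero_of_isLittleO {p : Polynomial ℂ} {j : ℕ}
    (h : (fun μ : ℝ => p.eval (μ : ℂ)) =o[𝓝[>] 0] fun μ : ℝ => μ ^ j) :
    ∀ i ≤ j, p.coeff i = 0 := by
  intro i
  induction i using Nat.strong_induction_on with
  | _ i ih =>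
    intro hij
    obtain ⟨q, rfl⟩ := Polynomial.X_pow_dvd_iff.2 fun d hd => ih d hd (by omega)
    have h1 : (fun μ : ℝ => q.eval (μ : ℂ)) =o[𝓝[>] 0] fun _ : ℝ => (1 : ℝ) := by
      have h2 : (fun μ : ℝ => (μ : ℂ) ^ i * q.eval (μ : ℂ)) =o[𝓝[>] 0] fun μ : ℝ => μ ^ i := by
        have h3 : (fun μ : ℝ => μ ^ j) =O[𝓝[>] 0] fun μ : ℝ => μ ^ i :=
          hij.eq_or_lt.elim (fun e => e ▸ isBigO_refl _ _) fun h => (pow_isLittleO_pow h).isBigO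
        refine (h.trans_isBigO h3).congr_left fun μ => by simp
      have h4 : (fun μ : ℝ => ((μ : ℂ) ^ i)⁻¹) =O[𝓝[>] 0] fun μ : ℝ => (μ ^ i)⁻¹ :=
        IsBigO.of_bound 1 (Eventually.of_forall fun μ => by simp)
      refine (h4.mul_isLittleO h2).congr' ?_ ?_
      · filter_upwards [self_mem_nhdsWithin] with μ hμ
        have : (μ : ℂ) ^ i ≠ 0 := pow_ne_zero _ (by exact_mod_cast (ne_of_gt hμ))
        field_simp
      · filter_upwards [self_mem_nhdsWithin] with μ hμ
        exact inv_mul_cancel₀ (pow_ne_zero _ (ne_of_gt hμ))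
    have h5 := (isLittleO_one_iff ℝ).1 h1
    have h6 : Tendsto (fun μ : ℝ => q.eval (μ : ℂ)) (𝓝[>] 0) (𝓝 (q.eval ((0 : ℝ) : ℂ))) :=
      ((q.continuous.comp Complex.continuous_ofReal).tendsto 0).mono_left nhdsWithin_le_nhds
    have h7 := tendsto_nhds_unique h6 h5
    rw [Complex.ofReal_zero, ← Polynomial.coeff_zero_eq_eval_zero] at h7
    rw [Polynomial.coeff_X_pow_mul', if_pos le_rfl, Nat.sub_self, h7]

/-! ### The expansion at the origin -/

/-- With `z` scaled by `μ^m`, the integral of the degree `j` kernel scales by `μ^(j-(m-2))`, whose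
exponent may be negative. The extra factor `μ^(m-2)` turns all scalings into honest powers, so that
polynomials in `μ` can be compared. -/
theorem pow_mul_rpow_ord {m : ℕ} (hm : 2 ≤ m) (j : ℕ) {μ : ℝ} (hμ : 0 < μ) :
    μ ^ (m - 2) * (μ ^ m * (μ ^ m) ^ (-(1 - ord m j))) = μ ^ j := by
  have hm0 : (m : ℝ) ≠ 0 := by positivity
  rw [← Real.rpow_natCast, ← Real.rpow_natCast, ← Real.rpow_natCast, ← Real.rpow_mul hμ.le,
    ← Real.rpow_add hμ, ← Real.rpow_add hμ]
  congr 1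
  rw [Nat.cast_sub hm, ord]
  push_cast
  field_simp; ring

theorem sroot_smul {m : ℕ} (hm : 2 ≤ m) (l : ℕ) {μ : ℝ} (hμ : 0 < μ) {z : ℂ} (hz : z ≠ 0) :
    sroot m l ((μ ^ m : ℝ) * z) = μ * sroot m l z := by
  have hμm : 0 < μ ^ m := by positivity
  have h0 : ((μ ^ m : ℝ) : ℂ) ≠ 0 := by exact_mod_cast hμm.ne'
  have h1 : ((μ ^ m : ℝ) : ℂ) ^ ((1 / m : ℝ) : ℂ) = μ := by
    rw [← Complex.ofReal_cpow hμm.le, one_div, Real.pow_rpow_inv_natCast hμ.le (by omega)]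
  have h2 : ((μ ^ m : ℝ) * z : ℂ) ^ ((1 / m : ℝ) : ℂ) =
      ((μ ^ m : ℝ) : ℂ) ^ ((1 / m : ℝ) : ℂ) * z ^ ((1 / m : ℝ) : ℂ) := by
    rw [cpow_def_of_ne_zero (mul_ne_zero h0 hz), cpow_def_of_ne_zero h0, cpow_def_of_ne_zero hz,
      Complex.log_ofReal_mul hμm hz, Complex.ofReal_log hμm.le, ← Complex.exp_add]
    ring_nf
  rw [sroot, h2, h1, sroot]; ring

theorem zero_mem_closure_sector {m : ℕ} (hm : 2 ≤ m) (l : ℕ) :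
    (0 : ℂ) ∈ closure (sector m ((l : ℝ) / (2 * m)) (((l : ℝ) + 1) / (2 * m))) := by
  have hI : ∀ᶠ μ : ℝ in 𝓝[>] 0,
      (μ : ℂ) * sroot m l I ∈ sector m ((l : ℝ) / (2 * m)) (((l : ℝ) + 1) / (2 * m)) := by
    filter_upwards [self_mem_nhdsWithin,
      mem_nhdsWithin_of_mem_nhds (Iio_mem_nhds one_pos)] with μ hμ hμ1
    rw [← sroot_smul hm l hμ I_ne_zero]
    refine sroot_mem_sector hm l ?_
    simp only [box, Set.mem_ofPred_eq]
    have hμ' : (0 : ℝ) < μ := hμ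
    have h1 : μ ^ m ≤ 1 := pow_le_one₀ hμ'.le (le_of_lt hμ1)
    have h2 : 0 < μ ^ m := by positivity
    rw [Complex.im_ofReal_mul, Complex.re_ofReal_mul]
    simp [h1, h2]
  have hlim : Tendsto (fun μ : ℝ => (μ : ℂ) * sroot m l I) (𝓝[>] 0) (𝓝 0) := by
    have : Tendsto (fun μ : ℝ => (μ : ℂ) * sroot m l I) (𝓝 0) (𝓝 ((0 : ℝ) * sroot m l I)) :=
      (Continuous.tendsto (by fun_prop) 0)
    simpa using this.mono_left nhdsWithin_le_nhds
  exact mem_closure_of_tendsto hlim hI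

theorem isLittleO_comp_mul {E : ℝ → ℝ} {β K : ℝ} (hK : 0 < K)
    (hE : E =o[𝓝[>] 0] fun t : ℝ => t ^ β) :
    (fun t : ℝ => E (K * t)) =o[𝓝[>] 0] fun t : ℝ => t ^ β := by
  have hlim : Tendsto (fun t : ℝ => K * t) (𝓝[>] 0) (𝓝[>] 0) := by
    refine tendsto_nhdsWithin_iff.2 ⟨?_, ?_⟩
    · have : Tendsto (fun t : ℝ => K * t) (𝓝 0) (𝓝 (K * 0)) := Continuous.tendsto (by fun_prop) 0
      rw [mul_zero] at this
      exact this.mono_left nhdsWithin_le_nhds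
    · filter_upwards [self_mem_nhdsWithin] with t ht
      exact mul_pos hK ht
  have h1 := hE.comp_tendsto hlim
  refine (h1.congr' EventuallyEq.rfl ?_).trans_isBigO
    ((isBigO_refl (fun t : ℝ => t ^ β) (𝓝[>] 0)).const_mul_left (K ^ β))
  filter_upwards [self_mem_nhdsWithin] with t ht
  exact Real.mul_rpow hK.le (le_of_lt ht)

/-- The homogeneous parts of the expansion of `F_f` at the origin. -/
theorem exists_homogeneous_primitive {m : ℕ} (hm : 2 ≤ m) {k j l : ℕ} (hjk : j < k) (hl : l < 2 * m)
    {f h : ℂ → ℂ} (hf : ContDiffAt ℝ k f 0) (hfc : ContinuousOn f (domainD m)) {r : REta}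
    (hr0 : 0 < r.v) (hj : ordHat m j < r.v)
    (hh : IsCr r (closure (sector m ((l : ℝ) / (2 * m)) (((l : ℝ) + 1) / (2 * m)))) h)
    (heq : Set.EqOn h (FF m f) (sector m ((l : ℝ) / (2 * m)) (((l : ℝ) + 1) / (2 * m)))) :
    ∃ p : ℕ → ℂ, (∀ a, j < a + (m - 2) → p a = 0) ∧ ∀ u₁ u₂ s : ℝ, 0 < s →
      (∑ a ∈ Finset.range (j + 1), p a * wmono a (j - (m - 2) - a) (sroot m l (u₂ + s * I))) -
      (∑ a ∈ Finset.range (j + 1), p a * wmono a (j - (m - 2) - a) (sroot m l (u₁ + s * I))) =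
      (-1) ^ l * ∑ a ∈ Finset.range (j + 1), hcoeff m l f j a *
        ∫ v in u₁..u₂, kap (expo m a) (expo m (j - a)) (v + s * I) := by
  obtain ⟨K, ρ, hρ, hρ1, hKc, hKs, hexp⟩ := exists_integrand_expansion hm le_rfl hf hfc l
  obtain ⟨n, -, hall⟩ := hh.exists_expansion hr0 Metric.isOpen_ball
    (convex_closure_sector_inter_ball hm l) (interior_closure_sector_inter_ball_nonempty hm l)
  obtain ⟨P, hP, E, hEm, hEo, hb⟩ := hall 0 ⟨zero_mem_closure_sector hm l, by simp⟩
  simp only [sub_zero] at hb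
  -- The polynomial is the part of degree `j - (m-2)` of the expansion of `h`, or 0 if there is no
  -- such degree. Coefficients are set to 0 wherever the truncated exponent `j - (m-2) - a` would be
  -- wrong.
  obtain ⟨p, hp0, hpP⟩ : ∃ p : ℕ → ℂ, (∀ a, j < a + (m - 2) → p a = 0) ∧
      ∀ w, ∑ a ∈ Finset.range (j + 1), p a * wmono a (j - (m - 2) - a) w =
        if m - 2 ≤ j ∧ j - (m - 2) ≤ n then P (j - (m - 2)) w else 0 := by
    by_cases hc : m - 2 ≤ j ∧ j - (m - 2) ≤ n
    · obtain ⟨p, hp⟩ := hP (j - (m - 2))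
      refine ⟨fun a => if a ≤ j - (m - 2) then p a else 0, fun a ha => if_neg (by omega),
        fun w => ?_⟩
      rw [if_pos hc, hp]
      symm
      refine Finset.sum_subset_zero_on_sdiff (Finset.range_mono (by omega)) ?_ ?_
      · intro a ha
        rw [Finset.mem_sdiff, Finset.mem_range, Finset.mem_range] at ha
        simp only [if_neg (show ¬ a ≤ j - (m - 2) by omega), zero_mul]
      · intro a ha
        rw [Finset.mem_range] at ha
        simp only [if_pos (show a ≤ j - (m - 2) by omega)]
    · exact ⟨fun _ => 0, fun _ _ => rfl, fun w => by rw [if_neg hc]; simp⟩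
  refine ⟨p, hp0, fun u₁ u₂ s hs => ?_⟩
  rw [hpP, hpP]
  have hz : ∀ v : ℝ, (v + s * I : ℂ) ∈ upper := fun v => add_mul_I_mem_upper v hs
  have hz0 : ∀ v : ℝ, (v + s * I : ℂ) ≠ 0 := fun v => ne_zero_of_im_pos (hz v)
  set w₁ := sroot m l (u₁ + s * I) with hw₁
  set w₂ := sroot m l (u₂ + s * I) with hw₂
  set Q : ℕ → ℂ := fun i => (-1) ^ l * ∑ a ∈ Finset.range (i + 1), hcoeff m l f i a *
        ∫ v in u₁..u₂, kap (expo m a) (expo m (i - a)) (v + s * I) with hQ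
  -- The polynomial part of the horizontal difference of `h` minus the Taylor part of the integral,
  -- both at scale `μ` and multiplied by `μ^(m-2)`. Its coefficient at `μ^j` is the identity sought.
  set pol : Polynomial ℂ :=
    (∑ d ∈ Finset.range (n + 1), Polynomial.C (P d w₂ - P d w₁) * Polynomial.X ^ (d + (m - 2))) -
      ∑ i ∈ Finset.range k, Polynomial.C (Q i) * Polynomial.X ^ i with hpol
  have hcoef : pol.coeff j = (if m - 2 ≤ j ∧ j - (m - 2) ≤ n then
      P (j - (m - 2)) w₂ - P (j - (m - 2)) w₁ else 0) - Q j := by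
    rw [hpol, Polynomial.coeff_sub, Polynomial.finsetSum_coeff, Polynomial.finsetSum_coeff]
    congr 1
    · simp only [Polynomial.coeff_C_mul_X_pow]
      split_ifs with hc
      · rw [Finset.sum_eq_single (j - (m - 2))]
        · rw [if_pos (by omega)]
        · intro d _ hd; exact if_neg (by omega)
        · intro hd; exact absurd (Finset.mem_range.2 (by omega)) hd
      · refine Finset.sum_eq_zero fun d hd => if_neg ?_
        rw [Finset.mem_range] at hd
        omega
    · simp only [Polynomial.coeff_C_mul_X_pow]
      rw [Finset.sum_ite_eq, if_pos (Finset.mem_range.2 hjk)]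
  suffices hsuff : (fun μ : ℝ => pol.eval (μ : ℂ)) =o[𝓝[>] 0] fun μ : ℝ => μ ^ j by
    have := coeff_eq_zero_of_isLittleO hsuff j le_rfl
    rw [hcoef, sub_eq_zero] at this
    refine Eq.trans ?_ this
    split_ifs <;> simp
  -- a common bound for the points of the segment
  obtain ⟨M, hM0, hM⟩ : ∃ M : ℝ, 1 ≤ M ∧ ∀ v ∈ Set.uIcc u₁ u₂, ‖(v + s * I : ℂ)‖ ≤ M := by
    obtain ⟨M, hM⟩ := (isCompact_uIcc (a := u₁) (b := u₂)).exists_bound_of_continuousOn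
      (f := fun v : ℝ => (v + s * I : ℂ)) (by fun_prop)
    exact ⟨max 1 M, le_max_left _ _, fun v hv => (hM v hv).trans (le_max_right _ _)⟩
  have hsmall : ∀ᶠ μ : ℝ in 𝓝[>] 0, 0 < μ ∧ μ < 1 ∧ μ ^ m * M < ρ := by
    have h1 : Tendsto (fun μ : ℝ => μ ^ m * M) (𝓝[>] 0) (𝓝 0) := by
      have : Tendsto (fun μ : ℝ => μ ^ m * M) (𝓝 0) (𝓝 (0 ^ m * M)) :=
        Continuous.tendsto (by fun_prop) 0
      rw [zero_pow (by omega), zero_mul] at this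
      exact this.mono_left nhdsWithin_le_nhds
    filter_upwards [self_mem_nhdsWithin, mem_nhdsWithin_of_mem_nhds (Iio_mem_nhds one_pos),
      h1.eventually (gt_mem_nhds hρ)] with μ a b c using ⟨a, b, c⟩
  have hdisc : ∀ μ : ℝ, 0 < μ ∧ μ < 1 ∧ μ ^ m * M < ρ → ∀ v ∈ Set.uIcc u₁ u₂,
      ((μ ^ m : ℝ) * (v + s * I : ℂ)) ∈ halfDisc ρ := by
    intro μ hμ v hv
    have hμm : 0 < μ ^ m := pow_pos hμ.1 m
    refine ⟨?_, ?_⟩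
    · rw [Complex.im_ofReal_mul]; exact mul_pos hμm (hz v)
    · rw [norm_mul, norm_real, Real.norm_of_nonneg hμm.le]
      exact (mul_le_mul_of_nonneg_left (hM v hv) hμm.le).trans_lt hμ.2.2
  obtain ⟨CK, hCK, hKb⟩ := hKs.bound
  set D : ℝ → ℂ := fun μ => (h (μ * w₂) - ∑ d ∈ Finset.range (n + 1), P d (μ * w₂)) -
    (h (μ * w₁) - ∑ d ∈ Finset.range (n + 1), P d (μ * w₁)) with hD
  set J : ℝ → ℂ := fun μ => ∫ v in u₁..u₂, K ((μ ^ m : ℝ) * (v + s * I)) with hJ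
  have main : ∀ᶠ μ : ℝ in 𝓝[>] 0, pol.eval (μ : ℂ) =
      (μ : ℂ) ^ (m - 2) * ((-1) ^ l * ((μ ^ m : ℝ) * J μ) - D μ) := by
    filter_upwards [hsmall] with μ hμ
    have hμm : 0 < μ ^ m := pow_pos hμ.1 m
    have hd1 := hdisc μ hμ u₁ Set.left_mem_uIcc
    have hd2 := hdisc μ hμ u₂ Set.right_mem_uIcc
    have hb1 := halfDisc_subset_box hρ1 hd1
    have hb2 := halfDisc_subset_box hρ1 hd2
    have e : ∀ v : ℝ, ((μ ^ m : ℝ) * (v + s * I : ℂ)) =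
        ((μ ^ m * v : ℝ) : ℂ) + ((μ ^ m * s : ℝ) : ℂ) * I := fun v => by push_cast; ring
    have hFF : h (μ * w₂) - h (μ * w₁) =
        (-1) ^ l * ((μ ^ m : ℝ) * ∫ v in u₁..u₂, integrand m l f ((μ ^ m : ℝ) * (v + s * I))) := by
      rw [hw₁, hw₂, ← sroot_smul hm l hμ.1 (hz0 _), ← sroot_smul hm l hμ.1 (hz0 _),
        heq (sroot_mem_sector hm l hb1), heq (sroot_mem_sector hm l hb2), e, e]
      rw [FF_sub hm hfc hl (mul_pos hμm hs)]
      · congr 1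
        have := intervalIntegral.smul_integral_comp_mul_left (a := u₁) (b := u₂)
          (fun v : ℝ => integrand m l f (v + ((μ ^ m * s : ℝ) : ℂ) * I)) (μ ^ m)
        rw [← this, real_smul]
        simp only [e]
      · have := hb1.2.1; rwa [e, ← mk_eq_add_mul_I] at this
      · have := hb1.2.2; rwa [e, ← mk_eq_add_mul_I] at this
      · have := hb2.2.2; rwa [e, ← mk_eq_add_mul_I] at this
    have hint : ∫ v in u₁..u₂, integrand m l f ((μ ^ m : ℝ) * (v + s * I)) =
        (∑ i ∈ Finset.range k, ∑ a ∈ Finset.range (i + 1), hcoeff m l f i a *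
          ((((μ ^ m) ^ (-(1 - ord m i)) : ℝ) : ℂ) *
          ∫ v in u₁..u₂, kap (expo m a) (expo m (i - a)) (v + s * I))) + J μ := by
      have ik : ∀ i a : ℕ, IntervalIntegrable (fun v : ℝ => hcoeff m l f i a *
          ((((μ ^ m) ^ (-(1 - ord m i)) : ℝ) : ℂ) *
          kap (expo m a) (expo m (i - a)) (v + s * I))) volume u₁ u₂ := fun i a =>
        (continuous_const.mul (continuous_const.mul
          (continuous_line (continuousOn_kap _ _) hs))).intervalIntegrable _ _
      have iK : IntervalIntegrable (fun v : ℝ => K ((μ ^ m : ℝ) * (v + s * I))) volume u₁ u₂ :=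
        (hKc.comp (by fun_prop) (hdisc μ hμ)).intervalIntegrable
      have e1 : ∫ v in u₁..u₂, integrand m l f ((μ ^ m : ℝ) * (v + s * I)) =
          ∫ v in u₁..u₂, ((∑ i ∈ Finset.range k, ∑ a ∈ Finset.range (i + 1), hcoeff m l f i a *
          ((((μ ^ m) ^ (-(1 - ord m i)) : ℝ) : ℂ) *
          kap (expo m a) (expo m (i - a)) (v + s * I))) + K ((μ ^ m : ℝ) * (v + s * I))) := by
        refine intervalIntegral.integral_congr fun v hv => ?_
        rw [hexp _ (hdisc μ hμ v hv).1]
        congr 1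
        refine Finset.sum_congr rfl fun i _ => Finset.sum_congr rfl fun a ha => ?_
        rw [kap_smul _ _ hμm, expo_add hm (by have := Finset.mem_range.1 ha; omega)]
      have iS : ∀ i : ℕ, IntervalIntegrable (fun v : ℝ => ∑ a ∈ Finset.range (i + 1),
          hcoeff m l f i a * ((((μ ^ m) ^ (-(1 - ord m i)) : ℝ) : ℂ) *
          kap (expo m a) (expo m (i - a)) (v + s * I))) volume u₁ u₂ := fun i =>
        (continuous_finsetSum _ fun a _ => continuous_const.mul (continuous_const.mul
          (continuous_line (continuousOn_kap _ _) hs))).intervalIntegrable _ _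
      have iSS : IntervalIntegrable (fun v : ℝ => ∑ i ∈ Finset.range k,
          ∑ a ∈ Finset.range (i + 1), hcoeff m l f i a *
          ((((μ ^ m) ^ (-(1 - ord m i)) : ℝ) : ℂ) *
          kap (expo m a) (expo m (i - a)) (v + s * I))) volume u₁ u₂ :=
        (continuous_finsetSum _ fun i _ => continuous_finsetSum _ fun a _ =>
          continuous_const.mul (continuous_const.mul
          (continuous_line (continuousOn_kap _ _) hs))).intervalIntegrable _ _
      rw [e1, intervalIntegral.integral_add iSS iK,
        intervalIntegral.integral_finsetSum fun i _ => iS i]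
      congr 1
      refine Finset.sum_congr rfl fun i _ => ?_
      rw [intervalIntegral.integral_finsetSum fun a _ => ik i a]
      refine Finset.sum_congr rfl fun a _ => ?_
      rw [intervalIntegral.integral_const_mul, intervalIntegral.integral_const_mul]
    have hDμ : D μ = (h (μ * w₂) - h (μ * w₁)) -
        ∑ d ∈ Finset.range (n + 1), (μ : ℂ) ^ d * (P d w₂ - P d w₁) := by
      simp only [hD, (hP _).smul, mul_sub, Finset.sum_sub_distrib]; ring
    rw [hDμ, hFF, hint, hpol, Polynomial.eval_sub, Polynomial.eval_finsetSum,
      Polynomial.eval_finsetSum]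
    simp only [Polynomial.eval_mul, Polynomial.eval_C, Polynomial.eval_pow, Polynomial.eval_X]
    have s1 : ∑ d ∈ Finset.range (n + 1), (P d w₂ - P d w₁) * (μ : ℂ) ^ (d + (m - 2)) =
        (μ : ℂ) ^ (m - 2) * ∑ d ∈ Finset.range (n + 1), (μ : ℂ) ^ d * (P d w₂ - P d w₁) := by
      rw [Finset.mul_sum]
      exact Finset.sum_congr rfl fun d _ => by rw [pow_add]; ring
    have s2 : ∑ i ∈ Finset.range k, Q i * (μ : ℂ) ^ i = (μ : ℂ) ^ (m - 2) * ((-1) ^ l *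
        ((μ ^ m : ℝ) * ∑ i ∈ Finset.range k, ∑ a ∈ Finset.range (i + 1), hcoeff m l f i a *
          ((((μ ^ m) ^ (-(1 - ord m i)) : ℝ) : ℂ) *
          ∫ v in u₁..u₂, kap (expo m a) (expo m (i - a)) (v + s * I)))) := by
      rw [Finset.mul_sum, Finset.mul_sum, Finset.mul_sum]
      refine Finset.sum_congr rfl fun i _ => ?_
      have hpow : (μ : ℂ) ^ i = (μ : ℂ) ^ (m - 2) * (((μ ^ m : ℝ) : ℂ) *
          (((μ ^ m) ^ (-(1 - ord m i)) : ℝ) : ℂ)) := by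
        rw [← Complex.ofReal_pow, ← pow_mul_rpow_ord hm i hμ.1]; push_cast; ring
      simp only [hQ]
      rw [hpow, Finset.mul_sum, Finset.mul_sum, Finset.mul_sum, Finset.mul_sum, Finset.sum_mul]
      refine Finset.sum_congr rfl fun a _ => ?_
      ring
    rw [s1, s2]; ring
  refine IsLittleO.congr' (f₁ := fun μ : ℝ =>
    (μ : ℂ) ^ (m - 2) * ((-1) ^ l * ((μ ^ m : ℝ) * J μ) - D μ)) ?_
    (main.mono fun μ hμ => hμ.symm) EventuallyEq.rfl
  simp only [mul_sub]
  refine IsLittleO.sub ?_ ?_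
  -- The contribution of the Taylor remainder of `f` is `O(μ^k)`, and `j < k`.
  · refine IsBigO.trans_isLittleO (g := fun μ : ℝ => μ ^ k) ?_ (pow_isLittleO_pow hjk)
    have hJb : ∀ᶠ μ : ℝ in 𝓝[>] 0, ‖J μ‖ ≤ (μ ^ m) ^ (-(1 - ord m k)) *
        (CK * |∫ v in u₁..u₂, ‖(v + s * I : ℂ)‖ ^ (ord m k - 1)|) := by
      filter_upwards [hsmall] with μ hμ
      have hμm : 0 < μ ^ m := pow_pos hμ.1 m
      have hcn : Continuous fun v : ℝ => ‖(v + s * I : ℂ)‖ ^ (ord m k - 1) :=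
        Continuous.rpow_const (by fun_prop) fun v => Or.inl (norm_ne_zero_iff.2 (hz0 v))
      have := intervalIntegral.norm_integral_le_abs_of_norm_le (a := u₁) (b := u₂) (μ := volume)
        (f := fun v : ℝ => K ((μ ^ m : ℝ) * (v + s * I)))
        (g := fun v => (μ ^ m) ^ (-(1 - ord m k)) * CK * ‖(v + s * I : ℂ)‖ ^ (ord m k - 1))
        ((ae_restrict_iff' measurableSet_uIoc).2 (Eventually.of_forall fun v hv => by
          refine (hKb _ (hdisc μ hμ v (Set.uIoc_subset_uIcc hv))).trans_eq ?_
          rw [norm_mul, norm_real, Real.norm_of_nonneg hμm.le,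
            Real.mul_rpow hμm.le (norm_nonneg _), neg_sub]
          ring)) ((hcn.const_mul _).intervalIntegrable _ _)
      refine this.trans_eq ?_
      rw [intervalIntegral.integral_const_mul, abs_mul, abs_of_nonneg (by positivity), mul_assoc]
    refine IsBigO.of_bound (CK * |∫ v in u₁..u₂, ‖(v + s * I : ℂ)‖ ^ (ord m k - 1)|) ?_
    filter_upwards [hJb, hsmall] with μ hJμ hμ
    have hμm : 0 < μ ^ m := pow_pos hμ.1 m
    rw [norm_mul, norm_mul, norm_mul, norm_pow, norm_pow, norm_neg, norm_one, one_pow, one_mul,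
      norm_real, norm_real, Real.norm_of_nonneg hμm.le, Real.norm_of_nonneg hμ.1.le,
      Real.norm_of_nonneg (pow_pos hμ.1 k).le, ← pow_mul_rpow_ord hm k hμ.1]
    calc μ ^ (m - 2) * (μ ^ m * ‖J μ‖) ≤ μ ^ (m - 2) * (μ ^ m * ((μ ^ m) ^ (-(1 - ord m k)) *
        (CK * |∫ v in u₁..u₂, ‖(v + s * I : ℂ)‖ ^ (ord m k - 1)|))) := by
          have := pow_pos hμ.1 (m - 2)
          gcongr
      _ = _ := by ring
  -- The error of the expansion of `h` is `o(μ^(ordHat m j))`; the factor `μ^(m-2)` makes this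
  -- `o(μ^j)`.
  · have hw : ∀ v : ℝ, 0 < ‖sroot m l (v + s * I)‖ := fun v => by
      rw [norm_sroot]; exact Real.rpow_pos_of_pos (norm_pos_iff.2 (hz0 v)) _
    have hEE := (isLittleO_comp_mul (hw u₂) (hEo _ hj)).add
      (isLittleO_comp_mul (hw u₁) (hEo _ hj))
    have hDO : D =O[𝓝[>] 0] fun μ : ℝ =>
        E (‖sroot m l (u₂ + s * I)‖ * μ) + E (‖sroot m l (u₁ + s * I)‖ * μ) := by
      refine IsBigO.of_bound 1 ?_
      filter_upwards [hsmall] with μ hμ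
      have hin : ∀ v ∈ Set.uIcc u₁ u₂, ‖h (μ * sroot m l (v + s * I)) -
          ∑ d ∈ Finset.range (n + 1), P d (μ * sroot m l (v + s * I))‖ ≤
          E (‖sroot m l (v + s * I)‖ * μ) := by
        intro v hv
        have hd := hdisc μ hμ v hv
        have := hb (μ * sroot m l (v + s * I)) ⟨subset_closure ?_, ?_⟩
        · rwa [norm_mul, norm_real, Real.norm_of_nonneg hμ.1.le, mul_comm μ] at this
        · rw [← sroot_smul hm l hμ.1 (hz0 v)]
          exact sroot_mem_sector hm l (halfDisc_subset_box hρ1 hd)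
        · rw [← sroot_smul hm l hμ.1 (hz0 v), mem_ball_zero_iff, norm_sroot]
          exact Real.rpow_lt_one (norm_nonneg _) (hd.2.trans_le hρ1) (by positivity)
      rw [one_mul, hD]
      refine (norm_sub_le _ _).trans ((add_le_add (hin u₂ Set.right_mem_uIcc)
        (hin u₁ Set.left_mem_uIcc)).trans (le_abs_self _))
    have h1 : (fun μ : ℝ => (μ : ℂ) ^ (m - 2)) =O[𝓝[>] 0] fun μ : ℝ => μ ^ (m - 2) :=
      IsBigO.of_bound 1 (Eventually.of_forall fun μ => by simp)
    refine (h1.mul_isLittleO (hDO.trans_isLittleO hEE)).congr' EventuallyEq.rfl ?_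
    filter_upwards [self_mem_nhdsWithin] with μ hμ
    rw [← Real.rpow_natCast, ← Real.rpow_natCast, ← Real.rpow_add hμ]
    congr 1
    rw [ordHat, Nat.cast_sub hm]; push_cast; ring

/-! ### The functionals `∂^j_i` in terms of the Taylor coefficients -/

/-- The quotient of binomial coefficients in the definition of `∂^j_i`. -/
noncomputable def chooseRatio (m j i n : ℕ) : ℝ :=
  Ring.choose (((m : ℝ) - 1 - i) / m - 1) n / Ring.choose (((j : ℝ) - i - ((m : ℝ) - 1)) / m) n

theorem succ_mul_choose_succ (x : ℝ) (n : ℕ) :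
    ((n : ℝ) + 1) * Ring.choose x (n + 1) = Ring.choose x n * (x - n) := by
  have h1 := Ring.descPochhammer_eq_factorial_smul_choose x (n + 1)
  have h2 := Ring.descPochhammer_eq_factorial_smul_choose x n
  rw [descPochhammer_succ_right, Polynomial.smeval_mul, h2] at h1
  have h3 : (Polynomial.X - (n : Polynomial ℤ)).smeval x = x - n := by
    rw [Polynomial.smeval_sub, Polynomial.smeval_X, Polynomial.smeval_natCast]; simp
  rw [h3, nsmul_eq_mul, nsmul_eq_mul, Nat.factorial_succ] at h1
  push_cast at h1
  have h4 : (n.factorial : ℝ) ≠ 0 := by positivity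
  refine mul_left_cancel₀ h4 ?_
  linear_combination -h1

theorem Relevant.ne {m j i : ℕ} (hm : 2 ≤ m) (hi : Relevant m j i) (n : ℕ) : i + n * m + (m - 1) ≠ j := by
  intro h
  refine hi.2 (Int.modEq_iff_dvd.2 ?_)
  exact ⟨n, by rw [← h]; push_cast [Nat.cast_sub (show 1 ≤ m by omega)]; ring⟩

/-- The recursion that makes the sum over a residue class telescope; relevance of `i` keeps the
factor on the left nonzero. -/
theorem chooseRatio_succ {m j i : ℕ} (hm : 2 ≤ m) (hi : Relevant m j i) (n : ℕ) :
    chooseRatio m j i (n + 1) * ((j : ℝ) + 1 - (i + (n + 1 : ℕ) * m)) =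
      -(chooseRatio m j i n * (i + n * m + 1)) := by
  have hm0 : (m : ℝ) ≠ 0 := by positivity
  set x : ℝ := ((m : ℝ) - 1 - i) / m - 1 with hx
  set y : ℝ := ((j : ℝ) - i - ((m : ℝ) - 1)) / m with hy
  have hy0 : y - n = ((j : ℝ) + 1 - (i + (n + 1 : ℕ) * m)) / m := by
    rw [hy]; push_cast; field_simp; ring
  have hx0 : x - n = -(i + n * m + 1) / m := by rw [hx]; field_simp; ring
  have hne : (j : ℝ) + 1 - (i + (n + 1 : ℕ) * m) ≠ 0 := by
    intro h
    refine hi.ne hm n ?_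
    have : (j : ℝ) + 1 = ((i + (n + 1) * m : ℕ) : ℝ) := by push_cast at h ⊢; linarith
    have h2 : j + 1 = i + (n + 1) * m := by exact_mod_cast this
    rw [add_mul] at h2; omega
  have hn : (n : ℝ) + 1 ≠ 0 := by positivity
  have ex : Ring.choose x (n + 1) = Ring.choose x n * (-(i + n * m + 1) / m) / (n + 1) := by
    rw [eq_div_iff hn, ← hx0, ← succ_mul_choose_succ]; ring
  have ey : Ring.choose y (n + 1) =
      Ring.choose y n * (((j : ℝ) + 1 - (i + (n + 1 : ℕ) * m)) / m) / (n + 1) := by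
    rw [eq_div_iff hn, ← hy0, ← succ_mul_choose_succ]; ring
  rw [chooseRatio, chooseRatio, ← hx, ← hy, ex, ey]
  -- If the denominator vanished, both ratios would be 0 by the convention for division.
  by_cases hc : Ring.choose y n = 0
  · simp [hc]
  · generalize (j : ℝ) + 1 - (i + (n + 1 : ℕ) * m) = e at hne
    field_simp

theorem wmono_add_mul {m : ℕ} (hm : 2 ≤ m) (l i n b : ℕ) :
    wmono (i + n * m) b (theta0 m ^ l) = wmono i (b + n * m) (theta0 m ^ l) := by
  have h : (theta0 m ^ l) ^ m = (-1) ^ l := by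
    rw [← pow_mul, mul_comm l, pow_mul, theta0_pow_self hm]
  have h' : conj (theta0 m ^ l) ^ m = (-1) ^ l := by rw [← map_pow, h]; simp
  rw [wmono, wmono, pow_add, pow_add, mul_comm n m, pow_mul, pow_mul, h, h']; ring

theorem choose_mul_wirtinger {a j : ℕ} (ha : a ≤ j) (f : ℂ → ℂ) :
    (j.choose a : ℂ) * wirtinger a (j - a) f = j.factorial * tcoeff f a (j - a) := by
  have h : ((j.choose a : ℂ) * a.factorial * (j - a).factorial) = j.factorial := by
    exact_mod_cast Nat.choose_mul_factorial_mul_factorial ha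
  rw [tcoeff, ← h]
  have h1 : (a.factorial : ℂ) ≠ 0 := by exact_mod_cast a.factorial_ne_zero
  have h2 : ((j - a).factorial : ℂ) ≠ 0 := by exact_mod_cast (j - a).factorial_ne_zero
  field_simp

theorem add_mul_le_of_mem_range {m j i n : ℕ} (hij : i ≤ j)
    (hn : n ∈ Finset.range ((j - i) / m + 1)) : i + n * m ≤ j := by
  have h1 : n ≤ (j - i) / m := by have := Finset.mem_range.1 hn; omega
  have h2 := (Nat.mul_le_mul_right m h1).trans (Nat.div_mul_le_self _ _)
  omega

/-- Since `(θ₀^l)^m = ±1`, all indices `i + n m` carry the same power of `θ₀`. So `∂^j_i(f)` is, up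
to a nonzero factor, a weighted sum of the rotated Taylor coefficients. -/
theorem wmono_mul_partialFun {m j i : ℕ} (hm : 2 ≤ m) (hij : i ≤ j) (l : ℕ) (f : ℂ → ℂ) :
    wmono i (j - i) (theta0 m ^ l) * partialFun m j i f = j.factorial *
      ∑ n ∈ Finset.range ((j - i) / m + 1),
        (chooseRatio m j i n : ℂ) * hcoeff m l f j (i + n * m) := by
  rw [partialFun, Finset.mul_sum, Finset.mul_sum]
  refine Finset.sum_congr rfl fun n hn => ?_
  have hc := add_mul_le_of_mem_range hij hn
  have h1 := choose_mul_wirtinger hc f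
  have h2 := wmono_add_mul hm l i n (j - (i + n * m))
  rw [show j - (i + n * m) + n * m = j - i by omega] at h2
  rw [hcoeff, h2, Nat.sub_sub, chooseRatio]
  generalize Ring.choose (((m : ℝ) - 1 - i) / m - 1) n = x
  generalize Ring.choose (((j : ℝ) - i - ((m : ℝ) - 1)) / m) n = y
  push_cast
  linear_combination (wmono i (j - i) (theta0 m ^ l)) * x / y * h1

theorem wmono_theta0_ne_zero (m l a b : ℕ) : wmono a b (theta0 m ^ l) ≠ 0 := by
  have h : theta0 m ^ l ≠ 0 := norm_ne_zero_iff.1 (by rw [norm_theta0_pow]; exact one_ne_zero)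
  exact mul_ne_zero (pow_ne_zero _ h) (pow_ne_zero _ ((map_ne_zero _).2 h))

/-! ### Vanishing of all `∂^j_i` -/

theorem kap_exp (x y : ℝ) {φ : ℝ} (h0 : 0 < φ) (hπ : φ < Real.pi) :
    kap x y (cexp (φ * I)) = cexp ((φ * (y - x) : ℝ) * I) := by
  have hlog : log (cexp (φ * I)) = φ * I := Complex.log_exp (by simp; linarith) (by simp; linarith)
  rw [kap, cpow_def_of_ne_zero (exp_ne_zero _), cpow_def_of_ne_zero (exp_ne_zero _), hlog,
    ← Complex.exp_conj, ← Complex.exp_add]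
  congr 1
  simp only [map_mul, conj_ofReal, conj_I]
  push_cast; ring

theorem wmono_sroot (m l a b : ℕ) (z : ℂ) :
    wmono a b (sroot m l z) =
      wmono a b (theta0 m ^ l) * kap (-((a : ℝ) / m)) (-((b : ℝ) / m)) z := by
  have key : ∀ a : ℕ, (z ^ ((1 / m : ℝ) : ℂ)) ^ a = z ^ ((-(-((a : ℝ) / m)) : ℝ) : ℂ) := by
    intro a
    rw [← Complex.cpow_nat_mul]
    congr 1; push_cast; ring
  rw [wmono, sroot, mul_pow, map_mul, mul_pow, ← map_pow conj (z ^ _), key, key, wmono, kap]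
  ring

/-- The derivative along the real direction of the homogeneous primitive, on the unit circle. -/
theorem primitive_deriv {m j l : ℕ} {f : ℂ → ℂ} {p : ℕ → ℂ}
    (h : ∀ u₁ u₂ s : ℝ, 0 < s →
      (∑ a ∈ Finset.range (j + 1), p a * wmono a (j - (m - 2) - a) (sroot m l (u₂ + s * I))) -
      (∑ a ∈ Finset.range (j + 1), p a * wmono a (j - (m - 2) - a) (sroot m l (u₁ + s * I))) =
      (-1) ^ l * ∑ a ∈ Finset.range (j + 1), hcoeff m l f j a *
        ∫ v in u₁..u₂, kap (expo m a) (expo m (j - a)) (v + s * I)) {z : ℂ} (hz : z ∈ upper) :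
    ∑ a ∈ Finset.range (j + 1), p a * (wmono a (j - (m - 2) - a) (theta0 m ^ l) *
      (((a : ℝ) / m : ℝ) * kap (1 - (a : ℝ) / m) (-(((j - (m - 2) - a : ℕ) : ℝ) / m)) z +
        ((((j - (m - 2) - a : ℕ) : ℝ) / m : ℝ) : ℂ) *
          kap (-((a : ℝ) / m)) (1 - ((j - (m - 2) - a : ℕ) : ℝ) / m) z)) =
      (-1) ^ l * ∑ a ∈ Finset.range (j + 1), hcoeff m l f j a *
        kap (expo m a) (expo m (j - a)) z := by
  have hs : 0 < z.im := hz
  have hzz : (z.re + z.im * I : ℂ) = z := re_add_im z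
  have hL : HasDerivAt (fun u : ℝ => ∑ a ∈ Finset.range (j + 1),
      p a * wmono a (j - (m - 2) - a) (sroot m l (u + z.im * I)))
      (∑ a ∈ Finset.range (j + 1), p a * (wmono a (j - (m - 2) - a) (theta0 m ^ l) *
      (((a : ℝ) / m : ℝ) * kap (1 - (a : ℝ) / m) (-(((j - (m - 2) - a : ℕ) : ℝ) / m)) z +
        ((((j - (m - 2) - a : ℕ) : ℝ) / m : ℝ) : ℂ) *
          kap (-((a : ℝ) / m)) (1 - ((j - (m - 2) - a : ℕ) : ℝ) / m) z))) z.re := by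
    refine HasDerivAt.fun_sum fun a _ => HasDerivAt.const_mul _ ?_
    have hfun : (fun u : ℝ => wmono a (j - (m - 2) - a) (sroot m l (u + z.im * I))) =
        fun u : ℝ => wmono a (j - (m - 2) - a) (theta0 m ^ l) *
          kap (-((a : ℝ) / m)) (-(((j - (m - 2) - a : ℕ) : ℝ) / m)) (u + z.im * I) :=
      funext fun u => wmono_sroot m l _ _ _
    rw [hfun]
    refine HasDerivAt.const_mul _ ?_
    have := hasDerivAt_horizontal (p := 0) hs le_rfl (fun w hw => hasLineDerivAt_kap
      (-((a : ℝ) / m)) (-(((j - (m - 2) - a : ℕ) : ℝ) / m)) hw 1) z.re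
    simp only [Function.iterate_zero, id, hzz, map_one, mul_one] at this
    refine this.congr_deriv ?_
    rw [show -((a : ℝ) / m) + 1 = 1 - (a : ℝ) / m by ring,
      show -(((j - (m - 2) - a : ℕ) : ℝ) / m) + 1 = 1 - ((j - (m - 2) - a : ℕ) : ℝ) / m by ring]
    push_cast; ring
  have hR : HasDerivAt (fun u : ℝ => (-1) ^ l * ∑ a ∈ Finset.range (j + 1), hcoeff m l f j a *
        ∫ v in (0 : ℝ)..u, kap (expo m a) (expo m (j - a)) (v + z.im * I))
      ((-1) ^ l * ∑ a ∈ Finset.range (j + 1), hcoeff m l f j a *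
        kap (expo m a) (expo m (j - a)) z) z.re := by
    refine HasDerivAt.const_mul _ (HasDerivAt.fun_sum fun a _ => HasDerivAt.const_mul _ ?_)
    have hc := continuous_line (continuousOn_kap (expo m a) (expo m (j - a))) hs
    have := intervalIntegral.integral_hasDerivAt_right (hc.intervalIntegrable 0 z.re)
      hc.stronglyMeasurable.stronglyMeasurableAtFilter hc.continuousAt
    rwa [hzz] at this
  -- With one endpoint fixed at `u₁ = 0`, both sides of `h` are differentiated in the other
  -- endpoint.
  refine (hL.sub_const (∑ a ∈ Finset.range (j + 1),
    p a * wmono a (j - (m - 2) - a) (sroot m l ((0 : ℝ) + z.im * I)))).unique ?_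
  refine hR.congr_of_eventuallyEq (Eventually.of_forall fun u => ?_)
  exact h 0 u z.im hs

/-- On `z = e^(iφ)` every kernel is an exponential in `φ`, and after a common factor the derivative
identity becomes polynomial in `e^(2iφ/m)`. It holds at infinitely many points, so coefficients
agree. The two derivatives of a monomial of index `a` land at `a - 1` and `a + (m-1)`, which gives
the two terms. -/
theorem coeff_relation {m j l : ℕ} (hm : 2 ≤ m) {f : ℂ → ℂ} {p : ℕ → ℂ}
    (hp : ∀ a, j < a + (m - 2) → p a = 0) (h : ∀ u₁ u₂ s : ℝ, 0 < s →
      (∑ a ∈ Finset.range (j + 1), p a * wmono a (j - (m - 2) - a) (sroot m l (u₂ + s * I))) -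
      (∑ a ∈ Finset.range (j + 1), p a * wmono a (j - (m - 2) - a) (sroot m l (u₁ + s * I))) =
      (-1) ^ l * ∑ a ∈ Finset.range (j + 1), hcoeff m l f j a *
        ∫ v in u₁..u₂, kap (expo m a) (expo m (j - a)) (v + s * I)) :
    ∃ q : ℕ → ℂ, (∀ a, j < a + (m - 2) → q a = 0) ∧ ∀ c ≤ j,
      ((c : ℂ) + 1) * q (c + 1) + (if m - 1 ≤ c then ((j : ℂ) + 1 - c) * q (c - (m - 1)) else 0) =
        m * (-1) ^ l * hcoeff m l f j c := by
  have hm0 : (m : ℝ) ≠ 0 := by positivity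
  have hmC : (m : ℂ) ≠ 0 := by exact_mod_cast hm0
  set q : ℕ → ℂ := fun a => p a * wmono a (j - (m - 2) - a) (theta0 m ^ l) with hq
  have hq0 : ∀ a, j < a + (m - 2) → q a = 0 := fun a ha => by simp only [hq, hp a ha, zero_mul]
  refine ⟨q, hq0, ?_⟩
  set A : Polynomial ℂ := (∑ a ∈ Finset.range (j + 1),
    (Polynomial.C (q a * a) * Polynomial.X ^ (a - 1) +
      Polynomial.C (q a * ((j : ℂ) - (m - 2) - a)) * Polynomial.X ^ (a + (m - 1)))) -
    ∑ a ∈ Finset.range (j + 1), Polynomial.C (m * (-1) ^ l * hcoeff m l f j a) * Polynomial.X ^ a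
    with hA
  have hroot : ∀ φ : ℝ, 0 < φ → φ < Real.pi → A.eval (cexp ((2 * φ / m : ℝ) * I)) = 0 := by
    intro φ h0 hπ
    have hz : cexp (φ * I) ∈ upper := by
      show 0 < (cexp (φ * I)).im
      rw [exp_ofReal_mul_I_im]; exact Real.sin_pos_of_pos_of_lt_pi h0 hπ
    have hd := primitive_deriv h hz
    simp only [kap_exp _ _ h0 hπ] at hd
    -- The factor `m` clears the denominators of the derivatives; `e^(iφj/m)` shifts all frequencies
    -- to nonnegative multiples of `2φ/m`, apart from terms with coefficient 0.
    have hd2 := congrArg (fun t => m * cexp ((φ * j / m : ℝ) * I) * t) hd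
    simp only [Finset.mul_sum] at hd2
    rw [hA, Polynomial.eval_sub, sub_eq_zero, Polynomial.eval_finsetSum, Polynomial.eval_finsetSum]
    simp only [Polynomial.eval_add, Polynomial.eval_mul, Polynomial.eval_C, Polynomial.eval_pow,
      Polynomial.eval_X, ← Complex.exp_nat_mul]
    refine Eq.trans ?_ (hd2.trans ?_)
    · refine Finset.sum_congr rfl fun a ha => ?_
      by_cases hja : j < a + (m - 2)
      · rw [hq0 a hja, hp a hja]; simp
      have hb : (((j - (m - 2) - a : ℕ) : ℝ)) = j - (m - 2) - a := by
        rw [Nat.cast_sub (by omega), Nat.cast_sub (by omega), Nat.cast_sub hm]; push_cast; ring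
      rw [hb]
      have e2 : cexp (((a + (m - 1) : ℕ) : ℂ) * (((2 * φ / m : ℝ) : ℂ) * I)) =
          cexp ((φ * j / m : ℝ) * I) *
            cexp ((φ * (1 - ((j : ℝ) - (m - 2) - a) / m - -((a : ℝ) / m)) : ℝ) * I) := by
        rw [← Complex.exp_add]; congr 1
        push_cast [Nat.cast_sub (show 1 ≤ m by omega)]
        field_simp; ring
      have e1 : (a : ℂ) * cexp (((a - 1 : ℕ) : ℂ) * (((2 * φ / m : ℝ) : ℂ) * I)) =
          a * (cexp ((φ * j / m : ℝ) * I) *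
            cexp ((φ * (-(((j : ℝ) - (m - 2) - a) / m) - (1 - (a : ℝ) / m)) : ℝ) * I)) := by
        rcases Nat.eq_zero_or_pos a with rfl | hpos
        · simp
        rw [← Complex.exp_add]; congr 2
        push_cast [Nat.cast_sub (show 1 ≤ a from hpos)]
        field_simp; ring
      rw [mul_assoc (q a), e1, e2]
      simp only [hq]
      push_cast
      field_simp
    · refine Finset.sum_congr rfl fun a ha => ?_
      have haj : a ≤ j := by have := Finset.mem_range.1 ha; omega
      have e3 : cexp ((a : ℂ) * (((2 * φ / m : ℝ) : ℂ) * I)) = cexp ((φ * j / m : ℝ) * I) *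
          cexp ((φ * (expo m (j - a) - expo m a) : ℝ) * I) := by
        rw [← Complex.exp_add, expo, expo]; congr 1
        push_cast [Nat.cast_sub haj]
        field_simp; ring
      rw [e3]; ring
  have hA0 : A = 0 := by
    refine Polynomial.eq_zero_of_infinite_isRoot A ?_
    have hinj : Set.InjOn (fun φ : ℝ => cexp ((2 * φ / m : ℝ) * I)) (Set.Ioo 0 Real.pi) := by
      have hm2 : (2 : ℝ) ≤ m := by exact_mod_cast hm
      have hlog : ∀ φ ∈ Set.Ioo 0 Real.pi, log (cexp ((2 * φ / m : ℝ) * I)) = (2 * φ / m : ℝ) * I :=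
        fun φ hφ => by
          have h1 : 0 < 2 * φ / m := by have := hφ.1; positivity
          have h2 : 2 * φ / m < Real.pi := by
            rw [div_lt_iff₀ (by positivity)]; nlinarith [hφ.1, hφ.2, Real.pi_pos]
          refine Complex.log_exp ?_ ?_
          · rw [Complex.im_ofReal_mul, I_im]; linarith [Real.pi_pos]
          · rw [Complex.im_ofReal_mul, I_im]; linarith
      intro φ hφ ψ hψ heq
      have := congrArg log heq
      simp only at this
      rw [hlog φ hφ, hlog ψ hψ] at this
      have h3 := Complex.ofReal_injective (mul_right_cancel₀ I_ne_zero this)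
      field_simp at h3
      exact h3
    refine ((Set.Ioo_infinite Real.pi_pos).image hinj).mono ?_
    rintro _ ⟨φ, hφ, rfl⟩
    exact hroot φ hφ.1 hφ.2
  intro c hc
  have hcoef := congrArg (fun P => Polynomial.coeff P c) hA0
  simp only [hA, Polynomial.coeff_sub, Polynomial.finsetSum_coeff, Polynomial.coeff_add,
    Polynomial.coeff_C_mul_X_pow, Polynomial.coeff_zero, Finset.sum_add_distrib] at hcoef
  rw [Finset.sum_ite_eq, if_pos (Finset.mem_range.2 (by omega)), sub_eq_zero] at hcoef
  rw [← hcoef]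
  congr 1
  · rw [Finset.sum_eq_single (c + 1)]
    · simp [mul_comm]
    · intro a _ hac
      split_ifs with hca
      · have : a = 0 := by omega
        simp [this]
      · rfl
    · intro hnot
      rw [hq0 (c + 1) (by rw [Finset.mem_range] at hnot; omega)]; simp
  · split_ifs with hmc
    · rw [Finset.sum_eq_single (c - (m - 1))]
      · rw [if_pos (by omega)]
        push_cast [Nat.cast_sub hmc, Nat.cast_sub (show 1 ≤ m by omega)]
        ring
      · intro a _ hac; exact if_neg (by omega)
      · intro hnot; exact absurd (Finset.mem_range.2 (by omega)) hnot
    · exact (Finset.sum_eq_zero fun a _ => if_neg (by omega)).symm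

/-- The coefficient with index `i + n m + 1` enters the relations for `c = i + n m` and `c = i +
(n+1) m`; the weights `chooseRatio` make these two occurrences cancel. -/
theorem partialFun_eq_zero_of_coeff_relation {m j l i : ℕ} (hm : 2 ≤ m) {f : ℂ → ℂ} {q : ℕ → ℂ}
    (hq : ∀ a, j < a + (m - 2) → q a = 0) (h : ∀ c ≤ j,
      ((c : ℂ) + 1) * q (c + 1) + (if m - 1 ≤ c then ((j : ℂ) + 1 - c) * q (c - (m - 1)) else 0) =
        m * (-1) ^ l * hcoeff m l f j c) (hi : Relevant m j i) : partialFun m j i f = 0 := by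
  have hij : i ≤ j := hi.1.trans (min_le_left _ _)
  have him : i ≤ m - 2 := hi.1.trans (min_le_right _ _)
  have hmC : (m : ℂ) ≠ 0 := by exact_mod_cast (show m ≠ 0 by omega)
  refine (mul_eq_zero.1 ?_).resolve_left (wmono_theta0_ne_zero m l i (j - i))
  rw [wmono_mul_partialFun hm hij]
  -- The partial sums leave one boundary term, at the top. There is none at the bottom because `i ≤
  -- m - 2` excludes the second term of the relation at `c = i`.
  have hsum : ∀ N, (∀ n < N, i + n * m ≤ j) → ∑ n ∈ Finset.range N,
      (chooseRatio m j i n : ℂ) * (m * (-1) ^ l * hcoeff m l f j (i + n * m)) =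
      -(if N = 0 then 0 else chooseRatio m j i N * ((j : ℂ) + 1 - (i + N * m)) *
        q (i + N * m - (m - 1))) := by
    intro N
    induction N with
    | zero => simp
    | succ N ih =>
      intro hN
      rw [Finset.sum_range_succ, ih fun n hn => hN n (by omega), ← h _ (hN N (by omega)),
        if_neg (Nat.succ_ne_zero N)]
      have hr : (chooseRatio m j i (N + 1) : ℂ) * ((j : ℂ) + 1 - (i + (N + 1 : ℕ) * m)) =
          -(chooseRatio m j i N * (i + N * m + 1)) := by
        exact_mod_cast congrArg (fun t : ℝ => (t : ℂ)) (chooseRatio_succ hm hi N)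
      have hidx : i + (N + 1) * m - (m - 1) = i + N * m + 1 := by rw [add_mul]; omega
      rw [hr, hidx]
      by_cases hN0 : N = 0
      · subst hN0
        rw [if_pos rfl, if_neg (by omega)]
        push_cast; ring
      · have : m ≤ N * m := Nat.le_mul_of_pos_left m (by omega)
        rw [if_neg hN0, if_pos (by omega)]
        push_cast; ring
  have hN := hsum ((j - i) / m + 1) fun n hn => add_mul_le_of_mem_range hij (Finset.mem_range.2 hn)
  -- The top index lies outside the support of `q`: `i + (n+1) m` exceeds `j` by maximality of `n =
  -- (j-i)/m` and differs from `j + 1` by relevance.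
  rw [hq (i + ((j - i) / m + 1) * m - (m - 1)), mul_zero, ite_self, neg_zero] at hN
  · rw [← mul_right_inj' (mul_ne_zero hmC (pow_ne_zero l (neg_ne_zero.2 (one_ne_zero (α := ℂ))))),
      mul_zero, mul_left_comm, Finset.mul_sum]
    rw [← mul_zero ((j.factorial : ℂ)), ← hN]
    congr 1
    exact Finset.sum_congr rfl fun n _ => by ring
  · have h1 := hi.ne hm ((j - i) / m)
    have h2 := Nat.lt_div_mul_add (a := j - i) (show 0 < m by omega)
    rw [add_mul]; omega

/-! ### Differences of truncated integrals -/

theorem fwdDiff_iterate_congr {K L : ℂ → ℂ} {h z : ℂ} {p : ℕ}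
    (hKL : ∀ i : ℕ, i ≤ p → K (z + i * h) = L (z + i * h)) :
    (fwdDiff h)^[p] K z = (fwdDiff h)^[p] L z := by
  rw [fwdDiff_iter_eq_sum_shift, fwdDiff_iter_eq_sum_shift]
  refine Finset.sum_congr rfl fun i hi => ?_
  rw [nsmul_eq_mul, hKL i (by have := Finset.mem_range.1 hi; omega)]

theorem norm_fwdDiff_iterate_le {K : ℂ → ℂ} {h z : ℂ} {p : ℕ} {B : ℝ}
    (hK : ∀ i : ℕ, i ≤ p → ‖K (z + i * h)‖ ≤ B) : ‖(fwdDiff h)^[p] K z‖ ≤ 2 ^ p * B := by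
  induction p generalizing z with
  | zero => simpa using hK 0 le_rfl
  | succ p ih =>
    rw [Function.iterate_succ_apply', fwdDiff]
    refine (norm_sub_le _ _).trans ((add_le_add (ih fun i hi => ?_)
      (ih fun i hi => hK i (by omega))).trans_eq (by ring))
    have := hK (i + 1) (by omega)
    rwa [show z + h + i * h = z + (i + 1 : ℕ) * h by push_cast; ring]

theorem integral_line_scale {E : Type*} [NormedAddCommGroup E] [NormedSpace ℝ E] (g : ℝ → E)
    {s : ℝ} (hs : 0 < s) : ∫ v, g v = s • ∫ t, g (s * t) := by
  rw [Measure.integral_comp_mul_left, abs_of_pos (inv_pos.2 hs), smul_smul,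
    mul_inv_cancel₀ hs.ne', one_smul]

theorem integral_norm_line {γ s : ℝ} (hs : 0 < s) :
    ∫ v : ℝ, ‖(v + s * I : ℂ)‖ ^ (-γ) = s ^ (1 - γ) * ∫ v : ℝ, ‖(v + I : ℂ)‖ ^ (-γ) := by
  rw [integral_line_scale _ hs]
  have : ∀ t : ℝ, ‖(((s * t : ℝ) : ℂ) + s * I)‖ ^ (-γ) = s ^ (-γ) * ‖(t + I : ℂ)‖ ^ (-γ) := by
    intro t
    rw [← Real.mul_rpow hs.le (norm_nonneg _)]
    congr 1
    rw [← Real.norm_of_nonneg hs.le, ← norm_real, ← norm_mul, norm_real, Real.norm_of_nonneg hs.le]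
    congr 1; push_cast; ring
  simp only [this]
  rw [integral_const_mul, smul_eq_mul, ← mul_assoc, sub_eq_add_neg, Real.rpow_add hs, Real.rpow_one]

theorem integrable_fwdDiff_kap_smul {x y : ℝ} {p : ℕ} (h : 1 < x + y + p) {s : ℝ} (hs : 0 < s) :
    Integrable fun v : ℝ => (fwdDiff (s * I))^[p] (kap x y) (v + s * I) := by
  obtain ⟨C, hC, hb⟩ := norm_fwdDiff_kap_le x y p (by linarith)
  exact ((integrable_norm_line hs h).const_mul (C * s ^ p)).mono'
    (continuous_line (continuousOn_fwdDiff_iterate (continuousOn_kap x y) hs.le p)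
      hs).aestronglyMeasurable
    (Eventually.of_forall fun v => hb _ (add_mul_I_mem_upper v hs) s hs.le)

theorem integral_fwdDiff_kap_smul (x y : ℝ) (p : ℕ) {s : ℝ} (hs : 0 < s) :
    ∫ v : ℝ, (fwdDiff (s * I))^[p] (kap x y) (v + s * I) =
      ((s ^ (1 - (x + y)) : ℝ) : ℂ) * regInt p x y 1 := by
  rw [integral_line_scale _ hs, regInt]
  have : ∀ t : ℝ, (fwdDiff (s * I))^[p] (kap x y) (((s * t : ℝ) : ℂ) + s * I) =
      ((s ^ (-(x + y)) : ℝ) : ℂ) * (fwdDiff I)^[p] (kap x y) (t + (1 : ℝ) * I) := by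
    intro t
    rw [← fwdDiff_iterate_smul x y hs, show (s : ℂ) * (t + (1 : ℝ) * I) = (s * t : ℝ) + s * I by
      push_cast; ring]
  simp only [this]
  rw [integral_const_mul, real_smul, ← mul_assoc, ← ofReal_mul, sub_eq_add_neg, Real.rpow_add hs,
    Real.rpow_one]

/-- Over the whole line the integral is exactly homogeneous in `s`. The tails with `|v| ≥ δ` stay
away from the singularity, where a `p`-th difference is `O(s^p)` with an integrable majorant. -/
theorem norm_integral_fwdDiff_kap_sub_le {x y : ℝ} {p : ℕ} (h : 1 < x + y + p) {δ : ℝ}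
    (hδ : 0 < δ) : ∃ C : ℝ, ∀ s : ℝ, 0 < s →
      ‖(∫ v in (-δ)..δ, (fwdDiff (s * I))^[p] (kap x y) (v + s * I)) -
        ((s ^ (1 - (x + y)) : ℝ) : ℂ) * regInt p x y 1‖ ≤ C * s ^ p := by
  obtain ⟨C, hC, hb⟩ := norm_fwdDiff_kap_le x y p (by linarith)
  set γ := x + y + p with hγ
  -- This constant makes `c * (1 + |v|) ≤ |v|` whenever `|v| ≥ δ`.
  set c := δ / (1 + δ) with hc
  have hc0 : 0 < c := by positivity
  set G : ℝ → ℝ := fun v => c ^ (-γ) * ‖(1 + v * I : ℂ)‖ ^ (-γ) with hG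
  have hGi : Integrable G := (integrable_one_add_mul_I h).const_mul _
  refine ⟨C * ∫ v in (Set.Ioc (-δ) δ)ᶜ, G v, fun s hs => ?_⟩
  rw [← integral_fwdDiff_kap_smul x y p hs, intervalIntegral.integral_of_le (by linarith),
    ← integral_add_compl measurableSet_Ioc (integrable_fwdDiff_kap_smul h hs), sub_add_cancel_left,
    norm_neg, mul_right_comm, ← integral_const_mul]
  refine norm_integral_le_of_norm_le (hGi.restrict.const_mul _)
    ((ae_restrict_iff' measurableSet_Ioc.compl).2 (Eventually.of_forall fun v hv => ?_))
  refine (hb _ (add_mul_I_mem_upper v hs) s hs.le).trans ?_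
  have h1 : 0 < ‖(1 + v * I : ℂ)‖ := norm_pos_iff.2 (slitPlane_ne_zero (slit_one_add_mul_I v))
  have hv' : δ ≤ |v| := by
    by_contra! hlt
    exact hv ⟨(abs_lt.1 hlt).1, (abs_lt.1 hlt).2.le⟩
  have h2 : c * ‖(1 + v * I : ℂ)‖ ≤ ‖(v + s * I : ℂ)‖ := by
    have h3 : ‖(1 + v * I : ℂ)‖ ≤ 1 + |v| := by
      refine (norm_add_le _ _).trans_eq ?_
      rw [norm_mul, norm_I, norm_real, norm_one, mul_one, Real.norm_eq_abs]
    have h4 : |v| ≤ ‖(v + s * I : ℂ)‖ := by simpa using Complex.abs_re_le_norm (v + s * I : ℂ)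
    refine le_trans ?_ h4
    rw [hc, div_mul_eq_mul_div, div_le_iff₀ (by positivity)]
    nlinarith
  refine mul_le_mul_of_nonneg_left ?_ (by positivity)
  simp only [hG]
  rw [← Real.mul_rpow hc0.le h1.le]
  exact Real.rpow_le_rpow_of_nonpos (by positivity) h2 (by linarith)

/-- The difference is at most a constant times `s^p |z|^(α-p)`. At height `s` the integral of
`|z|^(α-p)` over the whole line is a multiple of `s^(α-p+1)`, convergent because `p - α > 1`. -/
theorem norm_integral_fwdDiff_remainder_le {ρ α : ℝ} {p : ℕ} {K : ℂ → ℂ}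
    (hα : α + 1 < p) (hK : Sym (halfDisc ρ) p α K) {δ : ℝ} (hδ : 0 < δ) :
    ∃ C : ℝ, ∀ s : ℝ, 0 < s → δ + (p + 1) * s < ρ →
      ‖∫ v in (-δ)..δ, (fwdDiff (s * I))^[p] K (v + s * I)‖ ≤ C * s ^ (α + 1) := by
  obtain ⟨C, hC, hb⟩ := hK.norm_fwdDiff_le (fun z hz => hz.1) (by linarith)
  refine ⟨C * ∫ v : ℝ, ‖(v + I : ℂ)‖ ^ (-(p - α)), fun s hs hsρ => ?_⟩
  have hi := (integrable_norm_line hs (show 1 < p - α by linarith)).const_mul (C * s ^ p)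
  have h1 : ‖∫ v in (-δ)..δ, (fwdDiff (s * I))^[p] K (v + s * I)‖ ≤
      ∫ v in Set.Ioc (-δ) δ, C * s ^ p * ‖(v + s * I : ℂ)‖ ^ (-(p - α)) := by
    rw [intervalIntegral.integral_of_le (by linarith)]
    refine norm_integral_le_of_norm_le hi.restrict
      ((ae_restrict_iff' measurableSet_Ioc).2 (Eventually.of_forall fun v hv => ?_))
    rw [neg_sub]
    refine hb _ s hs.le fun t ht0 ht => ⟨?_, ?_⟩
    · simp; linarith
    · have e : (v + s * I + t * I : ℂ) = v + ((s + t : ℝ) : ℂ) * I := by push_cast; ring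
      rw [e]
      refine (norm_add_le _ _).trans_lt ?_
      rw [norm_mul, norm_I, norm_real, norm_real, mul_one, Real.norm_eq_abs, Real.norm_eq_abs,
        abs_of_nonneg (show 0 ≤ s + t by linarith)]
      have : |v| ≤ δ := abs_le.2 ⟨hv.1.le, hv.2⟩
      linarith
  refine h1.trans ((setIntegral_le_integral hi (Eventually.of_forall fun v => ?_)).trans_eq ?_)
  · positivity
  · rw [integral_const_mul, integral_norm_line hs, show α + 1 = p + (1 - (p - α)) by ring,
      Real.rpow_add hs, Real.rpow_natCast]
    ring

/-- Vertical differences commute with horizontal integration; each one shortens the admissible range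
of heights by `s`. -/
theorem integral_fwdDiff_eq {U G : ℂ → ℂ} {a b s τ : ℝ} (hs : 0 < s) {p : ℕ}
    (h : ∀ t : ℝ, 0 < t → t ≤ τ → U (b + t * I) - U (a + t * I) = ∫ v in a..b, G (v + t * I))
    (hG : ∀ t : ℝ, 0 < t → t ≤ τ →
      IntervalIntegrable (fun v : ℝ => G (v + t * I)) volume a b) {t : ℝ} (ht : 0 < t)
    (htτ : t + p * s ≤ τ) :
    (fwdDiff (s * I))^[p] U (b + t * I) - (fwdDiff (s * I))^[p] U (a + t * I) =
      ∫ v in a..b, (fwdDiff (s * I))^[p] G (v + t * I) := by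
  induction p generalizing U G τ with
  | zero => exact h t ht (by simpa using htτ)
  | succ p ih =>
    simp only [Function.iterate_succ_apply]
    have e : ∀ v t : ℝ, (v + t * I + s * I : ℂ) = v + ((t + s : ℝ) : ℂ) * I := fun v t => by
      push_cast; ring
    refine ih (τ := τ - s) (fun t ht htτ => ?_) (fun t ht htτ => ?_) (by push_cast at htτ; linarith)
    · simp only [fwdDiff, e]
      rw [intervalIntegral.integral_sub (hG _ (by linarith) (by linarith))
        (hG _ ht (by linarith)), ← h _ (by linarith) (by linarith), ← h _ ht (by linarith)]
      ring
    · simp only [fwdDiff, e]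
      exact (hG _ (by linarith) (by linarith)).sub (hG _ ht (by linarith))

/-! ### Differences of an expandable function along a vertical segment -/

/-- For `u < 0` the point lies on the branch cut. Approached from above, the power coincides with a
constant times the power of `-z`, which is differentiable there; the value on the cut agrees because
the principal argument is `π`. -/
theorem exists_hasDerivAt_eqOn_cpow {u : ℝ} (hu : u ≠ 0) (e : ℝ) :
    ∃ g : ℝ → ℂ, DifferentiableAt ℝ g 0 ∧ ∀ t : ℝ, 0 ≤ t → (u + t * I : ℂ) ^ (e : ℂ) = g t := by
  have hdiff : ∀ {u : ℝ} (c : ℂ), 0 < u →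
      DifferentiableAt ℝ (fun t : ℝ => (u + t * c : ℂ) ^ (e : ℂ)) 0 := by
    intro u c hu
    have h1 : HasDerivAt (fun t : ℝ => (u + t * c : ℂ)) c 0 := by
      simpa using ((hasDerivAt_id (0 : ℝ)).ofReal_comp.mul_const c).const_add (u : ℂ)
    have h2 : HasDerivAt (fun z : ℂ => z ^ (e : ℂ)) _ (u + (0 : ℝ) * c : ℂ) :=
      (hasDerivAt_id _).cpow_const (by simpa using hu)
    exact (h2.comp_of_eq (0 : ℝ) h1 rfl).differentiableAt
  rcases hu.lt_or_gt with hneg | hpos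
  · refine ⟨fun t => cexp (Real.pi * I * e) * (((-u : ℝ) : ℂ) + t * (-I)) ^ (e : ℂ),
      (hdiff (-I) (by linarith)).const_mul _, fun t ht => ?_⟩
    have hz : (((-u : ℝ) : ℂ) + t * (-I)) = -(u + t * I) := by push_cast; ring
    have h0 : (u + t * I : ℂ) ≠ 0 := fun h => hu (by simpa using congrArg re h)
    have hlog : log (-(u + t * I : ℂ)) = log (u + t * I) - Real.pi * I := by
      have harg : arg (-(u + t * I : ℂ)) = arg (u + t * I) - Real.pi := by
        refine Complex.arg_neg_eq_arg_sub_pi_iff.2 ?_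
        rcases ht.eq_or_lt with rfl | ht
        · right; simpa using hneg
        · left; simpa using ht
      rw [log, log, norm_neg, harg]; push_cast; ring
    simp only
    rw [hz, cpow_def_of_ne_zero h0, cpow_def_of_ne_zero (neg_ne_zero.2 h0), hlog, ← Complex.exp_add]
    congr 1; ring
  · exact ⟨_, hdiff I hpos, fun t _ => rfl⟩

theorem exists_norm_sroot_sub_le {m : ℕ} (l : ℕ) {u : ℝ} (hu : u ≠ 0) :
    ∃ M ε : ℝ, 0 < M ∧ 0 < ε ∧ ∀ t : ℝ, 0 ≤ t → t < ε →
      ‖sroot m l (u + t * I) - sroot m l u‖ ≤ M * t := by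
  obtain ⟨g, hg, hgu⟩ := exists_hasDerivAt_eqOn_cpow hu (1 / m)
  obtain ⟨M, hM, hb⟩ := hg.isBigO_sub.exists_pos
  obtain ⟨ε, hε, hb⟩ := Metric.eventually_nhds_iff.1 hb.bound
  refine ⟨M, ε, hM, hε, fun t ht htε => ?_⟩
  have h1 := hb (y := t) (by rwa [Real.dist_eq, sub_zero, abs_of_nonneg ht])
  have h2 := hgu 0 le_rfl
  rw [ofReal_zero, zero_mul, add_zero] at h2
  rw [sroot, sroot, ← mul_sub, norm_mul, norm_theta0_pow, one_mul, hgu t ht, h2]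
  simpa [abs_of_nonneg ht] using h1

theorem Sym.pow {Ω : Set ℂ} (hΩ : ∀ z ∈ Ω, z ≠ 0) {N : ℕ} {K : ℂ → ℂ} (hK : Sym Ω N 0 K) (a : ℕ) :
    Sym Ω N 0 (fun z => K z ^ a) := by
  induction a with
  | zero => simpa using Sym.const N 1
  | succ a ih => simpa [pow_succ] using ih.mul hΩ hK

theorem Sym.sum {Ω : Set ℂ} {N : ℕ} {ι : Type*} (s : Finset ι) {K : ι → ℂ → ℂ}
    (hK : ∀ i ∈ s, Sym Ω N 0 (K i)) : Sym Ω N 0 (fun z => ∑ i ∈ s, K i z) := by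
  classical
  induction s using Finset.induction_on with
  | empty => simpa using Sym.const N 0
  | insert i s hi ih =>
    simp only [Finset.sum_insert hi]
    exact (hK i (Finset.mem_insert_self i s)).add
      (ih fun j hj => hK j (Finset.mem_insert_of_mem hj))

theorem sym_hom_sroot {d : ℕ} {P : ℂ → ℂ} (hP : IsHom d P) (m l N : ℕ) (w₀ : ℂ) :
    Sym (halfDisc 1) N 0 (fun z => P (sroot m l z - w₀)) := by
  have h0 : ∀ z ∈ halfDisc 1, z ≠ 0 := fun z hz => ne_zero_of_im_pos hz.1
  have h1 : Sym (halfDisc 1) N 0 (fun z => sroot m l z + -w₀) :=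
    (((Sym.cpow (fun z hz => hz.1) N (1 / m)).weaken
      (fun z hz => ⟨h0 z hz, le_of_lt hz.2⟩) (by positivity)).const_mul h0 _).add (Sym.const N _)
  obtain ⟨p, hp⟩ := hP
  simp only [hp, sub_eq_add_neg (sroot m l _), wmono]
  refine Sym.sum _ fun a _ => Sym.const_mul h0 ?_ _
  simpa using (h1.pow h0 a).mul h0 (h1.conj.pow h0 (d - a))

/-! ### Differences of `F_f` along vertical segments -/

theorem intervalIntegrable_fwdDiff {G : ℂ → ℂ} {a b s τ : ℝ} (hs : 0 < s) {p : ℕ}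
    (hG : ∀ t : ℝ, 0 < t → t ≤ τ →
      IntervalIntegrable (fun v : ℝ => G (v + t * I)) volume a b) {t : ℝ} (ht : 0 < t)
    (htτ : t + p * s ≤ τ) :
    IntervalIntegrable (fun v : ℝ => (fwdDiff (s * I))^[p] G (v + t * I)) volume a b := by
  induction p generalizing G τ with
  | zero => exact hG t ht (by simpa using htτ)
  | succ p ih =>
    simp only [Function.iterate_succ_apply]
    refine ih (τ := τ - s) (fun t ht htτ => ?_) (by push_cast at htτ; linarith)
    have e : ∀ v t : ℝ, (v + t * I + s * I : ℂ) = v + ((t + s : ℝ) : ℂ) * I := fun v t => by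
      push_cast; ring
    simp only [fwdDiff, e]
    exact (hG _ (by linarith) (by linarith)).sub (hG _ ht (by linarith))

theorem eventually_small {A B : ℝ} (hB : 0 < B) : ∀ᶠ s : ℝ in 𝓝[>] 0, 0 < s ∧ A * s < B := by
  have h1 : Tendsto (fun s : ℝ => A * s) (𝓝[>] 0) (𝓝 0) := by
    have : Tendsto (fun s : ℝ => A * s) (𝓝 0) (𝓝 (A * 0)) := Continuous.tendsto (by fun_prop) 0
    rw [mul_zero] at this
    exact this.mono_left nhdsWithin_le_nhds
  filter_upwards [self_mem_nhdsWithin, h1.eventually (gt_mem_nhds hB)] with s a b using ⟨a, b⟩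

/-- Expand `h` at the boundary point `sroot m l u`. Away from the origin the root is regular, so the
polynomial part has `p`-th differences `O(s^p)`, and the points used lie within `O(s)` of the
centre, where the error is `o(s^β)`. -/
theorem fwdDiff_comp_sroot_isLittleO {m : ℕ} (hm : 2 ≤ m) (l : ℕ) {h : ℂ → ℂ} {r : REta}
    (hr0 : 0 < r.v)
    (hh : IsCr r (closure (sector m ((l : ℝ) / (2 * m)) (((l : ℝ) + 1) / (2 * m)))) h)
    {u : ℝ} (hu : u ≠ 0) (hu1 : |u| < 1) {p : ℕ} {β : ℝ} (hβ : β < r.v) (hβp : β < p) :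
    (fun s : ℝ => (fwdDiff (s * I))^[p] (fun z => h (sroot m l z)) (u + s * I)) =o[𝓝[>] 0]
      fun s : ℝ => s ^ β := by
  obtain ⟨M, ε, hM, hε, hLip⟩ := exists_norm_sroot_sub_le (m := m) l hu
  have hu0 : 0 < |u| := abs_pos.2 hu
  have hnorm : ∀ t : ℝ, 0 < t → t < 1 - |u| → ‖(u + t * I : ℂ)‖ < 1 := by
    intro t ht ht1
    refine (norm_add_le _ _).trans_lt ?_
    rw [norm_mul, norm_I, norm_real, norm_real, mul_one, Real.norm_eq_abs, Real.norm_eq_abs,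
      abs_of_pos ht]
    linarith
  have hsec : ∀ t : ℝ, 0 < t → t < 1 - |u| →
      sroot m l (u + t * I) ∈ sector m ((l : ℝ) / (2 * m)) (((l : ℝ) + 1) / (2 * m)) :=
    fun t ht ht1 => sroot_mem_sector hm l (halfDisc_subset_box le_rfl
      ⟨add_mul_I_mem_upper u ht, hnorm t ht ht1⟩)
  have hball : ∀ z : ℂ, ‖z‖ < 1 → sroot m l z ∈ Metric.ball (0 : ℂ) 1 := fun z hz => by
    rw [mem_ball_zero_iff, norm_sroot]
    exact Real.rpow_lt_one (norm_nonneg _) hz (by positivity)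
  have hw₀ : sroot m l u ∈ closure (sector m ((l : ℝ) / (2 * m)) (((l : ℝ) + 1) / (2 * m))) ∩
      Metric.ball 0 1 := by
    refine ⟨mem_closure_of_tendsto (f := fun t : ℝ => sroot m l (u + t * I)) (b := 𝓝[>] 0) ?_ ?_,
      hball _ (by rwa [norm_real, Real.norm_eq_abs])⟩
    · rw [tendsto_iff_norm_sub_tendsto_zero]
      refine squeeze_zero' (Eventually.of_forall fun t => norm_nonneg _) (g := fun t => M * t) ?_ ?_
      · filter_upwards [eventually_small (A := 1) hε] with t ht
        exact hLip t ht.1.le (by linarith [ht.2])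
      · have : Tendsto (fun t : ℝ => M * t) (𝓝 0) (𝓝 (M * 0)) := Continuous.tendsto (by fun_prop) 0
        rw [mul_zero] at this
        exact this.mono_left nhdsWithin_le_nhds
    · filter_upwards [eventually_small (A := 1) (show 0 < 1 - |u| by linarith)] with t ht
      exact hsec t ht.1 (by linarith [ht.2])
  obtain ⟨n, -, hall⟩ := hh.exists_expansion hr0 Metric.isOpen_ball
    (convex_closure_sector_inter_ball hm l) (interior_closure_sector_inter_ball_nonempty hm l)
  obtain ⟨P, hP, E, hEm, hEo, hb⟩ := hall _ hw₀
  set T : ℂ → ℂ := fun z => ∑ d ∈ Finset.range (n + 1), P d (sroot m l z - sroot m l u) with hT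
  have hTs : Sym (halfDisc 1) p 0 T := Sym.sum _ fun d _ => sym_hom_sroot (hP d) m l p _
  obtain ⟨C, hC, hTb⟩ := hTs.norm_fwdDiff_le (fun z hz => hz.1) (Nat.cast_nonneg p)
  have hsplit : ∀ z h' : ℂ, (fwdDiff h')^[p] (fun z => h (sroot m l z)) z =
      (fwdDiff h')^[p] T z + (fwdDiff h')^[p] (fun z => h (sroot m l z) - T z) z := by
    intro z h'
    rw [← Pi.add_apply, ← fwdDiff_iter_add]
    exact congrArg (fun F => (fwdDiff h')^[p] F z) (funext fun z => by simp)
  simp only [hsplit]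
  have hsm := (eventually_small (A := (p : ℝ) + 1) (lt_min hε (show 0 < 1 - |u| by linarith)))
  have hpt : ∀ s : ℝ, 0 < s → ∀ t : ℝ, 0 ≤ t → t ≤ p * s →
      ((u + s * I : ℂ) + t * I) = u + ((s + t : ℝ) : ℂ) * I := fun s _ t _ _ => by push_cast; ring
  refine IsLittleO.add ?_ ?_
  -- Polynomial part: the modulus of the points is at least `|u|`, so the negative power of it is
  -- bounded.
  · refine IsBigO.trans_isLittleO (g := fun s : ℝ => s ^ (p : ℝ)) ?_ (rpow_isLittleO_rpow hβp)
    refine IsBigO.of_bound (C * |u| ^ (0 - (p : ℝ))) ?_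
    filter_upwards [hsm] with s hs
    refine (hTb _ s hs.1.le fun t ht0 ht => ?_).trans ?_
    · rw [hpt s hs.1 t ht0 ht]
      refine ⟨add_mul_I_mem_upper u (by linarith [hs.1]), hnorm _ (by linarith [hs.1]) ?_⟩
      have := hs.2.trans_le (min_le_right _ _)
      linarith
    · rw [Real.rpow_natCast, Real.norm_of_nonneg (pow_nonneg hs.1.le p), mul_right_comm]
      refine mul_le_mul_of_nonneg_right (mul_le_mul_of_nonneg_left ?_ hC) (pow_nonneg hs.1.le p)
      refine Real.rpow_le_rpow_of_nonpos hu0 ?_ (by simp)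
      simpa using Complex.abs_re_le_norm (u + s * I : ℂ)
  -- Error part: a `p`-th difference involves heights up to `(p+1)s`, and by the Lipschitz bound all
  -- points are within `M(p+1)s` of the centre.
  · have hK : 0 < M * (p + 1) := by positivity
    refine IsBigO.trans_isLittleO (IsBigO.of_bound (2 ^ p) ?_) (isLittleO_comp_mul hK (hEo β hβ))
    filter_upwards [hsm] with s hs
    refine (norm_fwdDiff_iterate_le fun i hi => ?_).trans
      (mul_le_mul_of_nonneg_left (le_abs_self (E (M * (p + 1) * s))) (by positivity))
    have hi' : (i : ℝ) ≤ p := by exact_mod_cast hi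
    have e : (u + s * I + i * (s * I) : ℂ) = u + ((s + i * s : ℝ) : ℂ) * I := by push_cast; ring
    have ht0 : 0 < s + i * s := by have := hs.1; positivity
    have htle : s + i * s ≤ (p + 1) * s := by nlinarith [hs.1]
    have h1 := (htle.trans_lt hs.2).trans_le (min_le_left _ _)
    have h2 := (htle.trans_lt hs.2).trans_le (min_le_right _ _)
    rw [e]
    refine (hb _ ⟨subset_closure (hsec _ ht0 h2), hball _ (hnorm _ ht0 h2)⟩).trans ?_
    refine hEm (norm_nonneg _) (mul_nonneg hK.le hs.1.le) ?_
    refine (hLip _ ht0.le h1).trans ?_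
    rw [mul_assoc]
    exact mul_le_mul_of_nonneg_left htle hM.le

theorem ord_lt_ord {m : ℕ} (hm : 2 ≤ m) {j k : ℕ} (h : j < k) : ord m j < ord m k := by
  have h1 : (j : ℝ) < k := by exact_mod_cast h
  have hm0 : (0 : ℝ) < m := by positivity
  rw [ord, ord, div_lt_div_iff_of_pos_right hm0]
  linarith

theorem pow_mul_pow_rpow_ord {m : ℕ} (hm : 2 ≤ m) (j : ℕ) {μ : ℝ} (hμ : 0 < μ) :
    μ ^ (m - 2) * (μ ^ m) ^ (ord m j) = μ ^ j := by
  have hm0 : (m : ℝ) ≠ 0 := by positivity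
  rw [← Real.rpow_natCast, ← Real.rpow_natCast, ← Real.rpow_natCast, ← Real.rpow_mul hμ.le,
    ← Real.rpow_add hμ]
  congr 1
  rw [Nat.cast_sub hm, ord]
  push_cast
  field_simp; ring

/-- The regularised integrals of the homogeneous parts of the integrand vanish. -/
theorem sum_hcoeff_mul_regInt_eq_zero {m : ℕ} (hm : 2 ≤ m) {k j l p : ℕ} (hjk : j < k)
    (hl : l < 2 * m) (hp : ord m k < p) {f h : ℂ → ℂ} (hf : ContDiffAt ℝ (max k p : ℕ) f 0)
    (hfc : ContinuousOn f (domainD m)) {r : REta} (hr0 : 0 < r.v) (hj : ord m j < r.v)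
    (hh : IsCr r (closure (sector m ((l : ℝ) / (2 * m)) (((l : ℝ) + 1) / (2 * m)))) h)
    (heq : Set.EqOn h (FF m f) (sector m ((l : ℝ) / (2 * m)) (((l : ℝ) + 1) / (2 * m)))) :
    ∑ a ∈ Finset.range (j + 1), hcoeff m l f j a * regInt p (expo m a) (expo m (j - a)) 1 = 0 := by
  obtain ⟨K, ρ, hρ, hρ1, hKc, hKs, hexp⟩ :=
    exists_integrand_expansion hm (le_max_left k p) hf hfc l
  have hKs' := hKs.of_le (le_max_right k p)
  set δ := ρ / 2 with hδ
  have hδ0 : 0 < δ := by positivity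
  have hjo := ord_lt_ord hm hjk
  have hσ : ∀ i < k, ∀ a ≤ i, 1 < expo m a + expo m (i - a) + p := fun i hi a ha => by
    rw [expo_add hm ha]; linarith [ord_lt_ord hm hi]
  set A : ℕ → ℂ := fun i => ∑ a ∈ Finset.range (i + 1),
    hcoeff m l f i a * regInt p (expo m a) (expo m (i - a)) 1 with hA
  -- Substituting `s = μ^m` and multiplying by `μ^(m-2)` turns `s^(ord m i)` into `μ^i`, so the
  -- coefficient of `μ^j` can be read off.
  suffices hV : (fun s : ℝ => ∑ i ∈ Finset.range k, ((s ^ ord m i : ℝ) : ℂ) * A i) =o[𝓝[>] 0]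
      fun s : ℝ => s ^ ord m j by
    set pol : Polynomial ℂ :=
      ∑ i ∈ Finset.range k, Polynomial.C (A i) * Polynomial.X ^ i with hpol
    have hlim : Tendsto (fun μ : ℝ => μ ^ m) (𝓝[>] 0) (𝓝[>] 0) := by
      refine tendsto_nhdsWithin_iff.2 ⟨?_, ?_⟩
      · have : Tendsto (fun μ : ℝ => μ ^ m) (𝓝 0) (𝓝 (0 ^ m)) := Continuous.tendsto (by fun_prop) 0
        rw [zero_pow (by omega)] at this
        exact this.mono_left nhdsWithin_le_nhds
      · filter_upwards [self_mem_nhdsWithin] with μ hμ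
        exact pow_pos (Set.mem_Ioi.1 hμ) m
    have h1 : (fun μ : ℝ => (μ : ℂ) ^ (m - 2)) =O[𝓝[>] 0] fun μ : ℝ => μ ^ (m - 2) :=
      IsBigO.of_bound 1 (Eventually.of_forall fun μ => by simp)
    have hsmall : (fun μ : ℝ => pol.eval (μ : ℂ)) =o[𝓝[>] 0] fun μ : ℝ => μ ^ j := by
      refine (h1.mul_isLittleO (hV.comp_tendsto hlim)).congr' ?_ ?_
      · filter_upwards [self_mem_nhdsWithin] with μ hμ
        rw [hpol, Polynomial.eval_finsetSum]
        simp only [Function.comp_apply, Finset.mul_sum, Polynomial.eval_mul, Polynomial.eval_C,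
          Polynomial.eval_pow, Polynomial.eval_X]
        refine Finset.sum_congr rfl fun i _ => ?_
        rw [← mul_assoc, ← ofReal_pow, ← ofReal_mul, pow_mul_pow_rpow_ord hm i hμ, ofReal_pow,
          mul_comm]
      · filter_upwards [self_mem_nhdsWithin] with μ hμ
        exact pow_mul_pow_rpow_ord hm j hμ
    have := coeff_eq_zero_of_isLittleO hsmall j le_rfl
    rw [hpol, Polynomial.finsetSum_coeff] at this
    simp only [Polynomial.coeff_C_mul_X_pow] at this
    rwa [Finset.sum_ite_eq, if_pos (Finset.mem_range.2 hjk)] at this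
  set U : ℂ → ℂ := fun z => h (sroot m l z) with hU
  set Ek : ℕ → ℕ → ℝ → ℂ := fun i a s =>
    (∫ v in (-δ)..δ, (fwdDiff (s * I))^[p] (kap (expo m a) (expo m (i - a))) (v + s * I)) -
      ((s ^ (1 - (expo m a + expo m (i - a))) : ℝ) : ℂ) *
        regInt p (expo m a) (expo m (i - a)) 1 with hEk
  have hdisc : ∀ t : ℝ, 0 < t → t < δ → ∀ v ∈ Set.uIcc (-δ) δ, (v + t * I : ℂ) ∈ halfDisc ρ := by
    intro t ht htδ v hv
    rw [Set.uIcc_of_le (by linarith)] at hv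
    refine ⟨add_mul_I_mem_upper v ht, (norm_add_le _ _).trans_lt ?_⟩
    rw [norm_mul, norm_I, norm_real, norm_real, mul_one, Real.norm_eq_abs, Real.norm_eq_abs,
      abs_of_pos ht]
    have := abs_le.2 hv
    linarith
  -- With `δ = ρ/2` and `(p+1)s < δ`, every point of the difference scheme over `[-δ, δ]` remains in
  -- the half disc of radius `ρ`.
  have hsm := eventually_small (A := (p : ℝ) + 1) hδ0
  have main : ∀ᶠ s : ℝ in 𝓝[>] 0, ∑ i ∈ Finset.range k, ((s ^ ord m i : ℝ) : ℂ) * A i =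
      (-1) ^ l * ((fwdDiff (s * I))^[p] U ((δ : ℝ) + s * I) -
        (fwdDiff (s * I))^[p] U ((-δ : ℝ) + s * I)) -
      (∑ i ∈ Finset.range k, ∑ a ∈ Finset.range (i + 1), hcoeff m l f i a * Ek i a s) -
      ∫ v in (-δ)..δ, (fwdDiff (s * I))^[p] K (v + s * I) := by
    filter_upwards [hsm] with s hs
    have hs0 := hs.1
    have hint : (fwdDiff (s * I))^[p] U ((δ : ℝ) + s * I) -
        (fwdDiff (s * I))^[p] U ((-δ : ℝ) + s * I) =
        ∫ v in (-δ)..δ, (fwdDiff (s * I))^[p] (fun z => (-1) ^ l * integrand m l f z)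
          (v + s * I) := by
      have hboxm : ∀ t : ℝ, 0 < t → t ≤ 1 → ∀ v ∈ Set.uIcc (-δ) δ, (v + t * I : ℂ) ∈ box := by
        intro t ht ht1 v hv
        rw [Set.uIcc_of_le (by linarith)] at hv
        have := abs_le.2 hv
        simp only [box, Set.mem_ofPred_eq]
        simp [ht, ht1]
        linarith
      refine integral_fwdDiff_eq (τ := 1) hs0 (fun t ht ht1 => ?_) (fun t ht ht1 => ?_) hs0
        (by linarith)
      · simp only [hU]
        rw [heq (sroot_mem_sector hm l (hboxm t ht ht1 _ Set.right_mem_uIcc)),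
          heq (sroot_mem_sector hm l (hboxm t ht ht1 _ Set.left_mem_uIcc)),
          FF_sub hm hfc hl ht ht1 (by rw [abs_neg, abs_of_pos hδ0]; linarith)
          (by rw [abs_of_pos hδ0]; linarith), intervalIntegral.integral_const_mul]
      · exact (continuousOn_const.mul ((continuousOn_integrand hm l hfc).comp (by fun_prop)
          (hboxm t ht ht1))).intervalIntegrable
    have hpt : ∀ v : ℝ, (fwdDiff (s * I))^[p] (fun z => (-1) ^ l * integrand m l f z)
        (v + s * I) = (-1) ^ l * ((∑ i ∈ Finset.range k, ∑ a ∈ Finset.range (i + 1),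
          hcoeff m l f i a *
            (fwdDiff (s * I))^[p] (kap (expo m a) (expo m (i - a))) (v + s * I)) +
          (fwdDiff (s * I))^[p] K (v + s * I)) := by
      intro v
      rw [fwdDiff_iterate_congr (L := ((-1 : ℂ) ^ l) • ((∑ i ∈ Finset.range k,
        ∑ a ∈ Finset.range (i + 1), hcoeff m l f i a • kap (expo m a) (expo m (i - a))) + K))]
      · simp only [fwdDiff_iter_const_smul, fwdDiff_iter_add, fwdDiff_iter_finsetSum]
        simp [Finset.sum_apply]
      · intro i _
        rw [hexp]
        · simp [Finset.sum_apply]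
        · rw [show (v + s * I + i * (s * I) : ℂ) = v + ((s + i * s : ℝ) : ℂ) * I by
            push_cast; ring]
          exact add_mul_I_mem_upper v (by positivity)
    have iK : IntervalIntegrable (fun v : ℝ => (fwdDiff (s * I))^[p] K (v + s * I))
        volume (-δ) δ :=
      intervalIntegrable_fwdDiff (τ := (p + 1) * s) hs0 (fun t ht htτ =>
        (hKc.comp (by fun_prop) (hdisc t ht (htτ.trans_lt hs.2))).intervalIntegrable) hs0
        (by linarith)
    have hcont : ∀ i a : ℕ, Continuous fun v : ℝ => hcoeff m l f i a *
        (fwdDiff (s * I))^[p] (kap (expo m a) (expo m (i - a))) (v + s * I) := fun i a =>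
      continuous_const.mul
        (continuous_line (continuousOn_fwdDiff_iterate (continuousOn_kap _ _) hs0.le p) hs0)
    rw [hint]
    simp only [hpt]
    rw [intervalIntegral.integral_const_mul, ← mul_assoc, ← pow_add,
      Even.neg_one_pow ⟨l, rfl⟩, one_mul, intervalIntegral.integral_add
        ((continuous_finsetSum _ fun i _ => continuous_finsetSum _ fun a _ =>
          hcont i a).intervalIntegrable _ _) iK,
      intervalIntegral.integral_finsetSum fun i _ =>
        (continuous_finsetSum _ fun a _ => hcont i a).intervalIntegrable _ _, add_sub_right_comm,
      add_sub_cancel_right, ← Finset.sum_sub_distrib]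
    refine Finset.sum_congr rfl fun i _ => ?_
    rw [intervalIntegral.integral_finsetSum fun a _ => (hcont i a).intervalIntegrable _ _,
      ← Finset.sum_sub_distrib, hA, Finset.mul_sum]
    refine Finset.sum_congr rfl fun a ha => ?_
    rw [intervalIntegral.integral_const_mul, hEk]
    simp only
    rw [expo_add hm (by have := Finset.mem_range.1 ha; omega), sub_sub_cancel]
    ring
  refine IsLittleO.congr' ?_ (main.mono fun s hs => hs.symm) EventuallyEq.rfl
  have hlt1 : |δ| < 1 := by rw [abs_of_pos hδ0]; linarith
  refine ((((fwdDiff_comp_sroot_isLittleO hm l hr0 hh hδ0.ne' hlt1 hj (hjo.trans hp)).sub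
    (fwdDiff_comp_sroot_isLittleO hm l hr0 hh (neg_ne_zero.2 hδ0.ne') (by rwa [abs_neg]) hj
      (hjo.trans hp))).const_mul_left _).sub
    (IsLittleO.fun_sum fun i hi => IsLittleO.fun_sum fun a ha => IsLittleO.const_mul_left ?_ _)).sub ?_
  · obtain ⟨C, hC⟩ := norm_integral_fwdDiff_kap_sub_le
      (hσ i (Finset.mem_range.1 hi) a (by have := Finset.mem_range.1 ha; omega)) hδ0
    refine IsBigO.trans_isLittleO (g := fun s : ℝ => s ^ (p : ℝ)) (IsBigO.of_bound C ?_)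
      (rpow_isLittleO_rpow (hjo.trans hp))
    filter_upwards [self_mem_nhdsWithin] with s hs
    rw [Real.rpow_natCast, Real.norm_of_nonneg (pow_nonneg (le_of_lt hs) p)]
    exact hC s hs
  · obtain ⟨C, hC⟩ := norm_integral_fwdDiff_remainder_le (by linarith) hKs' hδ0
    refine IsBigO.trans_isLittleO (g := fun s : ℝ => s ^ (ord m k)) (IsBigO.of_bound C ?_)
      (rpow_isLittleO_rpow hjo)
    filter_upwards [hsm] with s hs
    rw [Real.norm_of_nonneg (Real.rpow_nonneg hs.1.le _)]
    have := hC s hs.1 (by linarith [hs.2])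
    rwa [sub_add_cancel] at this

/-! ### The analytic continuation of the beta integral -/

/-- The Pochhammer regularisation of `cauchyBeta x y`. -/
noncomputable def regBeta (p : ℕ) (x y : ℝ) : ℂ :=
  (∏ i ∈ Finset.range p, ((y + i : ℝ) : ℂ)) * cauchyBeta x (y + p)

/-- The integration by parts for `cauchyBeta` at `y + p`; the Pochhammer products starting at `y`
and `y + 1` share all but their end factors, which turns `y + p` into `y`. -/
theorem regBeta_shift {p : ℕ} {x y : ℝ} (h : 1 < x + y + p) :
    (1 - x) * regBeta p x y = y * regBeta p (x - 1) (y + 1) := by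
  have h1 := cauchyBeta_shift (x := x) (y := y + p) (by linarith)
  have h2 : (∏ i ∈ Finset.range p, ((y + i : ℝ) : ℂ)) * ((y + p : ℝ) : ℂ) =
      (∏ i ∈ Finset.range p, ((y + 1 + i : ℝ) : ℂ)) * y := by
    have h3 := Finset.prod_range_succ' (fun i : ℕ => ((y + i : ℝ) : ℂ)) p
    rw [Finset.prod_range_succ] at h3
    rw [h3]
    congr 1
    · exact Finset.prod_congr rfl fun i _ => by push_cast; ring
    · simp
  rw [regBeta, regBeta, show y + 1 + (p : ℝ) = y + p + 1 by ring]
  linear_combination (∏ i ∈ Finset.range p, ((y + i : ℝ) : ℂ)) * h1 +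
    cauchyBeta (x - 1) (y + p + 1) * h2

/-! ### Recursion of the beta values along residue classes mod `m` -/

theorem regBeta_expo_shift {m j a p : ℕ} (hm : 2 ≤ m) (h : ord m j < p) (ha : a + m ≤ j) :
    ((a : ℂ) + m - (j + 1)) * regBeta p (expo m (a + m)) (expo m (j - (a + m))) =
      (a + 1) * regBeta p (expo m a) (expo m (j - a)) := by
  have hm0 : (m : ℝ) ≠ 0 := by positivity
  have hmC : (m : ℂ) ≠ 0 := by exact_mod_cast hm0
  have hs := regBeta_shift (p := p) (x := expo m a) (y := expo m (j - a))
    (by rw [expo_add hm (by omega)]; linarith)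
  have e1 : expo m a - 1 = expo m (a + m) := by
    rw [expo, expo]; push_cast; field_simp; ring
  have e2 : expo m (j - a) + 1 = expo m (j - (a + m)) := by
    rw [expo, expo]; push_cast [Nat.cast_sub ha, Nat.cast_sub (show a ≤ j by omega)]
    field_simp; ring
  have e3 : (1 : ℂ) - (expo m a : ℝ) = (a + 1) / m := by
    rw [expo]; push_cast; field_simp; ring
  have e4 : ((expo m (j - a) : ℝ) : ℂ) = (a + m - (j + 1)) / m := by
    rw [expo]; push_cast [Nat.cast_sub (show a ≤ j by omega)]; field_simp; ring
  rw [e1, e2, e3, e4, div_mul_eq_mul_div, div_mul_eq_mul_div, div_left_inj' hmC] at hs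
  exact hs.symm

/-- Here the second parameter is the nonpositive integer `-t`. At `t = 0` the Pochhammer product has
the factor 0, and the shift carries the zero down the class. -/
theorem regBeta_expo_eq_zero_of_add_eq {m j p : ℕ} (hm : 2 ≤ m) (hp : 0 < p) (h : ord m j < p)
    (t : ℕ) : ∀ a, a + (t + 1) * m = j + 1 → regBeta p (expo m a) (expo m (j - a)) = 0 := by
  induction t with
  | zero =>
    intro a ha
    have h0 : expo m (j - a) = 0 := by
      have : j - a = m - 1 := by omega
      rw [this, expo, Nat.cast_sub (by omega)]; simp
    rw [regBeta, h0, Finset.prod_eq_zero (Finset.mem_range.2 hp) (by simp), zero_mul]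
  | succ t ih =>
    intro a ha
    have ha' : a + m + (t + 1) * m = j + 1 := by rw [← ha]; ring
    have hm' : m ≤ (t + 1) * m := Nat.le_mul_of_pos_left m (by omega)
    have hs := regBeta_expo_shift (a := a) hm h (by omega)
    rw [ih _ ha', mul_zero, eq_comm] at hs
    exact (mul_eq_zero.1 hs).resolve_left (by exact_mod_cast Nat.succ_ne_zero a)

/-- Here the first parameter is the nonpositive integer `-n`. The start `n = 0` follows from the
shift relation at `x = 1`, whose left side has the factor `1 - x`. -/
theorem regBeta_expo_eq_zero_of_residue {m j p : ℕ} (hm : 2 ≤ m) (h : ord m j < p) (n : ℕ)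
    (hn : m - 1 + n * m ≤ j) :
    regBeta p (expo m (m - 1 + n * m)) (expo m (j - (m - 1 + n * m))) = 0 := by
  have hm0 : (m : ℝ) ≠ 0 := by positivity
  induction n with
  | zero =>
    simp only [zero_mul, add_zero] at hn ⊢
    have h0 : expo m (m - 1) = 0 := by rw [expo, Nat.cast_sub (by omega)]; simp
    have h1 := expo_add hm hn
    rw [h0] at h1 ⊢
    have hs := regBeta_shift (p := p) (x := 1) (y := expo m (j - (m - 1)) - 1) (by linarith)
    simp only [ofReal_one, sub_self, zero_mul, sub_add_cancel] at hs
    refine (mul_eq_zero.1 hs.symm).resolve_left ?_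
    have h2 : (m : ℝ) ≤ j + 1 := by exact_mod_cast (show m ≤ j + 1 by omega)
    have h3 : expo m (j - (m - 1)) - 1 ≠ 0 := by
      rw [expo, Nat.cast_sub hn, Nat.cast_sub (by omega), div_sub_one hm0]
      refine div_ne_zero ?_ hm0
      push_cast
      intro h; linarith
    exact_mod_cast h3
  | succ n ih =>
    have e : m - 1 + (n + 1) * m = m - 1 + n * m + m := by ring
    rw [e] at hn ⊢
    have hs := regBeta_expo_shift hm h hn
    rw [ih (by omega), mul_zero] at hs
    refine (mul_eq_zero.1 hs).resolve_left (sub_ne_zero.2 ?_)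
    exact_mod_cast (show m - 1 + n * m + m ≠ j + 1 by omega)

/-- The shift relation for the beta values and the recursion for `chooseRatio` are the same
recursion; this is why the same functionals `∂^j_i` occur in both conclusions. -/
theorem regBeta_expo_eq_chooseRatio_mul {m j i p : ℕ} (hm : 2 ≤ m) (h : ord m j < p)
    (hi : Relevant m j i) (n : ℕ) (hn : i + n * m ≤ j) :
    regBeta p (expo m (i + n * m)) (expo m (j - (i + n * m))) =
      chooseRatio m j i n * regBeta p (expo m i) (expo m (j - i)) := by
  induction n with
  | zero => simp [chooseRatio]
  | succ n ih =>
    have e : i + (n + 1) * m = i + n * m + m := by ring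
    rw [e] at hn ⊢
    have hs := regBeta_expo_shift hm h hn
    rw [ih (by omega)] at hs
    have hr : (chooseRatio m j i (n + 1) : ℂ) * ((j : ℂ) + 1 - (i + (n + 1 : ℕ) * m)) =
        -(chooseRatio m j i n * (i + n * m + 1)) := by
      exact_mod_cast congrArg (fun t : ℝ => (t : ℂ)) (chooseRatio_succ hm hi n)
    have hne : ((i + n * m : ℕ) : ℂ) + m - (j + 1) ≠ 0 := by
      rw [sub_ne_zero]
      have := hi.ne hm n
      exact_mod_cast (show i + n * m + m ≠ j + 1 by omega)
    refine mul_left_cancel₀ hne (hs.trans ?_)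
    push_cast at hr ⊢
    linear_combination regBeta p (expo m i) (expo m (j - i)) * hr

/-! ### Comparison with the beta-like function -/

theorem Gamma_add_natCast {y : ℝ} (hy : ∀ n : ℕ, y ≠ -n) (p : ℕ) :
    Real.Gamma (y + p) = (∏ i ∈ Finset.range p, (y + i)) * Real.Gamma y := by
  induction p with
  | zero => simp
  | succ p ih =>
    have h0 : y + p ≠ 0 := fun h => hy p (by linarith)
    rw [Finset.prod_range_succ, mul_right_comm, ← ih, Nat.cast_succ, ← add_assoc,
      Real.Gamma_add_one h0, mul_comm]

theorem gammaExt_eq {x : ℝ} (hx : ∀ n : ℕ, x ≠ -n) : gammaExt x = Real.Gamma x :=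
  if_neg (hx _)

/-- The quotient of the two functions depends only on `x + y` and `p`, hence is common to all
indices of one degree. The conventional values of `gammaExt` at `x + y - 1` enter only through this
common factor. -/
theorem betaLike_eq {x y : ℝ} {p : ℕ} (hx : 0 < x) (hyp : 1 < y + p) (hy : ∀ n : ℕ, y ≠ -n)
    {σ : ℝ} (hσ : x + y = σ) :
    betaLike x y = (((gammaExt (σ - 1) / ((2 : ℝ) ^ (σ - 2) * (2 * 2 ^ (1 - (σ + p)) *
      Real.Gamma (σ + p - 1))) : ℝ) : ℂ) * cexp (-(I * (Real.pi / 2) * p))) * regBeta p x y := by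
  subst hσ
  have hx' : ∀ n : ℕ, x ≠ -n := fun n h => by
    have : (0 : ℝ) ≤ n := Nat.cast_nonneg n
    linarith
  have hGx := Real.Gamma_ne_zero hx'
  have hGy := Real.Gamma_ne_zero hy
  have hG := (Real.Gamma_pos_of_pos (show 0 < x + y + p - 1 by linarith)).ne'
  have hprod : (∏ i ∈ Finset.range p, (y + i)) ≠ 0 :=
    Finset.prod_ne_zero_iff.2 fun i _ h => hy i (by linarith)
  rw [regBeta, cauchyBeta_eq hx hyp, betaLike, gammaExt_eq hx', gammaExt_eq hy,
    Gamma_add_natCast hy, ← add_assoc x y]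
  have hexp : cexp (I * (Real.pi / 2) * (y - x)) =
      cexp (-(I * (Real.pi / 2) * p)) * cexp (I * (Real.pi / 2) * ((y + p : ℝ) - x)) := by
    rw [← Complex.exp_add]; congr 1; push_cast; ring
  rw [hexp, ← ofReal_prod]
  have h2 : (2 : ℝ) ^ (x + y - 2) ≠ 0 := (Real.rpow_pos_of_pos two_pos _).ne'
  have h3 : (2 : ℝ) ^ (1 - (x + y + p)) ≠ 0 := (Real.rpow_pos_of_pos two_pos _).ne'
  generalize (2 : ℝ) ^ (x + y - 2) = A at *
  generalize (2 : ℝ) ^ (1 - (x + y + p)) = B at *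
  generalize (∏ i ∈ Finset.range p, (y + (i : ℝ))) = D at *
  generalize Real.Gamma x = a at *
  generalize Real.Gamma y = b at *
  generalize Real.Gamma (x + y + p - 1) = g at *
  generalize gammaExt (x + y - 1) = g' at *
  have h2' : (A : ℂ) ≠ 0 := by exact_mod_cast h2
  have h3' : (B : ℂ) ≠ 0 := by exact_mod_cast h3
  have h4' : (D : ℂ) ≠ 0 := by exact_mod_cast hprod
  have h5' : (a : ℂ) ≠ 0 := by exact_mod_cast hGx
  have h6' : (b : ℂ) ≠ 0 := by exact_mod_cast hGy
  have h7' : (g : ℂ) ≠ 0 := by exact_mod_cast hG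
  push_cast
  field_simp

/-! ### Vanishing of `𝒞^j_l` -/

/-- Every `a ≤ j` is `i + n m` with `i < m`. If `i` is not relevant, it is either `m - 1` or
congruent to `j + 1`, and these are the two classes on which `g` is assumed to vanish. -/
theorem sum_range_eq_sum_relevant {m j : ℕ} (hm : 2 ≤ m) {g : ℕ → ℂ}
    (h1 : ∀ n, m - 1 + n * m ≤ j → g (m - 1 + n * m) = 0)
    (h2 : ∀ t a, a + (t + 1) * m = j + 1 → g a = 0) :
    ∑ i ∈ (Finset.range (min j (m - 2) + 1)).filter (Relevant m j),
      ∑ n ∈ Finset.range ((j - i) / m + 1), g (i + n * m) = ∑ a ∈ Finset.range (j + 1), g a := by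
  rw [Finset.sum_sigma']
  have hmem : ∀ q : (_ : ℕ) × ℕ, q ∈ ((Finset.range (min j (m - 2) + 1)).filter (Relevant m j)).sigma
      (fun i => Finset.range ((j - i) / m + 1)) ↔
      Relevant m j q.1 ∧ q.2 ∈ Finset.range ((j - q.1) / m + 1) := by
    intro q
    rw [Finset.mem_sigma, Finset.mem_filter, Finset.mem_range]
    exact ⟨fun h => ⟨h.1.2, h.2⟩, fun h => ⟨⟨Nat.lt_succ_of_le h.1.1, h.1⟩, h.2⟩⟩
  refine Finset.sum_of_injOn (fun q => q.1 + q.2 * m) ?_ ?_ ?_ fun _ _ => rfl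
  · rintro ⟨i, n⟩ hi ⟨i', n'⟩ hi' heq
    have him := (((hmem _).1 hi).1.1).trans (min_le_right _ _)
    have him' := (((hmem _).1 hi').1.1).trans (min_le_right _ _)
    simp only at heq him him'
    have e1 := congrArg (· % m) heq
    have e2 := congrArg (· / m) heq
    simp only [Nat.add_mul_mod_self_right] at e1
    rw [Nat.mod_eq_of_lt (by omega), Nat.mod_eq_of_lt (by omega)] at e1
    subst e1
    have : n = n' := Nat.eq_of_mul_eq_mul_right (show 0 < m by omega) (by omega)
    rw [this]
  · rintro ⟨i, n⟩ hi
    obtain ⟨hr, hn⟩ := (hmem _).1 hi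
    have := add_mul_le_of_mem_range (hr.1.trans (min_le_left _ _)) hn
    exact Finset.mem_coe.2 (Finset.mem_range.2 (Nat.lt_succ_of_le this))
  · intro a ha hnot
    have haj : a ≤ j := Nat.lt_succ_iff.1 (Finset.mem_range.1 ha)
    have hlt : a % m < m := Nat.mod_lt _ (by omega)
    have hdm : a % m + a / m * m = a := Nat.mod_add_div' a m
    by_cases hc : a % m = m - 1
    · rw [hc] at hdm
      rw [← hdm]; exact h1 _ (by omega)
    · have him : a % m ≤ min j (m - 2) := le_min ((Nat.mod_le a m).trans haj) (by omega)
      have hnr : ¬ Relevant m j (a % m) := by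
        intro hr
        refine hnot ⟨⟨a % m, a / m⟩, Finset.mem_coe.2 ((hmem _).2 ⟨hr, ?_⟩), hdm⟩
        rw [Finset.mem_range, Nat.lt_succ_iff, Nat.le_div_iff_mul_le (by omega)]
        simp only; omega
      have hmod : ((a % m : ℕ) : ℤ) ≡ (j : ℤ) - ((m : ℤ) - 1) [ZMOD (m : ℤ)] := by
        by_contra hcon; exact hnr ⟨him, hcon⟩
      obtain ⟨t, ht⟩ := (Int.modEq_iff_dvd.1 hmod)
      have hdm' : ((a % m : ℕ) : ℤ) + (a / m : ℕ) * m = a := by exact_mod_cast hdm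
      have hm0 : (0 : ℤ) < m := by exact_mod_cast (show 0 < m by omega)
      have hja : (a : ℤ) + (t - (a / m : ℕ) + 1) * m = j + 1 := by linear_combination -ht - hdm'
      have haj' : (a : ℤ) ≤ j := by exact_mod_cast haj
      have hpos : 0 < t - (a / m : ℕ) + 1 := by
        by_contra! hneg
        have := mul_nonpos_of_nonpos_of_nonneg hneg hm0.le
        linarith
      obtain ⟨t', ht'⟩ := Int.eq_ofNat_of_zero_le (show 0 ≤ t - (a / m : ℕ) by omega)
      rw [ht'] at hja
      exact h2 t' a (by exact_mod_cast hja)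

theorem wmono_theta0_eq_zpow {m l i j : ℕ} (hij : i ≤ j) :
    wmono i (j - i) (theta0 m ^ l) = theta0 m ^ ((l : ℤ) * (2 * (i : ℤ) - (j : ℤ))) := by
  have h0 : theta0 m ≠ 0 := Complex.exp_ne_zero _
  have hn : ‖theta0 m‖ = 1 := by simpa using norm_theta0_pow m 1
  have hc : conj (theta0 m) = (theta0 m)⁻¹ := (Complex.inv_eq_conj hn).symm
  rw [wmono, map_pow, hc, ← zpow_natCast, ← zpow_natCast, ← zpow_natCast, ← zpow_natCast, inv_zpow',
    ← zpow_mul, ← zpow_mul, ← zpow_add₀ h0]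
  congr 1
  push_cast [Nat.cast_sub hij]
  ring

/-- The inner sums over residue classes assemble into `∂^j_i(f)`. The constant `c` need not be
nonzero, as only the vanishing of the sum is transferred. The condition `ord m j + 1 < p` ensures
`expo m (j - i) + p > 1`, as the evaluation of the beta integral requires. -/
theorem scriptC_eq_mul_sum {m j p : ℕ} (hm : 2 ≤ m) (hp : ord m j + 1 < p) (hp0 : 0 < p) (l : ℕ)
    (f : ℂ → ℂ) : ∃ c : ℂ, scriptC m j l f = c * ∑ a ∈ Finset.range (j + 1),
      hcoeff m l f j a * regBeta p (expo m a) (expo m (j - a)) := by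
  have hm0 : (0 : ℝ) < m := by positivity
  have hord : ord m j < p := by linarith
  set lam : ℂ := (((gammaExt ((1 - ord m j) - 1) / ((2 : ℝ) ^ ((1 - ord m j) - 2) *
    (2 * 2 ^ (1 - ((1 - ord m j) + p)) * Real.Gamma ((1 - ord m j) + p - 1))) : ℝ) : ℂ) *
    cexp (-(I * (Real.pi / 2) * p))) with hlam
  refine ⟨lam * j.factorial, ?_⟩
  rw [← sum_range_eq_sum_relevant hm, scriptC, Finset.mul_sum]
  · refine Finset.sum_congr rfl fun i hi => ?_
    have hr : Relevant m j i := (Finset.mem_filter.1 hi).2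
    have hij : i ≤ j := hr.1.trans (min_le_left _ _)
    have him : i ≤ m - 2 := hr.1.trans (min_le_right _ _)
    have himR : (i : ℝ) + 2 ≤ m := by exact_mod_cast (show i + 2 ≤ m by omega)
    have hx0 : 0 < expo m i := div_pos (by linarith) hm0
    have hx1 : expo m i < 1 := by
      rw [expo, div_lt_one hm0]
      have : (0 : ℝ) ≤ i := Nat.cast_nonneg i
      linarith
    have hadd := expo_add hm hij
    have hy : ∀ n : ℕ, expo m (j - i) ≠ -n := by
      intro n hn
      rw [expo, div_eq_iff hm0.ne', Nat.cast_sub hij] at hn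
      refine hr.ne hm n ?_
      have : ((i + n * m + (m - 1) : ℕ) : ℝ) = j := by
        push_cast [Nat.cast_sub (show 1 ≤ m by omega)]; linarith
      exact_mod_cast this
    have hb := betaLike_eq (p := p) hx0 (by linarith) hy hadd
    rw [← hlam] at hb
    have e2 : ((m : ℝ) - 1 - ((j : ℝ) - i)) / m = expo m (j - i) := by
      rw [expo, Nat.cast_sub hij]
    have hsum : ∑ n ∈ Finset.range ((j - i) / m + 1), hcoeff m l f j (i + n * m) *
        regBeta p (expo m (i + n * m)) (expo m (j - (i + n * m))) =
        regBeta p (expo m i) (expo m (j - i)) * ∑ n ∈ Finset.range ((j - i) / m + 1),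
          (chooseRatio m j i n : ℂ) * hcoeff m l f j (i + n * m) := by
      rw [Finset.mul_sum]
      refine Finset.sum_congr rfl fun n hn => ?_
      rw [regBeta_expo_eq_chooseRatio_mul hm hord hr n (add_mul_le_of_mem_range hij hn)]
      ring
    rw [hsum, e2, show ((m : ℝ) - 1 - i) / m = expo m i from rfl, hb, mul_right_comm,
      ← wmono_theta0_eq_zpow hij, wmono_mul_partialFun hm hij]
    ring
  · intro n hn
    rw [regBeta_expo_eq_zero_of_residue hm hord n hn, mul_zero]
  · intro t a ha
    rw [regBeta_expo_eq_zero_of_add_eq hm hp0 hord t a ha, mul_zero]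

theorem sum_hcoeff_mul_regInt {m j p : ℕ} (hm : 2 ≤ m) (hp : ord m j < p) (l : ℕ) (f : ℂ → ℂ) :
    ∑ a ∈ Finset.range (j + 1), hcoeff m l f j a * regInt p (expo m a) (expo m (j - a)) 1 =
      (2 * I) ^ p * regWeight (1 - ord m j + p) p 1 * ∑ a ∈ Finset.range (j + 1),
        hcoeff m l f j a * regBeta p (expo m a) (expo m (j - a)) := by
  rw [Finset.mul_sum]
  refine Finset.sum_congr rfl fun a ha => ?_
  have haj : a ≤ j := Nat.lt_succ_iff.1 (Finset.mem_range.1 ha)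
  have hadd := expo_add hm haj
  rw [regInt_eq (by rw [hadd]; linarith) one_pos, hadd, regBeta]
  ring

theorem domainD_mem_nhds {m : ℕ} (hm : 2 ≤ m) : domainD m ∈ 𝓝 (0 : ℂ) := by
  have h1 : Tendsto (fun w : ℂ => (w ^ m).re) (𝓝 0) (𝓝 ((0 : ℂ) ^ m).re) :=
    Continuous.tendsto (Complex.continuous_re.comp (continuous_pow m)) 0
  have h2 : Tendsto (fun w : ℂ => (w ^ m).im) (𝓝 0) (𝓝 ((0 : ℂ) ^ m).im) :=
    Continuous.tendsto (Complex.continuous_im.comp (continuous_pow m)) 0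
  rw [zero_pow (by omega)] at h1 h2
  have hI : Set.Icc (-1 : ℝ) 1 ∈ 𝓝 (0 : ℝ) := Icc_mem_nhds (by norm_num) (by norm_num)
  exact inter_mem (h1 hI) (h2 hI)

end SaddleLocal

/-! ### Assembly of the two conclusions -/

theorem mainTheorem8 (m : ℕ) (hm : 2 ≤ m) (k : ℕ) (hk : m - 1 ≤ k) (l : ℕ) (hl : l < 2 * m)
    (f : ℂ → ℂ)
    (hf : ContDiffOn ℝ ((max k (⌈SaddleLocal.ord m k⌉₊ + 1) : ℕ) : ℕ∞) f (SaddleLocal.domainD m))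
    (r : SaddleLocal.REta) (hr0 : 0 < r.v) (hrk : r.v ≤ SaddleLocal.ord m k)
    (hF : SaddleLocal.IsCrOnClosure r
      (SaddleLocal.sector m ((l : ℝ) / (2 * m)) (((l : ℝ) + 1) / (2 * m)))
      (SaddleLocal.FF m f)) :
    (∀ j : ℕ, SaddleLocal.ord m j < r.v → SaddleLocal.scriptC m j l f = 0) ∧
    (∀ j : ℕ, SaddleLocal.ordHat m j < r.v →
      ∀ i : ℕ, SaddleLocal.Relevant m j i → SaddleLocal.partialFun m j i f = 0) := by
  open SaddleLocal in
  obtain ⟨h, heq, hh⟩ := hF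
  have hm2 : (2 : ℝ) ≤ m := by exact_mod_cast hm
  have hf0 : ContDiffAt ℝ (max k (⌈ord m k⌉₊ + 1) : ℕ) f 0 := hf.contDiffAt (domainD_mem_nhds hm)
  have hfk : ContDiffAt ℝ k f 0 := hf0.of_le (by exact_mod_cast le_max_left _ _)
  have hfc : ContinuousOn f (domainD m) := hf.continuousOn
  have hlt : ∀ j : ℕ, ord m j < r.v → j < k := by
    intro j hj
    by_contra! hkj
    have h1 : (k : ℝ) ≤ j := by exact_mod_cast hkj
    have h2 : ord m k ≤ ord m j := by
      rw [ord, ord]; gcongr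
    linarith
  refine ⟨fun j hj => ?_, fun j hj i hi => ?_⟩
  · have hjk := hlt j hj
    have hceil := Nat.le_ceil (ord m k)
    have hp : ord m j + 1 < ((⌈ord m k⌉₊ + 1 : ℕ) : ℝ) := by
      push_cast; linarith [ord_lt_ord hm hjk]
    -- The difference order `⌈ord m k⌉ + 1` exceeds both `ord m k` and `ord m j + 1`, and it is the
    -- second number in the smoothness assumed of `f`.
    have hzero := sum_hcoeff_mul_regInt_eq_zero hm hjk hl (p := ⌈ord m k⌉₊ + 1)
      (by push_cast; linarith) hf0 hfc hr0 hj hh heq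
    rw [sum_hcoeff_mul_regInt hm (by linarith)] at hzero
    have hw := (regWeight_pos_antitone (σ := 1 - ord m j + (⌈ord m k⌉₊ + 1 : ℕ)) (by linarith)
      (⌈ord m k⌉₊ + 1)).1 1 one_pos
    have hne : (2 * Complex.I) ^ (⌈ord m k⌉₊ + 1) *
        (regWeight (1 - ord m j + (⌈ord m k⌉₊ + 1 : ℕ)) (⌈ord m k⌉₊ + 1) 1 : ℂ) ≠ 0 :=
      mul_ne_zero (pow_ne_zero _ (mul_ne_zero two_ne_zero Complex.I_ne_zero))
        (by exact_mod_cast hw.ne')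
    obtain ⟨c, hc⟩ := scriptC_eq_mul_sum hm hp (Nat.succ_pos _) l f
    rw [hc, (mul_eq_zero.1 hzero).resolve_left hne, mul_zero]
  · have hk' : (m : ℝ) ≤ k + 1 := by exact_mod_cast (show m ≤ k + 1 by omega)
    -- `ord m j` is `ordHat m j / m`: nonpositive together with `ordHat m j`, and otherwise at most
    -- `ordHat m j`. Either way it lies below `v(r)`.
    have hjk : j < k := by
      refine hlt j ?_
      by_cases hneg : ordHat m j ≤ 0
      · exact lt_of_le_of_lt (div_nonpos_of_nonpos_of_nonneg hneg (by positivity)) hr0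
      · refine lt_of_le_of_lt (div_le_self (le_of_not_ge hneg) (by linarith)) hj
    obtain ⟨q, hq0, hq⟩ := exists_homogeneous_primitive hm hjk hl hfk hfc hr0 hj hh heq
    obtain ⟨q', hq0', hq'⟩ := coeff_relation hm hq0 hq
    exact partialFun_eq_zero_of_coeff_relation hm hq0' hq' hi
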